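/- Let $L,\varepsilon,T>0$, $A\in\mathbb R$ and $\Omega=(0,L)^2$. Let $\Phi_0\in H^8_{\rm per}(\Omega)$, and let $\Phi$ be a solution on $[0,T]$ of the Cahn–Hilliard equation $\partial_t\Phi=\Delta\mu$, $\mu=\Phi^3-\Phi-\varepsilon^2\Delta\Phi$, on $\Omega$ with periodic boundary conditions and $\Phi(0)=\Phi_0$, of regularity class $$\Phi\in H^3(0,T;C^0)\cap H^2(0,T;H^4_{\rm per}(\Omega))\cap L^\infty(0,T;H^8_{\rm per}(\Omega))$$ (we take the representative that is continuous on $[0,T]$ with values in $C^0$). For a positive integer $m$ let $h=L/m$ and $x_i=y_i=(i-\tfrac12)h$. For a grid function $\nu=(\nu_{i,j})_{i,j\in\mathbb Z}$ that is $m$-periodic in each index, let $\|\nu\|_2=\big(h^2\sum_{i,j=1}^m\nu_{i,j}^2\big)^{1/2}$, let $\Delta_h$ be the standard five-point discrete Laplacian, and let $\Delta_{h,(4)}=\mathcal D^2_{x,(4)}+\mathcal D^2_{y,(4)}$ with $$\mathcal D^2_{x,(4)}\nu_{i,j}=\frac{-\nu_{i-2,j}+16\nu_{i-1,j}-30\nu_{i,j}+16\nu_{i+1,j}-\nu_{i+2,j}}{12h^2}$$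 and $\mathcal D^2_{y,(4)}$ defined in the same way in the index $j$. For a time step $\Delta t>0$, the numerical solution $\phi^{-1},\phi^0,\phi^1,\dots$ consists of periodic grid functions with $\phi^0_{i,j}=\Phi_0(x_i,y_j)$, $$\phi^{-1}=\phi^0-\Delta t\,\Delta_{h,(4)}\big((\phi^0)^3-\phi^0-\varepsilon^2\Delta_{h,(4)}\phi^0\big),$$ and, for $k\ge0$, $$\frac{\frac32\phi^{k+1}-2\phi^k+\frac12\phi^{k-1}}{\Delta t}=\Delta_{h,(4)}\Big((\phi^{k+1})^3-2\phi^k+\phi^{k-1}-\varepsilon^2\Delta_{h,(4)}\phi^{k+1}-A\Delta t\,\Delta_{h,(4)}(\phi^{k+1}-\phi^k)\Big).$$ Write $\Phi^k_{i,j}=\Phi(x_i,y_j,k\Delta t)$. Theorem. There are constants $C,\Delta t_0,h_0>0$, which may depend on $L,\varepsilon,A,T,\Phi$ but not on $\Delta t$, $h$ or $n$, such that whenever $0<\Delta t\le\Delta t_0$ and $h=L/m\le h_0$, every positive integer $n$ with $n\Delta t\le T$ and every numerical solution $\phi^{-1},\dots,\phi^n$ up to time level $n$ satisfy $$\|\Phi^n-\phi^n\|_2+\Big(\varepsilon^2\Delta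 t\sum_{k=1}^n\|\Delta_h(\Phi^k-\phi^k)\|_2^2\Big)^{1/2}\le C\,(\Delta t^2+h^4).$$ -/

import Mathlib

open MeasureTheory Set
open scoped ContDiff ENNReal BoundedContinuousFunction

noncomputable section

namespace CahnHilliard

/-! ### Periodic functions on the square `Ω = (0, L)²` -/

/-- The square `Ω = (0, L) × (0, L)`. -/
def Omega (L : ℝ) : Set (ℝ × ℝ) := Ioo 0 L ×ˢ Ioo 0 L

/-- Lebesgue measure on `Ω`. -/
abbrev measOmega (L : ℝ) : Measure (ℝ × ℝ) := volume.restrict (Omega L)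

/-- `f` is `L`-periodic in each of the two variables. -/
def PeriodicFun (L : ℝ) (f : ℝ × ℝ → ℝ) : Prop :=
  ∀ x y, f (x + L, y) = f (x, y) ∧ f (x, y + L) = f (x, y)

/-- The classical partial derivative in the first variable. -/
def dx (ψ : ℝ × ℝ → ℝ) : ℝ × ℝ → ℝ := fun p => deriv (fun s => ψ (s, p.2)) p.1

/-- The classical partial derivative in the second variable. -/
def dy (ψ : ℝ × ℝ → ℝ) : ℝ × ℝ → ℝ := fun p => deriv (fun s => ψ (p.1, s)) p.2

/-- `∂ₓᵃ ∂_yᵇ ψ`; only applied to smooth `ψ`. -/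
def partialDeriv (a b : ℕ) (ψ : ℝ × ℝ → ℝ) : ℝ × ℝ → ℝ := dx^[a] (dy^[b] ψ)

/-- The classical Laplacian; only applied to smooth functions. -/
def lap (ψ : ℝ × ℝ → ℝ) : ℝ × ℝ → ℝ :=
  fun p => partialDeriv 2 0 ψ p + partialDeriv 0 2 ψ p

/-- Spatial test functions: smooth functions on the plane that are `L`-periodic in each variable. -/
structure IsTestFun (L : ℝ) (ψ : ℝ × ℝ → ℝ) : Prop where
  smooth : ContDiff ℝ ∞ ψ
  periodic : PeriodicFun L ψ

/-- `g` is the weak derivative `∂ₓᵃ ∂_yᵇ f` on `Ω` with periodic boundary conditions. -/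
def IsWeakDeriv (L : ℝ) (a b : ℕ) (f g : ℝ × ℝ → ℝ) : Prop :=
  ∀ ψ, IsTestFun L ψ →
    ∫ p in Omega L, f p * partialDeriv a b ψ p = (-1) ^ (a + b) * ∫ p in Omega L, g p * ψ p

/-! Helper facts for the definition of the Sobolev spaces. -/

theorem contDiff_dx {ψ : ℝ × ℝ → ℝ} (h : ContDiff ℝ ∞ ψ) : ContDiff ℝ ∞ (dx ψ) := by
  have e : dx ψ = fun p => fderiv ℝ ψ p (1, 0) := by
    funext p
    have h1 : HasFDerivAt ψ (fderiv ℝ ψ p) (p.1, p.2) :=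
      (h.differentiable (by simp) p).hasFDerivAt
    exact (h1.comp_hasDerivAt p.1 ((hasDerivAt_id p.1).prodMk (hasDerivAt_const p.1 p.2))).deriv
  rw [e]
  exact (h.fderiv_right (m := ∞) (by simp)).clm_apply contDiff_const

theorem contDiff_dy {ψ : ℝ × ℝ → ℝ} (h : ContDiff ℝ ∞ ψ) : ContDiff ℝ ∞ (dy ψ) := by
  have e : dy ψ = fun p => fderiv ℝ ψ p (0, 1) := by
    funext p
    have h1 : HasFDerivAt ψ (fderiv ℝ ψ p) (p.1, p.2) :=
      (h.differentiable (by simp) p).hasFDerivAt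
    exact (h1.comp_hasDerivAt p.2 ((hasDerivAt_const p.2 p.1).prodMk (hasDerivAt_id p.2))).deriv
  rw [e]
  exact (h.fderiv_right (m := ∞) (by simp)).clm_apply contDiff_const

theorem contDiff_partialDeriv (a b : ℕ) {ψ : ℝ × ℝ → ℝ} (h : ContDiff ℝ ∞ ψ) :
    ContDiff ℝ ∞ (partialDeriv a b ψ) := by
  have h1 : ContDiff ℝ ∞ (dy^[b] ψ) := by
    induction b with
    | zero => exact h
    | succ b ih => rw [Function.iterate_succ_apply']; exact contDiff_dy ih
  unfold partialDeriv
  induction a with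
  | zero => exact h1
  | succ a ih => rw [Function.iterate_succ_apply']; exact contDiff_dx ih

/-- Integration against a continuous function is a continuous linear functional on `L²(Ω)`. -/
theorem exists_pairing (L : ℝ) {ψ : ℝ × ℝ → ℝ} (h : Continuous ψ) :
    ∃ l : Lp ℝ 2 (measOmega L) →L[ℝ] ℝ, ∀ f, l f = ∫ p in Omega L, f p * ψ p := by
  have hsub : Omega L ⊆ Icc (0 : ℝ) L ×ˢ Icc (0 : ℝ) L :=
    prod_mono Ioo_subset_Icc_self Ioo_subset_Icc_self
  have hK : IsCompact (Icc (0 : ℝ) L ×ˢ Icc (0 : ℝ) L) := isCompact_Icc.prod isCompact_Icc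
  obtain ⟨C, hC⟩ := hK.exists_bound_of_continuousOn h.continuousOn
  have hm : MeasurableSet (Omega L) := measurableSet_Ioo.prod measurableSet_Ioo
  have : IsFiniteMeasure (measOmega L) :=
    ⟨by rw [Measure.restrict_apply_univ]
        exact (measure_mono hsub).trans_lt hK.measure_lt_top⟩
  have hL : MemLp ψ 2 (measOmega L) :=
    MemLp.of_bound h.aestronglyMeasurable C
      ((ae_restrict_iff' hm).2 (Filter.Eventually.of_forall fun p hp => hC p (hsub hp)))
  refine ⟨innerSL ℝ (hL.toLp ψ), fun f => ?_⟩
  rw [innerSL_apply_apply, L2.inner_def]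
  refine integral_congr_ae ?_
  filter_upwards [hL.coeFn_toLp] with p hp
  simp [hp]

/-! ### Sobolev and Bochner spaces -/

/-- Multi-indices `(a, b)` with `a + b ≤ s`. -/
abbrev MultiIdx (s : ℕ) : Type := {α : Fin (s + 1) × Fin (s + 1) // (α.1 : ℕ) + α.2 ≤ s}

/-- The multi-index `(0, 0)`. -/
def MultiIdx.zero (s : ℕ) : MultiIdx s := ⟨(0, 0), by simp⟩

/-- The periodic Sobolev space `H^s_per(Ω)`. Its element `f` is stored as the family
`(∂^α f)_{|α| ≤ s}` of its weak derivatives, and its norm is `(∑_{|α| ≤ s} ‖∂^α f‖²_{L²})^{1/2}`. -/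
def Hper (L : ℝ) (s : ℕ) :
    Submodule ℝ (PiLp 2 fun _ : MultiIdx s => Lp ℝ 2 (measOmega L)) where
  carrier := {g | ∀ α : MultiIdx s, IsWeakDeriv L α.1.1 α.1.2 (g (MultiIdx.zero s)) (g α)}
  zero_mem' := by
    intro α ψ hψ
    obtain ⟨l, hl⟩ := exists_pairing L (contDiff_partialDeriv α.1.1 α.1.2 hψ.smooth).continuous
    obtain ⟨l', hl'⟩ := exists_pairing L hψ.smooth.continuous
    rw [← hl, ← hl']
    simp
  add_mem' := by
    intro g g' hg hg' α ψ hψ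
    obtain ⟨l, hl⟩ := exists_pairing L (contDiff_partialDeriv α.1.1 α.1.2 hψ.smooth).continuous
    obtain ⟨l', hl'⟩ := exists_pairing L hψ.smooth.continuous
    have h1 := hg α ψ hψ
    have h2 := hg' α ψ hψ
    rw [← hl, ← hl'] at h1 h2 ⊢
    simp [h1, h2, mul_add]
  smul_mem' := by
    intro c g hg α ψ hψ
    obtain ⟨l, hl⟩ := exists_pairing L (contDiff_partialDeriv α.1.1 α.1.2 hψ.smooth).continuous
    obtain ⟨l', hl'⟩ := exists_pairing L hψ.smooth.continuous
    have h1 := hg α ψ hψ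
    rw [← hl, ← hl'] at h1 ⊢
    simp [h1, mul_left_comm]

theorem isClosed_Hper (L : ℝ) (s : ℕ) :
    IsClosed (Hper L s : Set (PiLp 2 fun _ : MultiIdx s => Lp ℝ 2 (measOmega L))) := by
  have e : (Hper L s : Set (PiLp 2 fun _ : MultiIdx s => Lp ℝ 2 (measOmega L))) =
      ⋂ (α : MultiIdx s) (ψ : ℝ × ℝ → ℝ) (_ : IsTestFun L ψ),
        {g | ∫ p in Omega L, (g (MultiIdx.zero s)) p * partialDeriv α.1.1 α.1.2 ψ p
          = (-1) ^ ((α.1.1 : ℕ) + α.1.2) * ∫ p in Omega L, (g α) p * ψ p} := by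
    ext g
    simp only [mem_iInter]
    rfl
  rw [e]
  refine isClosed_iInter fun α => isClosed_iInter fun ψ => isClosed_iInter fun hψ => ?_
  obtain ⟨l, hl⟩ := exists_pairing L (contDiff_partialDeriv α.1.1 α.1.2 hψ.smooth).continuous
  obtain ⟨l', hl'⟩ := exists_pairing L hψ.smooth.continuous
  simp only [← hl, ← hl']
  refine isClosed_eq ?_ ?_ <;> fun_prop

instance instCompleteSpaceHper (L : ℝ) (s : ℕ) : CompleteSpace (Hper L s) :=
  (isClosed_Hper L s).completeSpace_coe

/-- `u ∈ H^s_per(Ω)` is (almost everywhere on `Ω`) the function `f`. -/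
def Represents {L : ℝ} {s : ℕ} (u : Hper L s) (f : ℝ × ℝ → ℝ) : Prop :=
  ⇑((u : PiLp 2 fun _ : MultiIdx s => Lp ℝ 2 (measOmega L)) (MultiIdx.zero s))
    =ᵐ[measOmega L] f

/-- The Bochner–Sobolev space `H^k(0, T; X)` of a Banach space `X`: the function and its weak time
derivatives up to order `k` lie in `L²(0, T; X)`. -/
def MemHTime {X : Type*} [NormedAddCommGroup X] [NormedSpace ℝ X] [CompleteSpace X]
    (k : ℕ) (T : ℝ) (u : ℝ → X) : Prop :=
  MemLp u 2 (volume.restrict (Ioo 0 T)) ∧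
  ∀ j : ℕ, j ≤ k → ∃ v : ℝ → X, MemLp v 2 (volume.restrict (Ioo 0 T)) ∧
    ∀ η : ℝ → ℝ, ContDiff ℝ ∞ η → HasCompactSupport η → tsupport η ⊆ Ioo 0 T →
      ∫ t in Ioo 0 T, iteratedDeriv j η t • u t = (-1 : ℝ) ^ j • ∫ t in Ioo 0 T, η t • v t

/-- The class `H³(0,T; C⁰) ∩ H²(0,T; H⁴) ∩ L^∞(0,T; H⁸)`. The values of `Φ` are bounded continuous
functions on the plane, with the maximum norm (for periodic functions, that of `C⁰`); members of
the other two spaces are identified with `Φ` for almost every time. -/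
structure RegularityClass (L T : ℝ) (Φ : ℝ → (ℝ × ℝ →ᵇ ℝ)) : Prop where
  h3c0 : MemHTime 3 T Φ
  h2h4 : ∃ u : ℝ → Hper L 4, MemHTime 2 T u ∧
    ∀ᵐ t ∂(volume.restrict (Ioo 0 T)), Represents (u t) (Φ t)
  linfh8 : ∃ u : ℝ → Hper L 8, MemLp u ∞ (volume.restrict (Ioo 0 T)) ∧
    ∀ᵐ t ∂(volume.restrict (Ioo 0 T)), Represents (u t) (Φ t)

/-- `Φ` is the solution on `[0, T]` of `∂ₜΦ = Δ(Φ³ - Φ - ε²ΔΦ)` on `Ω` with periodic boundary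
conditions and initial value `Φ₀`. The equation is understood weakly in space, i.e. tested with
smooth periodic functions; `Φ` is continuous in time with values in the continuous functions. -/
structure IsExactSolution (L ε T : ℝ) (Φ₀ : ℝ × ℝ → ℝ) (Φ : ℝ → (ℝ × ℝ →ᵇ ℝ)) : Prop where
  continuousOn : ContinuousOn Φ (Icc 0 T)
  periodic : ∀ t ∈ Icc 0 T, PeriodicFun L (Φ t)
  initial : ∀ p, Φ 0 p = Φ₀ p
  equation : ∀ ψ, IsTestFun L ψ → ∀ t ∈ Ioo 0 T,
    HasDerivAt (fun s => ∫ p in Omega L, Φ s p * ψ p)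
      (∫ p in Omega L, (((Φ t p) ^ 3 - Φ t p) * lap ψ p - ε ^ 2 * Φ t p * lap (lap ψ) p)) t

/-! ### The difference scheme -/

/-- Grid functions `ν_{i,j}`, `i, j ∈ ℤ`. -/
abbrev GridFun : Type := ℤ → ℤ → ℝ

/-- The space `𝒱_per` of grid functions of period `m` in each index. -/
def GridPeriodic (m : ℕ) (ν : GridFun) : Prop :=
  ∀ i j α β : ℤ, ν (i + α * m) (j + β * m) = ν i j

/-- Values of `f` at the grid points `((i - 1/2) h, (j - 1/2) h)`. -/
def sample (h : ℝ) (f : ℝ × ℝ → ℝ) : GridFun :=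
  fun i j => f (((i : ℝ) - 1 / 2) * h, ((j : ℝ) - 1 / 2) * h)

/-- The standard (second order, five point) discrete Laplacian `Δ_h`. -/
def lapH (h : ℝ) (ν : GridFun) : GridFun := fun i j =>
  (ν (i - 1) j - 2 * ν i j + ν (i + 1) j) / h ^ 2
    + (ν i (j - 1) - 2 * ν i j + ν i (j + 1)) / h ^ 2

/-- The long stencil fourth order discrete Laplacian `Δ_{h,(4)}`. -/
def lapH4 (h : ℝ) (ν : GridFun) : GridFun := fun i j =>
  (-ν (i - 2) j + 16 * ν (i - 1) j - 30 * ν i j + 16 * ν (i + 1) j - ν (i + 2) j) / (12 * h ^ 2)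
    + (-ν i (j - 2) + 16 * ν i (j - 1) - 30 * ν i j + 16 * ν i (j + 1) - ν i (j + 2))
      / (12 * h ^ 2)

/-- The discrete `ℓ²` norm `(h² ∑_{i,j=1}^m ν_{i,j}²)^{1/2}`. -/
def gridNorm (m : ℕ) (h : ℝ) (ν : GridFun) : ℝ :=
  Real.sqrt (h ^ 2 * ∑ i ∈ Finset.Icc (1 : ℤ) m, ∑ j ∈ Finset.Icc (1 : ℤ) m, ν i j ^ 2)

/-- The initial chemical potential `μ_h⁰ = (φ⁰)³ - φ⁰ - ε² Δ_{h,(4)} φ⁰`. -/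
def muInit (h ε : ℝ) (φ0 : GridFun) : GridFun := fun i j =>
  φ0 i j ^ 3 - φ0 i j - ε ^ 2 * lapH4 h φ0 i j

/-- The chemical potential
`(φ^{k+1})³ - 2 φ^k + φ^{k-1} - ε² Δ_{h,(4)} φ^{k+1} - A Δt Δ_{h,(4)} (φ^{k+1} - φ^k)`;
the arguments are `φ^{k+1}`, `φ^k`, `φ^{k-1}` in this order. -/
def muStep (h ε A Δt : ℝ) (φnew φcur φold : GridFun) : GridFun := fun i j =>
  φnew i j ^ 3 - 2 * φcur i j + φold i j - ε ^ 2 * lapH4 h φnew i j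
    - A * Δt * lapH4 h (φnew - φcur) i j

/-- `φ^{-1}, φ⁰, …, φ^n` is the numerical solution, on the grid with `m × m` points and mesh size
`h`, with time step `Δt` and initial value `Φ₀`, up to time level `n`. -/
structure IsNumericalSolution (m : ℕ) (h ε A Δt : ℝ) (Φ₀ : ℝ × ℝ → ℝ) (n : ℕ)
    (φ : ℤ → GridFun) : Prop where
  periodic : ∀ k : ℤ, -1 ≤ k → k ≤ n → GridPeriodic m (φ k)
  initial : φ 0 = sample h Φ₀
  ghost : ∀ i j : ℤ, φ (-1) i j = φ 0 i j - Δt * lapH4 h (muInit h ε (φ 0)) i j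
  step : ∀ k : ℤ, 0 ≤ k → k < n → ∀ i j : ℤ,
    (3 / 2 * φ (k + 1) i j - 2 * φ k i j + 1 / 2 * φ (k - 1) i j) / Δt
      = lapH4 h (muStep h ε A Δt (φ (k + 1)) (φ k) (φ (k - 1))) i j

end CahnHilliard

end

/-!
# Optimal error estimate for a fourth order finite difference scheme for Cahn–Hilliard

The estimate is an energy argument for the error `e` between the numerical solution and a suitable
perturbation of the exact solution, tested with `e` itself. Three observations make it work under
the stated regularity, without any a priori bound on the numerical solution.

*The cubic term.* Summation by parts writes `-⟨D (ψ³ - φ³), e⟩`, with `D` a long stencil second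
difference, as a positive combination of one step differences of `(ψ³ - φ³)` and `e`, from which a
small multiple of the two step differences is subtracted. Up to terms controlled by `|ψ|`, by the
first differences of `ψ` and by `e` in `ℓ²`, the cubic monotonicity `(r³ - t³)(r - t) ≥ 0` makes
this expression nonnegative: the two step products are bounded by the one step ones
(`gsum_D4_cubic_le`). So the nonlinearity is harmless whatever the size of `φ`, and
`bdfEnergy_step` gives the energy inequality for the two step backward differentiation formula.

*The comparison function.* The exact solution `Φ` itself would leave a residual of fourth order in
`h` only with six bounded derivatives of the chemical potential `μ`, that is, eight of `Φ`, and
the regularity class provides only six. Instead, `φ` is compared with averages `bAvg2 h Φ`,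
where `bAvg h d` is built from line averages in the direction `d` so that the fourth order second
difference `planeD4 h d f` is exactly `bAvg h d` of the second derivative of `f`
(`planeD4_eq_bAvg`). The average of `Δ μ` is then the discrete Laplacian of `μ` plus second
differences of `O(h⁴)` quantities (`bAvg2_lap`), and these residuals stand under difference
operators that are moved onto `e`. Four derivatives of `μ`, hence six of `Φ`, are enough, and
`bAvg2 h Φ - Φ` and its discrete Laplacian are `O(h⁴)`.

*The time regularity.* The third time derivative is only square integrable, so the truncation error
of a step is estimated by the integral of this derivative over two time steps, and the squares
of these errors sum up to `O(Δt⁵)` (`exists_bdf_remainder_bound`). To make sense of the solution at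
time `-Δt`, it is extended to negative times quadratically (`exists_time_extension`); the
extension agrees to second order with the starting value `φ⁻¹`.

The classical regularity is obtained from Fourier series. The `H⁸` bound makes the coefficients
summable with the sixth power of the frequency, so that `Φ(t)` has six bounded derivatives,
uniformly in `t` (`exists_bddDiff`); and the weak equation, tested with trigonometric functions,
holds pointwise on the whole closed time interval (`timeDeriv_eq_lap_chemPot`).
-/

noncomputable section

namespace CahnHilliard

/-! ### Summation by parts for periodic grid functions -/

/-- The sum of a grid function over one period cell, as a linear functional. Since grid functions
form a ring under pointwise multiplication, `gsum m (u * v)` is the (unnormalized) inner product. -/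
def gsum (m : ℕ) : GridFun →ₗ[ℝ] ℝ where
  toFun ν := ∑ i ∈ Finset.Icc (1 : ℤ) m, ∑ j ∈ Finset.Icc (1 : ℤ) m, ν i j
  map_add' u v := by simp [Finset.sum_add_distrib]
  map_smul' c u := by simp [Finset.mul_sum]

theorem gsum_apply (m : ℕ) (ν : GridFun) :
    gsum m ν = ∑ i ∈ Finset.Icc (1 : ℤ) m, ∑ j ∈ Finset.Icc (1 : ℤ) m, ν i j := rfl

/-- Translation of a grid function by the lattice vector `(a, b)`. -/
def tr (a b : ℤ) (ν : GridFun) : GridFun := fun i j => ν (i + a) (j + b)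

theorem sum_Icc_succ_of_periodic (m : ℕ) (f : ℤ → ℝ) (hf : f (1 + m) = f 1) :
    ∑ i ∈ Finset.Icc (1 : ℤ) m, f (i + 1) = ∑ i ∈ Finset.Icc (1 : ℤ) m, f i := by
  have key : ∀ n : ℕ, ∑ i ∈ Finset.Icc (1 : ℤ) n, f (i + 1)
      = ∑ i ∈ Finset.Icc (1 : ℤ) n, f i + f (1 + n) - f 1 := by
    intro n
    induction n with
    | zero => simp
    | succ n ih =>
      have e : Finset.Icc (1 : ℤ) ((n + 1 : ℕ) : ℤ)
          = insert ((n : ℤ) + 1) (Finset.Icc (1 : ℤ) n) := by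
        ext x; simp only [Finset.mem_Icc, Finset.mem_insert]; push_cast; omega
      rw [e, Finset.sum_insert (by simp), Finset.sum_insert (by simp), ih]
      push_cast
      rw [add_comm (1 : ℤ) (n : ℤ), add_comm (1 : ℤ) ((n : ℤ) + 1)]
      ring
  rw [key, hf]; ring

theorem sum_Icc_add_of_periodic (m : ℕ) (f : ℤ → ℝ) (hf : ∀ i, f (i + m) = f i) (c : ℤ) :
    ∑ i ∈ Finset.Icc (1 : ℤ) m, f (i + c) = ∑ i ∈ Finset.Icc (1 : ℤ) m, f i := by
  have step : ∀ c : ℤ, ∑ i ∈ Finset.Icc (1 : ℤ) m, f (i + (c + 1))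
      = ∑ i ∈ Finset.Icc (1 : ℤ) m, f (i + c) := by
    intro c
    have := sum_Icc_succ_of_periodic m (fun i => f (i + c))
      (by simpa [add_right_comm] using hf (1 + c))
    simpa [add_assoc, add_comm, add_left_comm] using this
  induction c using Int.induction_on with
  | zero => simp
  | succ n ih => rw [step, ih]
  | pred n ih => rw [← ih, ← step]; simp

theorem GridPeriodic.add {m : ℕ} {u v : GridFun} (hu : GridPeriodic m u) (hv : GridPeriodic m v) :
    GridPeriodic m (u + v) := fun i j α β => by simp [hu i j α β, hv i j α β]

theorem GridPeriodic.sub {m : ℕ} {u v : GridFun} (hu : GridPeriodic m u) (hv : GridPeriodic m v) :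
    GridPeriodic m (u - v) := fun i j α β => by simp [hu i j α β, hv i j α β]

theorem GridPeriodic.mul {m : ℕ} {u v : GridFun} (hu : GridPeriodic m u) (hv : GridPeriodic m v) :
    GridPeriodic m (u * v) := fun i j α β => by simp [hu i j α β, hv i j α β]

theorem GridPeriodic.pow {m : ℕ} {u : GridFun} (hu : GridPeriodic m u) (n : ℕ) :
    GridPeriodic m (u ^ n) := fun i j α β => by simp [hu i j α β]

theorem GridPeriodic.smul {m : ℕ} {u : GridFun} (hu : GridPeriodic m u) (c : ℝ) :
    GridPeriodic m (c • u) := fun i j α β => by simp [hu i j α β]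

theorem GridPeriodic.tr {m : ℕ} {u : GridFun} (hu : GridPeriodic m u) (a b : ℤ) :
    GridPeriodic m (tr a b u) := fun i j α β => by
  simp only [CahnHilliard.tr]
  rw [add_right_comm i, add_right_comm j, hu]

theorem gsum_tr {m : ℕ} {ν : GridFun} (hν : GridPeriodic m ν) (a b : ℤ) :
    gsum m (tr a b ν) = gsum m ν := by
  simp only [gsum_apply, tr]
  rw [sum_Icc_add_of_periodic m (fun i => ∑ j ∈ Finset.Icc (1 : ℤ) m, ν i (j + b))]
  · refine Finset.sum_congr rfl fun i _ => ?_
    exact sum_Icc_add_of_periodic m (fun j => ν i j) (fun j => by simpa using hν i j 0 1) b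
  · intro i
    refine Finset.sum_congr rfl fun j _ => ?_
    simpa using hν i (j + b) 1 0

theorem gsum_mono {m : ℕ} {u v : GridFun} (h : ∀ i j, u i j ≤ v i j) : gsum m u ≤ gsum m v := by
  rw [gsum_apply, gsum_apply]
  exact Finset.sum_le_sum fun i _ => Finset.sum_le_sum fun j _ => h i j

theorem gsum_sq_nonneg (m : ℕ) (u : GridFun) : 0 ≤ gsum m (u ^ 2) := by
  rw [gsum_apply]
  exact Finset.sum_nonneg fun i _ => Finset.sum_nonneg fun j _ => sq_nonneg (u i j)

/-- Young's inequality for the inner product of grid functions. -/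
theorem gsum_mul_le (m : ℕ) (u v : GridFun) {δ : ℝ} (hδ : 0 < δ) :
    gsum m (u * v) ≤ δ * gsum m (v ^ 2) + 1 / (4 * δ) * gsum m (u ^ 2) := by
  have : gsum m (u * v) ≤ gsum m (δ • v ^ 2 + (1 / (4 * δ)) • u ^ 2) := by
    refine gsum_mono fun i j => ?_
    simp only [Pi.mul_apply, Pi.add_apply, Pi.smul_apply, Pi.pow_apply, smul_eq_mul]
    have h1 : δ * v i j ^ 2 + 1 / (4 * δ) * u i j ^ 2 - u i j * v i j
        = 1 / (4 * δ) * (2 * δ * v i j - u i j) ^ 2 := by field_simp; ring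
    have h2 : 0 ≤ 1 / (4 * δ) * (2 * δ * v i j - u i j) ^ 2 := by positivity
    linarith
  simpa using this

/-- The inner product of two translates depends only on the difference of the translations. -/
theorem gsum_tr_mul_tr {m : ℕ} {f g : GridFun} (hf : GridPeriodic m f) (hg : GridPeriodic m g)
    (a b a' b' : ℤ) :
    gsum m (tr a b f * tr a' b' g) = gsum m (tr (a - a') (b - b') f * g) := by
  have e : tr a b f * tr a' b' g = tr a' b' (tr (a - a') (b - b') f * g) := by
    ext i j
    simp only [tr, Pi.mul_apply]
    congr 2 <;> ring_nf
  rw [e, gsum_tr ((hf.tr _ _).mul hg)]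

/-! ### Difference operators in a lattice direction -/

/-- The fourth order second difference in the lattice direction `(a, b)`. -/
def D4 (h : ℝ) (a b : ℤ) (ν : GridFun) : GridFun :=
  (1 / (12 * h ^ 2)) • (-tr (-2 * a) (-2 * b) ν + (16 : ℝ) • tr (-a) (-b) ν - (30 : ℝ) • ν
    + (16 : ℝ) • tr a b ν - tr (2 * a) (2 * b) ν)

/-- The second order second difference in the lattice direction `(a, b)`. -/
def D2 (h : ℝ) (a b : ℤ) (ν : GridFun) : GridFun :=
  (1 / h ^ 2) • (tr (-a) (-b) ν - (2 : ℝ) • ν + tr a b ν)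

theorem lapH4_eq (h : ℝ) (ν : GridFun) : lapH4 h ν = D4 h 1 0 ν + D4 h 0 1 ν := by
  ext i j
  simp only [lapH4, D4, tr, Pi.add_apply, Pi.sub_apply, Pi.neg_apply, Pi.smul_apply, smul_eq_mul]
  norm_num [← sub_eq_add_neg]
  ring

theorem lapH_eq (h : ℝ) (ν : GridFun) : lapH h ν = D2 h 1 0 ν + D2 h 0 1 ν := by
  ext i j
  simp only [lapH, D2, tr, Pi.add_apply, Pi.sub_apply, Pi.smul_apply, smul_eq_mul]
  norm_num [← sub_eq_add_neg]
  ring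

theorem D4_add (h : ℝ) (a b : ℤ) (u v : GridFun) : D4 h a b (u + v) = D4 h a b u + D4 h a b v := by
  ext i j
  simp only [D4, tr, Pi.add_apply, Pi.sub_apply, Pi.neg_apply, Pi.smul_apply, smul_eq_mul]
  ring

theorem D4_sub (h : ℝ) (a b : ℤ) (u v : GridFun) : D4 h a b (u - v) = D4 h a b u - D4 h a b v := by
  ext i j
  simp only [D4, tr, Pi.add_apply, Pi.sub_apply, Pi.neg_apply, Pi.smul_apply, smul_eq_mul]
  ring

theorem D4_smul (h : ℝ) (a b : ℤ) (c : ℝ) (u : GridFun) : D4 h a b (c • u) = c • D4 h a b u := by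
  ext i j
  simp only [D4, tr, Pi.add_apply, Pi.sub_apply, Pi.neg_apply, Pi.smul_apply, smul_eq_mul]
  ring

theorem D4_tr (h : ℝ) (a b c d : ℤ) (u : GridFun) : D4 h a b (tr c d u) = tr c d (D4 h a b u) := by
  ext i j
  simp only [D4, tr, Pi.add_apply, Pi.sub_apply, Pi.neg_apply, Pi.smul_apply, smul_eq_mul]
  simp only [add_right_comm _ c, add_right_comm _ d, add_assoc]

theorem lapH4_add (h : ℝ) (u v : GridFun) : lapH4 h (u + v) = lapH4 h u + lapH4 h v := by
  simp only [lapH4_eq, D4_add]; abel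

theorem lapH4_sub (h : ℝ) (u v : GridFun) : lapH4 h (u - v) = lapH4 h u - lapH4 h v := by
  simp only [lapH4_eq, D4_sub]; abel

theorem lapH4_smul (h : ℝ) (c : ℝ) (u : GridFun) : lapH4 h (c • u) = c • lapH4 h u := by
  simp only [lapH4_eq, D4_smul, smul_add]

theorem GridPeriodic.D4 {m : ℕ} {u : GridFun} (hu : GridPeriodic m u) (h : ℝ) (a b : ℤ) :
    GridPeriodic m (D4 h a b u) := fun i j α β => by
  have H := fun c d => hu.tr c d i j α β
  simp only [CahnHilliard.D4, Pi.add_apply, Pi.sub_apply, Pi.neg_apply, Pi.smul_apply, H,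
    hu i j α β]

theorem GridPeriodic.D2 {m : ℕ} {u : GridFun} (hu : GridPeriodic m u) (h : ℝ) (a b : ℤ) :
    GridPeriodic m (D2 h a b u) := fun i j α β => by
  have H := fun c d => hu.tr c d i j α β
  simp only [CahnHilliard.D2, Pi.add_apply, Pi.sub_apply, Pi.smul_apply, H, hu i j α β]

theorem GridPeriodic.lapH4 {m : ℕ} {u : GridFun} (hu : GridPeriodic m u) (h : ℝ) :
    GridPeriodic m (lapH4 h u) := by
  rw [lapH4_eq]; exact (hu.D4 h 1 0).add (hu.D4 h 0 1)

/-- Summation by parts: `-D4` is a combination of squares of differences over triples of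
consecutive points. The long differences enter with a negative sign but a small weight. -/
theorem gsum_D4_mul {m : ℕ} {f g : GridFun} (hf : GridPeriodic m f) (hg : GridPeriodic m g)
    (h : ℝ) (a b : ℤ) :
    gsum m (D4 h a b f * g) = -(1 / (12 * h ^ 2)) * gsum m
      ((8 : ℝ) • ((tr (-a) (-b) f - f) * (tr (-a) (-b) g - g))
        + (8 : ℝ) • ((f - tr a b f) * (g - tr a b g))
        - (tr (-a) (-b) f - tr a b f) * (tr (-a) (-b) g - tr a b g)) := by
  have t0 : ∀ u : GridFun, tr 0 0 u = u := fun u => by ext i j; simp [tr]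
  have K := gsum_tr_mul_tr hf hg
  have eR : (8 : ℝ) • ((tr (-a) (-b) f - f) * (tr (-a) (-b) g - g))
        + (8 : ℝ) • ((f - tr a b f) * (g - tr a b g))
        - (tr (-a) (-b) f - tr a b f) * (tr (-a) (-b) g - tr a b g)
      = (7 : ℝ) • (tr (-a) (-b) f * tr (-a) (-b) g) - (8 : ℝ) • (tr (-a) (-b) f * g)
        - (8 : ℝ) • (tr 0 0 f * tr (-a) (-b) g) + (16 : ℝ) • (f * g)
        - (8 : ℝ) • (tr a b f * g) - (8 : ℝ) • (tr 0 0 f * tr a b g)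
        + (7 : ℝ) • (tr a b f * tr a b g) + tr (-a) (-b) f * tr a b g
        + tr a b f * tr (-a) (-b) g := by
    rw [t0]
    ext i j
    simp only [Pi.add_apply, Pi.sub_apply, Pi.mul_apply, Pi.smul_apply, smul_eq_mul]
    ring
  have eL : D4 h a b f * g = (1 / (12 * h ^ 2)) • (-(tr (-2 * a) (-2 * b) f * g)
      + (16 : ℝ) • (tr (-a) (-b) f * g) - (30 : ℝ) • (f * g)
      + (16 : ℝ) • (tr a b f * g) - tr (2 * a) (2 * b) f * g) := by
    ext i j
    simp only [D4, Pi.add_apply, Pi.sub_apply, Pi.neg_apply, Pi.mul_apply, Pi.smul_apply,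
      smul_eq_mul]
    ring
  rw [eR, eL]
  simp only [map_add, map_sub, map_smul, map_neg, smul_eq_mul]
  rw [K (-a) (-b) (-a) (-b), K 0 0 (-a) (-b), K 0 0 a b, K a b a b, K (-a) (-b) a b,
    K a b (-a) (-b)]
  have e1 : -a - a = -2 * a := by ring
  have e2 : -b - b = -2 * b := by ring
  have e3 : a - -a = 2 * a := by ring
  have e4 : b - -b = 2 * b := by ring
  simp only [sub_self, t0, e1, e2, e3, e4, zero_sub, neg_neg]
  ring

theorem gsum_D4_mul_comm {m : ℕ} {f g : GridFun} (hf : GridPeriodic m f) (hg : GridPeriodic m g)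
    (h : ℝ) (a b : ℤ) : gsum m (D4 h a b f * g) = gsum m (f * D4 h a b g) := by
  rw [mul_comm f, gsum_D4_mul hf hg, gsum_D4_mul hg hf]
  rw [mul_comm (tr (-a) (-b) f - f), mul_comm (f - tr a b f),
    mul_comm (tr (-a) (-b) f - tr a b f)]

theorem gsum_lapH4_mul_comm {m : ℕ} {f g : GridFun} (hf : GridPeriodic m f)
    (hg : GridPeriodic m g) (h : ℝ) : gsum m (lapH4 h f * g) = gsum m (f * lapH4 h g) := by
  rw [lapH4_eq, lapH4_eq, add_mul, mul_add, map_add, map_add, gsum_D4_mul_comm hf hg,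
    gsum_D4_mul_comm hf hg]

theorem gsum_diff_sq_shift {m : ℕ} {f : GridFun} (hf : GridPeriodic m f) (a b : ℤ) :
    gsum m ((tr (-a) (-b) f - f) ^ 2) = gsum m ((f - tr a b f) ^ 2) := by
  rw [← gsum_tr ((((hf.tr (-a) (-b)).sub hf)).pow 2) a b]
  congr 1
  ext i j
  simp [tr]

/-- `-D4` dominates the square of the first difference. -/
theorem gsum_diff_sq_le {m : ℕ} {f : GridFun} (hf : GridPeriodic m f) {h : ℝ} (a b : ℤ) :
    1 / h ^ 2 * gsum m ((f - tr a b f) ^ 2) ≤ -gsum m (D4 h a b f * f) := by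
  rw [gsum_D4_mul hf hf, neg_mul, neg_neg]
  have : 12 * gsum m ((f - tr a b f) ^ 2) ≤ gsum m
      ((8 : ℝ) • ((tr (-a) (-b) f - f) * (tr (-a) (-b) f - f))
        + (8 : ℝ) • ((f - tr a b f) * (f - tr a b f))
        - (tr (-a) (-b) f - tr a b f) * (tr (-a) (-b) f - tr a b f)) := by
    have e : 12 * gsum m ((f - tr a b f) ^ 2)
        = gsum m ((6 : ℝ) • (tr (-a) (-b) f - f) ^ 2 + (6 : ℝ) • (f - tr a b f) ^ 2) := by
      simp only [map_add, map_smul, gsum_diff_sq_shift hf, smul_eq_mul]; ring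
    rw [e]
    refine gsum_mono fun i j => ?_
    simp only [Pi.add_apply, Pi.sub_apply, Pi.mul_apply, Pi.smul_apply, Pi.pow_apply, smul_eq_mul]
    nlinarith [sq_nonneg ((tr (-a) (-b) f i j - f i j) - (f i j - tr a b f i j))]
  calc 1 / h ^ 2 * gsum m ((f - tr a b f) ^ 2)
      = 1 / (12 * h ^ 2) * (12 * gsum m ((f - tr a b f) ^ 2)) := by
        rcases eq_or_ne h 0 with rfl | hh
        · simp
        · field_simp
    _ ≤ _ := mul_le_mul_of_nonneg_left this (by positivity)

theorem gsum_D4_mul_self_nonpos {m : ℕ} {f : GridFun} (hf : GridPeriodic m f) (h : ℝ) (a b : ℤ) :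
    gsum m (D4 h a b f * f) ≤ 0 := by
  have h1 := gsum_diff_sq_le hf (h := h) a b
  have h2 : 0 ≤ 1 / h ^ 2 * gsum m ((f - tr a b f) ^ 2) :=
    mul_nonneg (by positivity) (gsum_sq_nonneg _ _)
  linarith

/-- Two one-dimensional operators `-D4` commute and are positive, hence so is their product. -/
theorem gsum_D4_mul_D4_nonneg {m : ℕ} {f : GridFun} (hf : GridPeriodic m f) (h : ℝ)
    (a b c d : ℤ) : 0 ≤ gsum m (D4 h a b f * D4 h c d f) := by
  set q : GridFun → ℝ := fun u => -gsum m (D4 h c d u * u) with hq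
  have hq0 : ∀ u, GridPeriodic m u → 0 ≤ q u := fun u hu => by
    have := gsum_D4_mul_self_nonpos hu h c d
    simp only [hq]; linarith
  set u := tr (-a) (-b) f - f with hu
  set v := f - tr a b f with hv
  have hup : GridPeriodic m u := (hf.tr _ _).sub hf
  have hvp : GridPeriodic m v := hf.sub (hf.tr _ _)
  have eu : tr (-a) (-b) (D4 h c d f) - D4 h c d f = D4 h c d u := by rw [hu, D4_sub, D4_tr]
  have ev : D4 h c d f - tr a b (D4 h c d f) = D4 h c d v := by rw [hv, D4_sub, D4_tr]
  have euv : tr (-a) (-b) f - tr a b f = u + v := by rw [hu, hv]; abel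
  have euv' : tr (-a) (-b) (D4 h c d f) - tr a b (D4 h c d f) = D4 h c d (u + v) := by
    rw [D4_add, ← eu, ← ev]; abel
  rw [gsum_D4_mul hf (hf.D4 h c d), eu, ev, euv, euv']
  have key : gsum m ((8 : ℝ) • (u * D4 h c d u) + (8 : ℝ) • (v * D4 h c d v)
      - (u + v) * D4 h c d (u + v)) = -(6 * q u + 6 * q v + q (u - v)) := by
    simp only [hq, mul_comm _ (D4 h c d _), D4_add, D4_sub, mul_add, sub_mul, mul_sub,
      map_add, map_sub, map_smul, smul_eq_mul]
    ring
  rw [key]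
  have h1 := hq0 u hup
  have h2 := hq0 v hvp
  have h3 := hq0 (u - v) (hup.sub hvp)
  rw [neg_mul_neg]
  positivity

theorem gsum_D4_sq_add_le {m : ℕ} {f : GridFun} (hf : GridPeriodic m f) (h : ℝ) :
    gsum m (D4 h 1 0 f ^ 2) + gsum m (D4 h 0 1 f ^ 2) ≤ gsum m (lapH4 h f ^ 2) := by
  have e : lapH4 h f ^ 2
      = D4 h 1 0 f ^ 2 + D4 h 0 1 f ^ 2 + (2 : ℝ) • (D4 h 1 0 f * D4 h 0 1 f) := by
    rw [lapH4_eq]; ext i j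
    simp only [Pi.add_apply, Pi.mul_apply, Pi.smul_apply, Pi.pow_apply, smul_eq_mul]; ring
  rw [e, map_add, map_add, map_smul, smul_eq_mul]
  have := gsum_D4_mul_D4_nonneg hf h 1 0 0 1
  linarith

theorem gsum_D2_mul_self_nonpos {m : ℕ} {f : GridFun} (hf : GridPeriodic m f) (h : ℝ) (a b : ℤ) :
    gsum m (D2 h a b f * f) ≤ 0 := by
  have t0 : ∀ u : GridFun, tr 0 0 u = u := fun u => by ext i j; simp [tr]
  have e1 : D2 h a b f * f = (1 / h ^ 2) • (tr (-a) (-b) f * f - (2 : ℝ) • (f * f)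
      + tr a b f * f) := by
    ext i j
    simp only [D2, Pi.add_apply, Pi.sub_apply, Pi.mul_apply, Pi.smul_apply, smul_eq_mul]; ring
  have e2 : (f - tr a b f) ^ 2 = f * f + tr a b f * tr a b f - tr a b f * f
      - tr 0 0 f * tr a b f := by
    rw [t0]; ring
  have h1 := gsum_sq_nonneg m (f - tr a b f)
  have e3 : gsum m (D2 h a b f * f) = -(1 / h ^ 2) * gsum m ((f - tr a b f) ^ 2) := by
    have K := gsum_tr_mul_tr hf hf
    rw [e1, e2]
    simp only [map_add, map_sub, map_smul, smul_eq_mul]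
    rw [K a b a b, K 0 0 a b]
    simp only [sub_self, t0, zero_sub]
    ring
  rw [e3]
  have : 0 ≤ 1 / h ^ 2 * gsum m ((f - tr a b f) ^ 2) := mul_nonneg (by positivity) h1
  linarith

theorem gsum_D2_sq_le {m : ℕ} {f : GridFun} (hf : GridPeriodic m f) {h : ℝ} (hh : h ≠ 0)
    (a b : ℤ) : gsum m (D2 h a b f ^ 2) ≤ gsum m (D4 h a b f ^ 2) := by
  set v := D2 h a b f with hv
  have hvp : GridPeriodic m v := hf.D2 h a b
  have e : D4 h a b f = v - (h ^ 2 / 12) • D2 h a b v := by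
    ext i j
    simp only [hv, D4, D2, tr, Pi.add_apply, Pi.sub_apply, Pi.neg_apply, Pi.smul_apply, smul_eq_mul]
    rw [show i + -a + -a = i + -2 * a by ring, show j + -b + -b = j + -2 * b by ring,
      show i + a + a = i + 2 * a by ring, show j + b + b = j + 2 * b by ring]
    simp only [neg_add_cancel_right, add_neg_cancel_right]
    field_simp
    ring
  have e2 : D4 h a b f ^ 2 = v ^ 2 - (h ^ 2 / 6) • (D2 h a b v * v)
      + (h ^ 2 / 12) ^ 2 • (D2 h a b v) ^ 2 := by
    rw [e]; ext i j
    simp only [Pi.add_apply, Pi.sub_apply, Pi.mul_apply, Pi.smul_apply, Pi.pow_apply, smul_eq_mul]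
    ring
  rw [e2, map_add, map_sub, map_smul, map_smul, smul_eq_mul, smul_eq_mul]
  have h1 := gsum_D2_mul_self_nonpos hvp h a b
  have h2 := gsum_sq_nonneg m (D2 h a b v)
  have h3 : 0 ≤ h ^ 2 / 6 * -gsum m (D2 h a b v * v) := mul_nonneg (by positivity) (by linarith)
  have h4 : 0 ≤ (h ^ 2 / 12) ^ 2 * gsum m (D2 h a b v ^ 2) := by positivity
  linarith

/-- The five-point Laplacian is controlled by the fourth order one. -/
theorem gsum_lapH_sq_le {m : ℕ} {f : GridFun} (hf : GridPeriodic m f) {h : ℝ} (hh : h ≠ 0) :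
    gsum m (lapH h f ^ 2) ≤ 2 * gsum m (lapH4 h f ^ 2) := by
  have h1 := gsum_D4_sq_add_le hf h
  have h2 := gsum_D2_sq_le hf hh 1 0
  have h3 := gsum_D2_sq_le hf hh 0 1
  have h4 : gsum m (lapH h f ^ 2)
      ≤ gsum m ((2 : ℝ) • D2 h 1 0 f ^ 2 + (2 : ℝ) • D2 h 0 1 f ^ 2) := by
    rw [lapH_eq]
    refine gsum_mono fun i j => ?_
    simp only [Pi.add_apply, Pi.smul_apply, Pi.pow_apply, smul_eq_mul]
    nlinarith [sq_nonneg (D2 h 1 0 f i j - D2 h 0 1 f i j)]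
  simp only [map_add, map_smul, smul_eq_mul] at h4
  linarith

/-! ### Monotonicity of the cubic term for the long stencil -/

theorem cubic_long_diff_le (r s t : ℝ) :
    (r ^ 3 - t ^ 3) * (r - t)
      ≤ 4 * ((r ^ 3 - s ^ 3) * (r - s) + (s ^ 3 - t ^ 3) * (s - t)) := by
  nlinarith [sq_nonneg ((r - s) * (r + s)), sq_nonneg ((s - t) * (s + t)),
    sq_nonneg ((r - s) * (r + s) - (s - t) * (s + t)), sq_nonneg ((r - s) * (s - t)),
    sq_nonneg ((r - s) ^ 2 - (s - t) ^ 2), sq_nonneg ((r - s) * s), sq_nonneg ((s - t) * s),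
    sq_nonneg ((r - 2 * s + t) * s), sq_nonneg ((r - 2 * s + t) * (r - t)),
    sq_nonneg ((r - 2 * s + t) * (r + t))]

theorem sq_mul_diff_le (r s : ℝ) : (r * (r - s)) ^ 2 ≤ 2 * ((r ^ 3 - s ^ 3) * (r - s)) := by
  have : 2 * ((r ^ 3 - s ^ 3) * (r - s)) - (r * (r - s)) ^ 2
      = (r - s) ^ 2 * ((r + s) ^ 2 + s ^ 2) := by
    ring
  nlinarith [mul_nonneg (sq_nonneg (r - s)) (add_nonneg (sq_nonneg (r + s)) (sq_nonneg s))]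

/-- A lower bound for the summand in `gsum_D4_mul` with `f = ψ³ - (ψ - e)³` and `g = e`, at three
consecutive points where `ψ` takes the values `a, b, c` and `e` the values `u, v, w`. With `ψ`
frozen at the middle value the summand is nonnegative by `cubic_long_diff_le`; the variation of
`ψ` costs quadratic terms in `e` only. -/
theorem cubic_triple_lower_bound {a b c u v w B κ : ℝ} (ha : |a| ≤ B) (hc : |c| ≤ B)
    (hab : |a - b| ≤ κ) (hcb : |c - b| ≤ κ) :
    -(2 * ((u - v) ^ 2 + (v - w) ^ 2) + 1000 * (1 + B ^ 2) * κ ^ 2 * (u ^ 2 + w ^ 2)) ≤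
      8 * (((a ^ 3 - (a - u) ^ 3) - (b ^ 3 - (b - v) ^ 3)) * (u - v))
      + 8 * (((b ^ 3 - (b - v) ^ 3) - (c ^ 3 - (c - w) ^ 3)) * (v - w))
      - ((a ^ 3 - (a - u) ^ 3) - (c ^ 3 - (c - w) ^ 3)) * (u - w) := by
  have Y1 : ∀ X Y : ℝ, 24 * X * Y ≤ 576 * X ^ 2 + Y ^ 2 / 4 := fun X Y => by
    nlinarith [sq_nonneg (24 * X - Y / 2)]
  have Y2 : ∀ X Y : ℝ, 3 * X * Y ≤ 36 * X ^ 2 + Y ^ 2 / 16 := fun X Y => by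
    nlinarith [sq_nonneg (6 * X - Y / 4)]
  have Y3 : ∀ X Y : ℝ, 24 * X * Y ≤ 144 * X ^ 2 + Y ^ 2 := fun X Y => by
    nlinarith [sq_nonneg (12 * X - Y)]
  obtain ⟨r, hr⟩ : ∃ r, r = b - u := ⟨_, rfl⟩
  obtain ⟨s, hs⟩ : ∃ s, s = b - v := ⟨_, rfl⟩
  obtain ⟨t, ht⟩ : ∃ t, t = b - w := ⟨_, rfl⟩
  obtain ⟨d, hd⟩ : ∃ d, d = a - b := ⟨_, rfl⟩
  obtain ⟨d', hd'⟩ : ∃ d', d' = c - b := ⟨_, rfl⟩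
  have N1 := sq_mul_diff_le r s
  have N2 := sq_mul_diff_le t s
  have N3 := sq_mul_diff_le r t
  have N4 := sq_mul_diff_le t r
  have NL := cubic_long_diff_le r s t
  set n1 := (r ^ 3 - s ^ 3) * (r - s) with hn1
  set n2 := (s ^ 3 - t ^ 3) * (s - t) with hn2
  set n3 := (r ^ 3 - t ^ 3) * (r - t) with hn3
  have e2 : (t ^ 3 - s ^ 3) * (t - s) = n2 := by rw [hn2]; ring
  have e4 : (t ^ 3 - r ^ 3) * (t - r) = n3 := by rw [hn3]; ring
  rw [e2] at N2
  rw [e4] at N4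
  have huv : u - v = s - r := by rw [hr, hs]; ring
  have hvw : v - w = t - s := by rw [ht, hs]; ring
  have huw : u - w = t - r := by rw [ht, hr]; ring
  have main : 8 * (((a ^ 3 - (a - u) ^ 3) - (b ^ 3 - (b - v) ^ 3)) * (u - v))
      + 8 * (((b ^ 3 - (b - v) ^ 3) - (c ^ 3 - (c - w) ^ 3)) * (v - w))
      - ((a ^ 3 - (a - u) ^ 3) - (c ^ 3 - (c - w) ^ 3)) * (u - w)
      = 8 * n1 + 8 * n2 - n3
        - 24 * (d * u) * (r * (r - s)) + 24 * (d * u * a) * (u - v)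
        - 24 * (d' * w) * (t * (t - s)) - 24 * (d' * w * c) * (v - w)
        + 3 * (d * u) * (r * (r - t)) - 3 * (d * u * a) * (u - w)
        + 3 * (d' * w) * (t * (t - r)) + 3 * (d' * w * c) * (u - w) := by
    rw [hn1, hn2, hn3, hr, hs, ht, hd, hd']; ring
  rw [main]
  have hB : 0 ≤ B := (abs_nonneg a).trans ha
  have hκ : 0 ≤ κ := (abs_nonneg _).trans hab
  have hd2 : d ^ 2 ≤ κ ^ 2 := by rw [hd]; exact sq_le_sq' (abs_le.1 hab).1 (abs_le.1 hab).2
  have hd2' : d' ^ 2 ≤ κ ^ 2 := by rw [hd']; exact sq_le_sq' (abs_le.1 hcb).1 (abs_le.1 hcb).2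
  have ha2 : a ^ 2 ≤ B ^ 2 := sq_le_sq' (abs_le.1 ha).1 (abs_le.1 ha).2
  have hc2 : c ^ 2 ≤ B ^ 2 := sq_le_sq' (abs_le.1 hc).1 (abs_le.1 hc).2
  have p1 : (d * u) ^ 2 ≤ κ ^ 2 * u ^ 2 := by
    rw [mul_pow]; exact mul_le_mul_of_nonneg_right hd2 (sq_nonneg _)
  have p2 : (d' * w) ^ 2 ≤ κ ^ 2 * w ^ 2 := by
    rw [mul_pow]; exact mul_le_mul_of_nonneg_right hd2' (sq_nonneg _)
  have p3 : (d * u * a) ^ 2 ≤ B ^ 2 * (κ ^ 2 * u ^ 2) := by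
    rw [mul_pow, mul_comm]; exact mul_le_mul ha2 p1 (sq_nonneg _) (sq_nonneg _)
  have p4 : (d' * w * c) ^ 2 ≤ B ^ 2 * (κ ^ 2 * w ^ 2) := by
    rw [mul_pow, mul_comm]; exact mul_le_mul hc2 p2 (sq_nonneg _) (sq_nonneg _)
  have q0 : 0 ≤ n1 := by linarith only [N1, sq_nonneg (r * (r - s))]
  have q0' : 0 ≤ n2 := by linarith only [N2, sq_nonneg (t * (t - s))]
  have y1 := Y1 (d * u) (r * (r - s))
  have y2 := Y1 (d' * w) (t * (t - s))
  have y3 := Y2 (-(d * u)) (r * (r - t))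
  have y4 := Y2 (-(d' * w)) (t * (t - r))
  have z1 := Y3 (-(d * u * a)) (u - v)
  have z2 := Y3 (d' * w * c) (v - w)
  have z3 := Y2 (d * u * a) (u - w)
  have z4 := Y2 (-(d' * w * c)) (u - w)
  have hw : (u - w) ^ 2 ≤ 2 * (u - v) ^ 2 + 2 * (v - w) ^ 2 := by
    linarith only [sq_nonneg ((u - v) - (v - w)), show (u - w) ^ 2
      = 2 * (u - v) ^ 2 + 2 * (v - w) ^ 2 - ((u - v) - (v - w)) ^ 2 by ring]
  rw [neg_sq] at y3 y4 z1 z4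
  have f1 : 0 ≤ κ ^ 2 * u ^ 2 := by positivity
  have f2 : 0 ≤ κ ^ 2 * w ^ 2 := by positivity
  have f3 : 0 ≤ B ^ 2 * (κ ^ 2 * u ^ 2) := by positivity
  have f4 : 0 ≤ B ^ 2 * (κ ^ 2 * w ^ 2) := by positivity
  have f5 := sq_nonneg (u - v)
  have f6 := sq_nonneg (v - w)
  have ex : 1000 * (1 + B ^ 2) * κ ^ 2 * (u ^ 2 + w ^ 2)
      = 1000 * (κ ^ 2 * u ^ 2) + 1000 * (κ ^ 2 * w ^ 2) + 1000 * (B ^ 2 * (κ ^ 2 * u ^ 2))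
        + 1000 * (B ^ 2 * (κ ^ 2 * w ^ 2)) := by ring
  rw [ex]
  clear_value n1 n2 n3
  linarith only [NL, N1, N2, N3, N4, q0, q0', y1, y2, y3, y4, z1, z2, z3, z4, hw, p1, p2, p3, p4,
    f1, f2, f3, f4, f5, f6]

/-! ### The cubic nonlinearity -/

/-- The cubic term tested with the error is nonpositive up to lower order terms. -/
theorem gsum_D4_cubic_le {m : ℕ} {ψ e : GridFun} (hψ : GridPeriodic m ψ) (he : GridPeriodic m e)
    {h B K : ℝ} (hh : h ≠ 0) (hB : ∀ i j, |ψ i j| ≤ B) (a b : ℤ)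
    (hK : ∀ i j, |tr a b ψ i j - ψ i j| ≤ K * h) :
    gsum m (D4 h a b (ψ ^ 3 - (ψ - e) ^ 3) * e)
      ≤ -gsum m (D4 h a b e * e) + 200 * (1 + B ^ 2) * K ^ 2 * gsum m (e ^ 2) := by
  have hp : GridPeriodic m (ψ ^ 3 - (ψ - e) ^ 3) := (hψ.pow 3).sub ((hψ.sub he).pow 3)
  rw [gsum_D4_mul hp he]
  set S := gsum m ((e - tr a b e) ^ 2) with hS
  set X := gsum m (e ^ 2) with hX
  have h1 := gsum_diff_sq_le he (h := h) a b
  have hS0 : 0 ≤ S := gsum_sq_nonneg _ _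
  have hX0 : 0 ≤ X := gsum_sq_nonneg _ _
  set f := ψ ^ 3 - (ψ - e) ^ 3 with hf
  set Q := gsum m ((8 : ℝ) • ((tr (-a) (-b) f - f) * (tr (-a) (-b) e - e))
        + (8 : ℝ) • ((f - tr a b f) * (e - tr a b e))
        - (tr (-a) (-b) f - tr a b f) * (tr (-a) (-b) e - tr a b e)) with hQ
  have key : -(4 * S + 2000 * (1 + B ^ 2) * (K * h) ^ 2 * X) ≤ Q := by
    have e1 : -(4 * S + 2000 * (1 + B ^ 2) * (K * h) ^ 2 * X)
        = gsum m (-((2 : ℝ) • ((tr (-a) (-b) e - e) ^ 2 + (e - tr a b e) ^ 2)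
          + (1000 * (1 + B ^ 2) * (K * h) ^ 2) • (tr (-a) (-b) (e ^ 2) + tr a b (e ^ 2)))) := by
      simp only [map_neg, map_add, map_smul, gsum_diff_sq_shift he, gsum_tr (he.pow 2),
        smul_eq_mul, ← hS, ← hX]
      ring
    rw [e1, hQ]
    refine gsum_mono fun i j => ?_
    have hab : |tr (-a) (-b) ψ i j - ψ i j| ≤ K * h := by
      have := hK (i + -a) (j + -b)
      simp only [tr, neg_add_cancel_right] at this ⊢
      rwa [abs_sub_comm]
    have := cubic_triple_lower_bound (u := tr (-a) (-b) e i j) (v := e i j) (w := tr a b e i j)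
      (hB (i + -a) (j + -b)) (hB (i + a) (j + b)) hab (hK i j)
    simp only [hf, tr, Pi.add_apply, Pi.sub_apply, Pi.neg_apply, Pi.mul_apply, Pi.smul_apply,
      Pi.pow_apply, smul_eq_mul] at this ⊢
    linarith only [this]
  have hc : 0 ≤ 1 / (12 * h ^ 2) := by positivity
  have h2 := mul_le_mul_of_nonneg_left key hc
  have e2 : 1 / (12 * h ^ 2) * -(4 * S + 2000 * (1 + B ^ 2) * (K * h) ^ 2 * X)
      = -(1 / 3 * (1 / h ^ 2 * S)) - 500 / 3 * ((1 + B ^ 2) * K ^ 2 * X) := by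
    field_simp; ring
  have h3 : 0 ≤ 1 / h ^ 2 * S := mul_nonneg (by positivity) hS0
  have h4 : 0 ≤ (1 + B ^ 2) * K ^ 2 * X := by positivity
  rw [e2] at h2
  linarith

theorem gsum_lapH4_cubic_le {m : ℕ} {ψ e : GridFun} (hψ : GridPeriodic m ψ)
    (he : GridPeriodic m e) {h B K δ : ℝ} (hh : h ≠ 0) (hδ : 0 < δ) (hB : ∀ i j, |ψ i j| ≤ B)
    (hKx : ∀ i j, |tr 1 0 ψ i j - ψ i j| ≤ K * h) (hKy : ∀ i j, |tr 0 1 ψ i j - ψ i j| ≤ K * h) :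
    gsum m (lapH4 h (ψ ^ 3 - (ψ - e) ^ 3) * e) ≤ δ * gsum m (lapH4 h e ^ 2)
      + (1 / (4 * δ) + 400 * (1 + B ^ 2) * K ^ 2) * gsum m (e ^ 2) := by
  have h1 := gsum_D4_cubic_le hψ he hh hB 1 0 hKx
  have h2 := gsum_D4_cubic_le hψ he hh hB 0 1 hKy
  have h3 := gsum_mul_le m (-e) (lapH4 h e) hδ
  have e3 : gsum m (-e * lapH4 h e) = -gsum m (D4 h 1 0 e * e) - gsum m (D4 h 0 1 e * e) := by
    rw [lapH4_eq, neg_mul, map_neg, mul_add, map_add, mul_comm e, mul_comm e]; ring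
  rw [e3, neg_sq] at h3
  rw [lapH4_eq h (ψ ^ 3 - (ψ - e) ^ 3), add_mul, map_add]
  linarith

/-! ### The energy inequality for one time step -/

/-- The error energy of the second order backward differentiation formula. -/
def bdfEnergy (m : ℕ) (e1 e0 : GridFun) : ℝ :=
  1 / 4 * (gsum m (e1 ^ 2) + gsum m (((2 : ℝ) • e1 - e0) ^ 2))

theorem bdfEnergy_nonneg (m : ℕ) (e1 e0 : GridFun) : 0 ≤ bdfEnergy m e1 e0 := by
  have h1 := gsum_sq_nonneg m e1
  have h2 := gsum_sq_nonneg m ((2 : ℝ) • e1 - e0)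
  unfold bdfEnergy; positivity

/-- One step of the scheme, compared with a perturbed solution `ψ` of the scheme whose residual is
`Δ_{h,(4)} ρ + D_x ρx + D_y ρy + r / Δt`. The nonlinearity needs bounds on `ψ` and on its first
differences, but none on the numerical solution `φ`. -/
theorem bdfEnergy_step {m : ℕ} {h ε A Δt B K : ℝ} (hh : 0 < h) (hε : 0 < ε) (hΔt : 0 < Δt)
    (hA : |A| * Δt ≤ ε ^ 2 / 16) {ψ1 ψ0 ψm φ1 φ0 φm ρ ρx ρy r : GridFun}
    (hψ1 : GridPeriodic m ψ1) (hψ0 : GridPeriodic m ψ0)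
    (hψm : GridPeriodic m ψm)
    (hφ1 : GridPeriodic m φ1) (hφ0 : GridPeriodic m φ0) (hφm : GridPeriodic m φm)
    (hρ : GridPeriodic m ρ) (hρx : GridPeriodic m ρx) (hρy : GridPeriodic m ρy)
    (hB : ∀ i j, |ψ1 i j| ≤ B)
    (hKx : ∀ i j, |tr 1 0 ψ1 i j - ψ1 i j| ≤ K * h)
    (hKy : ∀ i j, |tr 0 1 ψ1 i j - ψ1 i j| ≤ K * h)
    (hφ : (3 / 2 : ℝ) • φ1 - (2 : ℝ) • φ0 + (1 / 2 : ℝ) • φm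
      = Δt • lapH4 h (muStep h ε A Δt φ1 φ0 φm))
    (hψ : (3 / 2 : ℝ) • ψ1 - (2 : ℝ) • ψ0 + (1 / 2 : ℝ) • ψm
      = Δt • (lapH4 h (muStep h ε A Δt ψ1 ψ0 ψm) + lapH4 h ρ + D4 h 1 0 ρx + D4 h 0 1 ρy) + r) :
    bdfEnergy m (ψ1 - φ1) (ψ0 - φ0) + ε ^ 2 / 2 * (Δt * gsum m (lapH4 h (ψ1 - φ1) ^ 2))
      ≤ bdfEnergy m (ψ0 - φ0) (ψm - φm) + ε ^ 2 / 32 * (Δt * gsum m (lapH4 h (ψ0 - φ0) ^ 2))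
        + (16 / ε ^ 2 + 1600 * (1 + B ^ 2) * K ^ 2 + 4) * Δt
          * (bdfEnergy m (ψ1 - φ1) (ψ0 - φ0) + bdfEnergy m (ψ0 - φ0) (ψm - φm))
        + (4 / ε ^ 2 * Δt * (gsum m (ρ ^ 2) + gsum m (ρx ^ 2) + gsum m (ρy ^ 2))
          + 1 / (4 * Δt) * gsum m (r ^ 2)) := by
  set e1 := ψ1 - φ1 with he1
  set e0 := ψ0 - φ0 with he0
  set em := ψm - φm with hem
  have p1 : GridPeriodic m e1 := hψ1.sub hφ1
  have p0 : GridPeriodic m e0 := hψ0.sub hφ0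
  have pm : GridPeriodic m em := hψm.sub hφm
  set c := ψ1 ^ 3 - (ψ1 - e1) ^ 3 with hc
  set z := (2 : ℝ) • e0 - em with hz
  have pc : GridPeriodic m c := (hψ1.pow 3).sub ((hψ1.sub p1).pow 3)
  have pz : GridPeriodic m z := (p0.smul 2).sub pm
  have hphi1 : φ1 = ψ1 - e1 := by rw [he1]; abel
  have mu : muStep h ε A Δt ψ1 ψ0 ψm - muStep h ε A Δt φ1 φ0 φm
      = c - z - ε ^ 2 • lapH4 h e1 - (A * Δt) • (lapH4 h e1 - lapH4 h e0) := by
    have a1 : lapH4 h φ1 = lapH4 h ψ1 - lapH4 h e1 := by rw [hphi1, lapH4_sub]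
    have a0 : lapH4 h φ0 = lapH4 h ψ0 - lapH4 h e0 := by rw [he0, lapH4_sub]; abel
    ext i j
    have b1 : φ1 i j = ψ1 i j - e1 i j := by rw [hphi1]; rfl
    have b0 : e0 i j = ψ0 i j - φ0 i j := rfl
    have bm : em i j = ψm i j - φm i j := rfl
    simp only [muStep, lapH4_sub, a1, a0, Pi.sub_apply, Pi.smul_apply, smul_eq_mul, hc, hz, b1, b0,
      bm, Pi.pow_apply]
    ring
  have err : (3 / 2 : ℝ) • e1 - (2 : ℝ) • e0 + (1 / 2 : ℝ) • em
      = Δt • (lapH4 h c - lapH4 h z - ε ^ 2 • lapH4 h (lapH4 h e1)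
        - (A * Δt) • (lapH4 h (lapH4 h e1) - lapH4 h (lapH4 h e0))
        + lapH4 h ρ + D4 h 1 0 ρx + D4 h 0 1 ρy) + r := by
    have l : (3 / 2 : ℝ) • e1 - (2 : ℝ) • e0 + (1 / 2 : ℝ) • em
        = ((3 / 2 : ℝ) • ψ1 - (2 : ℝ) • ψ0 + (1 / 2 : ℝ) • ψm)
          - ((3 / 2 : ℝ) • φ1 - (2 : ℝ) • φ0 + (1 / 2 : ℝ) • φm) := by
      rw [he1, he0, hem]; module
    rw [l, hφ, hψ]
    have l2 : lapH4 h (muStep h ε A Δt ψ1 ψ0 ψm) = lapH4 h (muStep h ε A Δt φ1 φ0 φm)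
        + lapH4 h (c - z - ε ^ 2 • lapH4 h e1 - (A * Δt) • (lapH4 h e1 - lapH4 h e0)) := by
      rw [← mu, lapH4_sub]; abel
    rw [l2]
    simp only [lapH4_sub, lapH4_smul]
    module
  have lhs : bdfEnergy m e1 e0 - bdfEnergy m e0 em
      ≤ gsum m (((3 / 2 : ℝ) • e1 - (2 : ℝ) • e0 + (1 / 2 : ℝ) • em) * e1) := by
    have : bdfEnergy m e1 e0 - bdfEnergy m e0 em = gsum m ((1 / 4 : ℝ) • (e1 ^ 2
        + ((2 : ℝ) • e1 - e0) ^ 2 - e0 ^ 2 - ((2 : ℝ) • e0 - em) ^ 2)) := by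
      simp only [bdfEnergy, map_smul, map_sub, map_add, smul_eq_mul]; ring
    rw [this]
    refine gsum_mono fun i j => ?_
    simp only [Pi.add_apply, Pi.sub_apply, Pi.mul_apply, Pi.smul_apply, Pi.pow_apply, smul_eq_mul]
    nlinarith [sq_nonneg (e1 i j - 2 * e0 i j + em i j)]
  set Y1 := gsum m (lapH4 h e1 ^ 2) with hY1
  set Y0 := gsum m (lapH4 h e0 ^ 2) with hY0
  set X1 := gsum m (e1 ^ 2) with hX1
  set Z0 := gsum m (z ^ 2) with hZ0
  have expand : gsum m (((3 / 2 : ℝ) • e1 - (2 : ℝ) • e0 + (1 / 2 : ℝ) • em) * e1)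
      = Δt * (gsum m (lapH4 h c * e1) + gsum m (-z * lapH4 h e1) - ε ^ 2 * Y1
        + (-(A * Δt)) * (Y1 - gsum m (lapH4 h e0 * lapH4 h e1))
        + gsum m (ρ * lapH4 h e1) + gsum m (ρx * D4 h 1 0 e1) + gsum m (ρy * D4 h 0 1 e1))
        + gsum m (r * e1) := by
    rw [err]
    simp only [add_mul, sub_mul, smul_mul_assoc, map_add, map_sub, map_smul, smul_eq_mul]
    rw [gsum_lapH4_mul_comm pz p1, gsum_lapH4_mul_comm (p1.lapH4 h) p1,
      gsum_lapH4_mul_comm (p0.lapH4 h) p1, gsum_lapH4_mul_comm hρ p1, gsum_D4_mul_comm hρx p1,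
      gsum_D4_mul_comm hρy p1, hY1, sq, neg_mul, map_neg]
    ring_nf
  have hδ : 0 < ε ^ 2 / 16 := by positivity
  have c1 := gsum_lapH4_cubic_le hψ1 p1 hh.ne' hδ hB hKx hKy
  have c2 := gsum_mul_le m (-z) (lapH4 h e1) hδ
  have c3 := gsum_mul_le m ρ (lapH4 h e1) hδ
  have c4 := gsum_mul_le m ρx (D4 h 1 0 e1) hδ
  have c5 := gsum_mul_le m ρy (D4 h 0 1 e1) hδ
  have c6 := gsum_mul_le m r e1 hΔt
  have c7 := gsum_mul_le m (lapH4 h e0) (lapH4 h e1) (δ := 1 / 2) (by norm_num)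
  have c8 := gsum_mul_le m (-lapH4 h e0) (lapH4 h e1) (δ := 1 / 2) (by norm_num)
  have c9 := gsum_D4_sq_add_le p1 h
  rw [neg_sq] at c2 c8
  rw [neg_mul, map_neg] at c8
  have d1 := gsum_sq_nonneg m (D4 h 1 0 e1)
  have d2 := gsum_sq_nonneg m (D4 h 0 1 e1)
  have hY1n : 0 ≤ Y1 := gsum_sq_nonneg _ _
  have hY0n : 0 ≤ Y0 := gsum_sq_nonneg _ _
  have hX1n : 0 ≤ X1 := gsum_sq_nonneg _ _
  have hZ0n : 0 ≤ Z0 := gsum_sq_nonneg _ _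
  have eδ : 1 / (4 * (ε ^ 2 / 16)) = 4 / ε ^ 2 := by field_simp; norm_num
  rw [eδ] at c1 c2 c3 c4 c5
  -- the stabilization term is small compared with the surface diffusion, whatever the sign of `A`
  have stab : (-(A * Δt)) * (Y1 - gsum m (lapH4 h e0 * lapH4 h e1))
      ≤ ε ^ 2 / 16 * (3 / 2 * Y1 + 1 / 2 * Y0) := by
    have b1 : |Y1 - gsum m (lapH4 h e0 * lapH4 h e1)| ≤ 3 / 2 * Y1 + 1 / 2 * Y0 := by
      rw [abs_le]; constructor <;> linarith
    calc (-(A * Δt)) * (Y1 - gsum m (lapH4 h e0 * lapH4 h e1))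
        ≤ |(-(A * Δt)) * (Y1 - gsum m (lapH4 h e0 * lapH4 h e1))| := le_abs_self _
      _ = |A| * Δt * |Y1 - gsum m (lapH4 h e0 * lapH4 h e1)| := by
          rw [abs_mul, abs_neg, abs_mul, abs_of_pos hΔt]
      _ ≤ ε ^ 2 / 16 * (3 / 2 * Y1 + 1 / 2 * Y0) := mul_le_mul hA b1 (abs_nonneg _) hδ.le
  set G := 4 / ε ^ 2 with hG
  set P := 400 * (1 + B ^ 2) * K ^ 2 with hP
  have hG0 : 0 ≤ G := by positivity
  have hP0 : 0 ≤ P := by positivity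
  have inner : gsum m (lapH4 h c * e1) + gsum m (-z * lapH4 h e1) - ε ^ 2 * Y1
        + (-(A * Δt)) * (Y1 - gsum m (lapH4 h e0 * lapH4 h e1))
        + gsum m (ρ * lapH4 h e1) + gsum m (ρx * D4 h 1 0 e1) + gsum m (ρy * D4 h 0 1 e1)
      ≤ -(ε ^ 2 / 2) * Y1 + ε ^ 2 / 32 * Y0 + (G + P) * X1 + G * Z0
        + G * (gsum m (ρ ^ 2) + gsum m (ρx ^ 2) + gsum m (ρy ^ 2)) := by
    have w1 : ε ^ 2 / 16 * gsum m (D4 h 1 0 e1 ^ 2) + ε ^ 2 / 16 * gsum m (D4 h 0 1 e1 ^ 2)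
        ≤ ε ^ 2 / 16 * Y1 := by rw [← mul_add]; exact mul_le_mul_of_nonneg_left c9 hδ.le
    have w2 : 0 ≤ ε ^ 2 * Y1 := by positivity
    linarith only [c1, c2, c3, c4, c5, stab, w1, w2]
  have hE1 : X1 ≤ 4 * bdfEnergy m e1 e0 := by
    have := gsum_sq_nonneg m ((2 : ℝ) • e1 - e0)
    simp only [bdfEnergy]; linarith
  have hE0 : Z0 ≤ 4 * bdfEnergy m e0 em := by
    have := gsum_sq_nonneg m e0
    simp only [bdfEnergy]; linarith
  have hn1 := bdfEnergy_nonneg m e1 e0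
  have hn0 := bdfEnergy_nonneg m e0 em
  have hfin : (G + P) * X1 + G * Z0 + X1
      ≤ (16 / ε ^ 2 + 1600 * (1 + B ^ 2) * K ^ 2 + 4)
        * (bdfEnergy m e1 e0 + bdfEnergy m e0 em) := by
    have ec : 16 / ε ^ 2 + 1600 * (1 + B ^ 2) * K ^ 2 + 4 = 4 * (G + P + 1) := by
      rw [hG, hP]; ring
    rw [ec]
    have v1 : (G + P + 1) * X1 ≤ (G + P + 1) * (4 * bdfEnergy m e1 e0) :=
      mul_le_mul_of_nonneg_left hE1 (by positivity)
    have v2 : (G + P + 1) * Z0 ≤ (G + P + 1) * (4 * bdfEnergy m e0 em) :=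
      mul_le_mul_of_nonneg_left hE0 (by positivity)
    have v3 : 0 ≤ (P + 1) * Z0 := by positivity
    linarith only [v1, v2, v3]
  have s1 := mul_le_mul_of_nonneg_left inner hΔt.le
  have s2 := mul_le_mul_of_nonneg_left hfin hΔt.le
  linarith only [lhs, expand, s1, s2, c6]

/-! ### Discrete Gronwall inequality -/

theorem discrete_gronwall {a : ℕ → ℝ} {s : ℕ → ℝ} {c : ℝ} (hc : 0 ≤ c) (hc2 : c ≤ 1 / 2)
    (n : ℕ) (ha : ∀ k, 0 ≤ a k) (hs : ∀ k, 0 ≤ s k)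
    (h : ∀ k < n, a (k + 1) ≤ a k + c * (a (k + 1) + a k) + s k) :
    ∀ k ≤ n, a k ≤ Real.exp (4 * c * k) * (a 0 + 2 * ∑ j ∈ Finset.range k, s j) := by
  intro k
  induction k with
  | zero => intro _; simp
  | succ k ih =>
    intro hk
    have h1 := h k (by omega)
    have h2 := ih (by omega)
    set P := a 0 + 2 * ∑ j ∈ Finset.range k, s j with hP
    have hP0 : 0 ≤ P := by
      have := Finset.sum_nonneg (s := Finset.range k) fun j _ => hs j
      have := ha 0
      positivity
    have h3 : a (k + 1) ≤ (1 + 4 * c) * a k + 2 * s k := by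
      have : (1 - c) * ((1 + 4 * c) * a k + 2 * s k)
          = (1 + c) * a k + s k + (2 * c * (1 - 2 * c) * a k + (1 - 2 * c) * s k) := by ring
      have h4 : 0 ≤ 2 * c * (1 - 2 * c) * a k + (1 - 2 * c) * s k := by
        have := ha k; have := hs k
        have h5 : 0 ≤ 1 - 2 * c := by linarith
        positivity
      have h6 : (1 - c) * a (k + 1) ≤ (1 - c) * ((1 + 4 * c) * a k + 2 * s k) := by linarith
      exact le_of_mul_le_mul_left h6 (by linarith)
    have h7 : 1 + 4 * c ≤ Real.exp (4 * c) := by linarith [Real.add_one_le_exp (4 * c)]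
    have e1 : Real.exp (4 * c * ((k + 1 : ℕ) : ℝ)) = Real.exp (4 * c) * Real.exp (4 * c * k) := by
      rw [← Real.exp_add]; push_cast; ring_nf
    have h8 : 1 ≤ Real.exp (4 * c) * Real.exp (4 * c * k) := by
      rw [← Real.exp_add]; exact Real.one_le_exp (by positivity)
    rw [e1, Finset.sum_range_succ, mul_add 2, ← add_assoc, ← hP, mul_add]
    have h9 : (1 + 4 * c) * a k ≤ Real.exp (4 * c) * (Real.exp (4 * c * k) * P) :=
      mul_le_mul h7 h2 (ha k) (Real.exp_pos _).le
    have h10 := mul_le_mul_of_nonneg_right h8 (hs k)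
    linarith

/-! ### Time regularity: from weak to classical time derivatives -/

/-- Smooth functions of time with compact support in `(0, T)`. -/
structure IsTimeTest (T : ℝ) (η : ℝ → ℝ) : Prop where
  smooth : ContDiff ℝ ∞ η
  compact : HasCompactSupport η
  supp : tsupport η ⊆ Ioo 0 T

theorem IsTimeTest.deriv {T : ℝ} {η : ℝ → ℝ} (h : IsTimeTest T η) : IsTimeTest T (deriv η) where
  smooth := (contDiff_infty_iff_deriv.1 h.smooth).2
  compact := h.compact.deriv
  supp := tsupport_deriv_subset.trans h.supp

theorem IsTimeTest.eq_zero {T : ℝ} {η : ℝ → ℝ} (h : IsTimeTest T η) {t : ℝ} (ht : t ∉ Ioo 0 T) :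
    η t = 0 := image_eq_zero_of_notMem_tsupport fun h' => ht (h.supp h')

theorem IsTimeTest.integrable {T : ℝ} {η : ℝ → ℝ} (h : IsTimeTest T η) (μ : Measure ℝ)
    [IsFiniteMeasureOnCompacts μ] : Integrable η μ :=
  h.smooth.continuous.integrable_of_hasCompactSupport h.compact

/-- A test function of mean zero is the derivative of a test function. -/
theorem IsTimeTest.exists_primitive {T : ℝ} {κ : ℝ → ℝ} (h : IsTimeTest T κ)
    (h0 : ∫ t, κ t = 0) : ∃ ζ, IsTimeTest T ζ ∧ _root_.deriv ζ = κ := by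
  rcases (tsupport κ).eq_empty_or_nonempty with he | hne
  · refine ⟨0, ⟨contDiff_const, HasCompactSupport.zero, by simp⟩, ?_⟩
    rw [tsupport_eq_empty_iff] at he
    rw [he]; exact deriv_zero
  have hK : IsCompact (tsupport κ) := h.compact
  set a := sInf (tsupport κ) with ha
  set b := sSup (tsupport κ) with hb
  have ha0 : 0 < a := (h.supp (hK.sInf_mem hne)).1
  have hbT : b < T := (h.supp (hK.sSup_mem hne)).2
  have hz : ∀ s, s < a ∨ b < s → κ s = 0 := by
    intro s hs
    refine image_eq_zero_of_notMem_tsupport fun hm => ?_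
    rcases hs with hs | hs
    · exact absurd (csInf_le hK.bddBelow hm) (not_le.2 hs)
    · exact absurd (le_csSup hK.bddAbove hm) (not_le.2 hs)
  have hder : ∀ t, HasDerivAt (fun t => ∫ s in (0 : ℝ)..t, κ s) (κ t) t := fun t =>
    intervalIntegral.integral_hasDerivAt_right (h.smooth.continuous.intervalIntegrable _ _)
      (h.smooth.continuous.stronglyMeasurableAtFilter _ _) h.smooth.continuous.continuousAt
  have hd : _root_.deriv (fun t => ∫ s in (0 : ℝ)..t, κ s) = κ := funext fun t => (hder t).deriv
  have hsupp : Function.support (fun t => ∫ s in (0 : ℝ)..t, κ s) ⊆ Icc a b := by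
    intro t ht
    by_contra hn
    refine ht ?_
    rcases lt_or_ge t a with h1 | h1
    · refine intervalIntegral.integral_zero_ae (Filter.Eventually.of_forall fun s hs => hz s ?_)
      rw [mem_uIoc] at hs
      left
      rcases hs with hs | hs <;> linarith [hs.1, hs.2]
    · have h2 : b < t := by
        by_contra h3
        exact hn ⟨h1, not_lt.1 h3⟩
      simp only
      rw [intervalIntegral.integral_eq_integral_of_support_subset, h0]
      intro s hs
      by_contra h4
      refine hs (hz s ?_)
      rw [mem_Ioc, not_and_or] at h4
      rcases h4 with h4 | h4
      · left; linarith
      · right; linarith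
  have hts : tsupport (fun t => ∫ s in (0 : ℝ)..t, κ s) ⊆ Icc a b :=
    closure_minimal hsupp isClosed_Icc
  refine ⟨fun t => ∫ s in (0 : ℝ)..t, κ s, ⟨?_, ?_, ?_⟩, hd⟩
  · rw [contDiff_infty_iff_deriv, hd]
    exact ⟨fun t => (hder t).differentiableAt, h.smooth⟩
  · exact HasCompactSupport.of_support_subset_isCompact isCompact_Icc hsupp
  · exact hts.trans (Icc_subset_Ioo ha0 hbT)

theorem exists_isTimeTest_integral_eq_one {T : ℝ} (hT : 0 < T) :
    ∃ χ, IsTimeTest T χ ∧ ∫ t, χ t = 1 := by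
  let f : ContDiffBump (T / 2) := ⟨T / 8, T / 4, by positivity, by linarith⟩
  refine ⟨f.normed volume, ⟨f.contDiff_normed, f.hasCompactSupport_normed, ?_⟩, f.integral_normed⟩
  rw [f.tsupport_normed_eq, Real.closedBall_eq_Icc]
  exact Icc_subset_Ioo (by simp only [f]; linarith) (by simp only [f]; linarith)

theorem IsTimeTest.integrable_smul {X : Type*} [NormedAddCommGroup X] [NormedSpace ℝ X]
    {T : ℝ} {η : ℝ → ℝ} (h : IsTimeTest T η) {v : ℝ → X}
    (hv : Integrable v (volume.restrict (Ioo 0 T))) :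
    Integrable (fun t => η t • v t) (volume.restrict (Ioo 0 T)) := by
  obtain ⟨C, hC⟩ := h.compact.exists_bound_of_continuous h.smooth.continuous
  exact hv.bdd_smul C h.smooth.continuous.aestronglyMeasurable (Filter.Eventually.of_forall hC)

/-- The lemma of du Bois-Reymond: a function with vanishing weak derivative is constant. -/
theorem ae_eq_const_of_integral_deriv_smul_eq_zero {X : Type*} [NormedAddCommGroup X]
    [NormedSpace ℝ X]
    [CompleteSpace X] {T : ℝ} (hT : 0 < T) {v : ℝ → X}
    (hv : Integrable v (volume.restrict (Ioo 0 T)))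
    (h : ∀ η, IsTimeTest T η → ∫ t in Ioo 0 T, deriv η t • v t = 0) :
    ∃ c, ∀ᵐ t ∂(volume.restrict (Ioo 0 T)), v t = c := by
  obtain ⟨χ, hχ, hχ1⟩ := exists_isTimeTest_integral_eq_one hT
  set c := ∫ t in Ioo 0 T, χ t • v t with hc
  refine ⟨c, ?_⟩
  have key : ∀ η, IsTimeTest T η → ∫ t in Ioo 0 T, η t • (v t - c) = 0 := by
    intro η hη
    have hκ : IsTimeTest T (fun t => η t - (∫ s, η s) * χ t) := by
      refine ⟨hη.smooth.sub (contDiff_const.mul hχ.smooth), ?_, ?_⟩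
      · exact hη.compact.sub (hχ.compact.mul_left)
      · have hs : Function.support (fun t => η t - (∫ s, η s) * χ t)
            ⊆ tsupport η ∪ tsupport χ := by
          intro t ht
          by_contra hn
          rw [mem_union, not_or] at hn
          refine ht ?_
          simp [image_eq_zero_of_notMem_tsupport hn.1, image_eq_zero_of_notMem_tsupport hn.2]
        exact (closure_minimal hs ((isClosed_tsupport _).union (isClosed_tsupport _))).trans
          (union_subset hη.supp hχ.supp)
    have hκ0 : ∫ t, (η t - (∫ s, η s) * χ t) = 0 := by
      rw [integral_sub (hη.integrable _) ((hχ.integrable _).const_mul _), integral_const_mul, hχ1]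
      ring
    obtain ⟨ζ, hζ, hζd⟩ := hκ.exists_primitive hκ0
    have h1 := h ζ hζ
    rw [hζd] at h1
    have hηint : ∫ t in Ioo 0 T, η t = ∫ t, η t :=
      setIntegral_eq_integral_of_forall_compl_eq_zero fun t ht => hη.eq_zero ht
    have e1 : ∫ t in Ioo 0 T, (η t - (∫ s, η s) * χ t) • v t
        = (∫ t in Ioo 0 T, η t • v t) - (∫ s, η s) • c := by
      rw [hc, ← integral_smul, ← integral_sub (hη.integrable_smul hv)
        (show Integrable (fun t => (∫ s, η s) • χ t • v t) _ from (hχ.integrable_smul hv).smul _)]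
      simp only [sub_smul, mul_smul]
    have e2 : ∫ t in Ioo 0 T, η t • (v t - c)
        = (∫ t in Ioo 0 T, η t • v t) - (∫ s, η s) • c := by
      simp only [smul_sub]
      rw [integral_sub (hη.integrable_smul hv) ((hη.integrable _).smul_const c),
        integral_smul_const]
      rw [hηint]
    rw [e2, ← e1, h1]
  have hloc : LocallyIntegrableOn (fun t => v t - c) (Ioo 0 T) volume := by
    refine IntegrableOn.locallyIntegrableOn ?_
    exact Integrable.sub hv (integrable_const c)
  have := isOpen_Ioo.ae_eq_zero_of_integral_contDiff_smul_eq_zero hloc fun g hg hgc hgs => by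
    have hg' : IsTimeTest T g := ⟨hg, hgc, hgs⟩
    rw [← key g hg']
    refine (setIntegral_eq_integral_of_forall_compl_eq_zero fun t ht => ?_).symm
    rw [hg'.eq_zero ht, zero_smul]
  rw [ae_restrict_iff' measurableSet_Ioo]
  filter_upwards [this] with t ht hm
  exact sub_eq_zero.1 (ht hm)

/-- The primitive of an integrable function has that function as its weak derivative. -/
theorem integral_deriv_smul_primitive {X : Type*} [NormedAddCommGroup X] [NormedSpace ℝ X]
    [CompleteSpace X] {T : ℝ} {v : ℝ → X}
    (hv : Integrable v (volume.restrict (Ioo 0 T))) {η : ℝ → ℝ} (hη : IsTimeTest T η) :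
    ∫ t in Ioo 0 T, deriv η t • ∫ s in (0 : ℝ)..t, v s = -∫ t in Ioo 0 T, η t • v t := by
  set μ := (volume : Measure ℝ).restrict (Ioo 0 T) with hμ
  set f : ℝ → ℝ → X := fun t s => (Iic t).indicator (fun s => deriv η t • v s) s with hf
  have hfi : Integrable (Function.uncurry f) (μ.prod μ) := by
    have e : Function.uncurry f
        = {p : ℝ × ℝ | p.2 ≤ p.1}.indicator (fun p => deriv η p.1 • v p.2) := by
      ext p; simp [f, Function.uncurry, indicator]
    rw [e]
    exact ((hη.deriv.integrable μ).smul_prod hv).indicator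
      (measurableSet_le measurable_snd measurable_fst)
  have h1 := integral_integral_swap hfi
  have h2 : ∫ t, ∫ s, f t s ∂μ ∂μ = ∫ t in Ioo 0 T, deriv η t • ∫ s in (0 : ℝ)..t, v s := by
    refine setIntegral_congr_fun measurableSet_Ioo fun t ht => ?_
    simp only [hf]
    rw [integral_indicator measurableSet_Iic, integral_smul, hμ,
      Measure.restrict_restrict measurableSet_Iic, intervalIntegral.integral_of_le ht.1.le]
    congr 3
    ext s; simp only [mem_inter_iff, mem_Iic, mem_Ioo, mem_Ioc]
    constructor
    · rintro ⟨a, b, c⟩; exact ⟨b, a⟩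
    · rintro ⟨a, b⟩; exact ⟨b, a, b.trans_lt ht.2⟩
  have h3 : ∫ s, ∫ t, f t s ∂μ ∂μ = ∫ s in Ioo 0 T, -η s • v s := by
    refine setIntegral_congr_fun measurableSet_Ioo fun s hs => ?_
    simp only [hf]
    have e1 : (fun t => (Iic t).indicator (fun s => deriv η t • v s) s)
        = (Ici s).indicator (fun t => deriv η t • v s) := by
      ext t; simp [indicator]
    rw [e1, integral_indicator measurableSet_Ici, integral_smul_const, hμ,
      Measure.restrict_restrict measurableSet_Ici]
    congr 1
    have e2 : Ici s ∩ Ioo 0 T = Ico s T := by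
      ext t; simp only [mem_inter_iff, mem_Ici, mem_Ioo, mem_Ico]
      constructor
      · rintro ⟨a, b, c⟩; exact ⟨a, c⟩
      · rintro ⟨a, b⟩; exact ⟨a, hs.1.trans_le a, b⟩
    rw [e2, integral_Ico_eq_integral_Ioc, ← intervalIntegral.integral_of_le hs.2.le,
      intervalIntegral.integral_deriv_eq_sub
        (fun t _ => (contDiff_infty_iff_deriv.1 hη.smooth).1 t)
        (hη.deriv.smooth.continuous.intervalIntegrable _ _), hη.eq_zero (by simp), zero_sub]
  rw [← h2, h1, h3, ← integral_neg]
  simp only [neg_smul]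
  rfl

theorem ae_eq_const_add_integral {X : Type*} [NormedAddCommGroup X] [NormedSpace ℝ X]
    [CompleteSpace X] {T : ℝ} (hT : 0 < T) {u v : ℝ → X}
    (hu : Integrable u (volume.restrict (Ioo 0 T)))
    (hv : Integrable v (volume.restrict (Ioo 0 T)))
    (h : ∀ η, IsTimeTest T η →
      ∫ t in Ioo 0 T, deriv η t • u t = -∫ t in Ioo 0 T, η t • v t) :
    ∃ c, ∀ᵐ t ∂(volume.restrict (Ioo 0 T)), u t = c + ∫ s in (0 : ℝ)..t, v s := by
  have hv' : IntegrableOn v (Icc 0 T) := by rwa [integrableOn_Icc_iff_integrableOn_Ioo]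
  have hp : Integrable (fun t => ∫ s in (0 : ℝ)..t, v s) (volume.restrict (Ioo 0 T)) := by
    have hc : ContinuousOn (fun t => ∫ s in (0 : ℝ)..t, v s) (Icc 0 T) :=
      intervalIntegral.continuousOn_primitive_interval (by rwa [uIcc_of_le hT.le]) |>.mono
        (by rw [uIcc_of_le hT.le])
    exact (hc.integrableOn_Icc).mono_set Ioo_subset_Icc_self
  obtain ⟨c, hc⟩ := ae_eq_const_of_integral_deriv_smul_eq_zero hT
    (v := fun t => u t - ∫ s in (0 : ℝ)..t, v s) (hu.sub hp) fun η hη => by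
      simp only [smul_sub]
      rw [integral_sub (hη.deriv.integrable_smul hu) (hη.deriv.integrable_smul hp), h η hη,
        integral_deriv_smul_primitive hv hη, sub_self]
  refine ⟨c, ?_⟩
  filter_upwards [hc] with t ht
  rw [← ht]; abel

/-- A continuous function of class `H³(0, T; X)` extends to a function on the line with two
classical derivatives; the second derivative is a primitive of a square integrable function, and
is constant before time `0`. -/
theorem exists_time_extension {X : Type*} [NormedAddCommGroup X] [NormedSpace ℝ X]
    [CompleteSpace X] {T : ℝ} (hT : 0 < T) {u : ℝ → X} (hc : ContinuousOn u (Icc 0 T))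
    (hu : MemHTime 3 T u) :
    ∃ U V W G : ℝ → X, (∀ t, HasDerivAt U (V t) t) ∧ (∀ t, HasDerivAt V (W t) t) ∧
      Continuous W ∧ MemLp G 2 volume ∧ (∀ s t, W t - W s = ∫ r in s..t, G r) ∧
      (∀ a b, IntervalIntegrable G volume a b) ∧
      (∀ t ≤ 0, W t = W 0) ∧ ∀ t ∈ Icc 0 T, U t = u t := by
  obtain ⟨hu2, hw⟩ := hu
  obtain ⟨v1, hv1, h1⟩ := hw 1 (by norm_num)
  obtain ⟨v2, hv2, h2⟩ := hw 2 (by norm_num)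
  obtain ⟨v3, hv3, h3⟩ := hw 3 (by norm_num)
  have hint : ∀ {v : ℝ → X}, MemLp v 2 (volume.restrict (Ioo 0 T)) →
      Integrable v (volume.restrict (Ioo 0 T)) := fun hv => hv.integrable (by norm_num)
  have k1 : ∀ η, IsTimeTest T η →
      ∫ t in Ioo 0 T, deriv η t • u t = -∫ t in Ioo 0 T, η t • v1 t := by
    intro η hη
    have := h1 η hη.smooth hη.compact hη.supp
    simpa [iteratedDeriv_one] using this
  have k2 : ∀ η, IsTimeTest T η →
      ∫ t in Ioo 0 T, deriv η t • v1 t = -∫ t in Ioo 0 T, η t • v2 t := by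
    intro η hη
    have e1 := h2 η hη.smooth hη.compact hη.supp
    have e2 := k1 _ hη.deriv
    have e3 : iteratedDeriv 2 η = deriv (deriv η) := by
      rw [iteratedDeriv_succ, iteratedDeriv_one]
    rw [e3, e2] at e1
    rw [← neg_inj, e1]; simp
  have k3 : ∀ η, IsTimeTest T η →
      ∫ t in Ioo 0 T, deriv η t • v2 t = -∫ t in Ioo 0 T, η t • v3 t := by
    intro η hη
    have e1 := h3 η hη.smooth hη.compact hη.supp
    have e2 := k1 _ hη.deriv.deriv
    have e4 := k2 _ hη.deriv
    have e3 : iteratedDeriv 3 η = deriv (deriv (deriv η)) := by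
      rw [iteratedDeriv_succ, iteratedDeriv_succ, iteratedDeriv_one]
    rw [e3, e2, e4] at e1
    rw [← neg_neg (∫ t in Ioo 0 T, deriv η t • v2 t), e1]
    norm_num
  obtain ⟨c2, hc2⟩ := ae_eq_const_add_integral hT (hint hv2) (hint hv3) k3
  obtain ⟨c1, hc1⟩ := ae_eq_const_add_integral hT (hint hv1) (hint hv2) k2
  obtain ⟨c0, hc0⟩ := ae_eq_const_add_integral hT (hint hu2) (hint hv1) k1
  set G : ℝ → X := (Ioo 0 T).indicator v3 with hG
  have hGi : ∀ a b, IntervalIntegrable G volume a b := fun a b =>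
    (IntegrableOn.integrable_indicator (hint hv3) measurableSet_Ioo).intervalIntegrable
  have hcongr : ∀ {f g : ℝ → X}, (∀ᵐ t ∂(volume.restrict (Ioo 0 T)), f t = g t) →
      ∀ t ∈ Ioo 0 T, ∫ s in (0 : ℝ)..t, f s = ∫ s in (0 : ℝ)..t, g s := by
    intro f g hfg t ht
    refine intervalIntegral.integral_congr_ae ?_
    rw [ae_restrict_iff' measurableSet_Ioo] at hfg
    filter_upwards [hfg] with s hs hm
    rw [uIoc_of_le ht.1.le] at hm
    exact hs ⟨hm.1, hm.2.trans_lt ht.2⟩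
  have hmem : ∀ᵐ t ∂((volume : Measure ℝ).restrict (Ioo 0 T)), t ∈ Ioo 0 T :=
    ae_restrict_mem measurableSet_Ioo
  set W : ℝ → X := fun t => c2 + ∫ s in (0 : ℝ)..t, G s with hW
  have hWc : Continuous W := continuous_const.add (intervalIntegral.continuous_primitive hGi 0)
  set V : ℝ → X := fun t => c1 + ∫ s in (0 : ℝ)..t, W s with hV
  have hVd : ∀ t, HasDerivAt V (W t) t := fun t =>
    (intervalIntegral.integral_hasDerivAt_right (hWc.intervalIntegrable _ _)
      (hWc.stronglyMeasurableAtFilter _ _) hWc.continuousAt).const_add c1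
  have hVc : Continuous V := continuous_iff_continuousAt.2 fun t => (hVd t).continuousAt
  set U : ℝ → X := fun t => c0 + ∫ s in (0 : ℝ)..t, V s with hU
  have hUd : ∀ t, HasDerivAt U (V t) t := fun t =>
    (intervalIntegral.integral_hasDerivAt_right (hVc.intervalIntegrable _ _)
      (hVc.stronglyMeasurableAtFilter _ _) hVc.continuousAt).const_add c0
  have hUc : Continuous U := continuous_iff_continuousAt.2 fun t => (hUd t).continuousAt
  have a3 : ∀ᵐ t ∂(volume.restrict (Ioo 0 T)), v3 t = G t := by
    filter_upwards [hmem] with t ht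
    rw [hG, indicator_of_mem ht]
  have a2 : ∀ᵐ t ∂(volume.restrict (Ioo 0 T)), v2 t = W t := by
    filter_upwards [hc2, hmem] with t ht hm
    rw [ht, hcongr a3 t hm]
  have a1 : ∀ᵐ t ∂(volume.restrict (Ioo 0 T)), v1 t = V t := by
    filter_upwards [hc1, hmem] with t ht hm
    rw [ht, hcongr a2 t hm]
  have a0 : ∀ᵐ t ∂(volume.restrict (Ioo 0 T)), U t = u t := by
    filter_upwards [hc0, hmem] with t ht hm
    rw [ht, hcongr a1 t hm]
  refine ⟨U, V, W, G, hUd, hVd, hWc, ?_, ?_, hGi, ?_, ?_⟩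
  · rwa [hG, memLp_indicator_iff_restrict measurableSet_Ioo]
  · intro s t
    simp only [hW, add_sub_add_left_eq_sub]
    exact intervalIntegral.integral_interval_sub_left (hGi _ _) (hGi _ _)
  · intro t ht
    simp only [hW, intervalIntegral.integral_same]
    congr 1
    refine intervalIntegral.integral_zero_ae (Filter.Eventually.of_forall fun s hs => ?_)
    rw [uIoc_of_ge ht] at hs
    exact indicator_of_notMem (fun h => absurd h.1 (not_lt.2 hs.2)) _
  · have a0' : U =ᵐ[volume.restrict (Icc 0 T)] u := by
      rw [restrict_Ioo_eq_restrict_Icc.symm]; exact a0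
    exact fun t ht => Measure.eqOn_Icc_of_ae_eq volume hT.ne a0' hUc.continuousOn hc ht

/-! ### Directional derivatives and Taylor expansion -/

/-- `g` is the derivative of `f` in the direction `d`, everywhere. -/
def HasDir (d : ℝ × ℝ) (f g : ℝ × ℝ → ℝ) : Prop :=
  ∀ p, ∀ s : ℝ, HasDerivAt (fun s : ℝ => f (p + s • d)) (g (p + s • d)) s

theorem HasDir.add {d : ℝ × ℝ} {f g f' g' : ℝ × ℝ → ℝ} (h : HasDir d f f') (h' : HasDir d g g') :
    HasDir d (f + g) (f' + g') := fun p s => (h p s).add (h' p s)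

theorem HasDir.smul {d : ℝ × ℝ} {f f' : ℝ × ℝ → ℝ} (h : HasDir d f f') (c : ℝ) :
    HasDir d (c • f) (c • f') := fun p s => (h p s).const_mul c

theorem HasDir.mul {d : ℝ × ℝ} {f g f' g' : ℝ × ℝ → ℝ} (h : HasDir d f f') (h' : HasDir d g g') :
    HasDir d (f * g) (f' * g + f * g') := fun p s => (h p s).mul (h' p s)

theorem abs_sub_le_of_abs_deriv_le_pow {F F' : ℝ → ℝ} {K : ℝ} (hK : 0 ≤ K) (n : ℕ)
    (hF : ∀ s, HasDerivAt F (F' s) s) (hF' : ∀ s, |F' s| ≤ K * |s| ^ n) (s : ℝ) :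
    |F s - F 0| ≤ K * |s| ^ (n + 1) := by
  have := (convex_uIcc (0 : ℝ) s).norm_image_sub_le_of_norm_hasDerivWithin_le (f := F) (f' := F')
    (C := K * |s| ^ n) (fun x _ => (hF x).hasDerivWithinAt) (fun x hx => by
      rw [Real.norm_eq_abs]
      refine (hF' x).trans ?_
      have hx' : |x| ≤ |s| := by
        have := abs_sub_left_of_mem_uIcc hx
        simpa using this
      gcongr) left_mem_uIcc right_mem_uIcc
  rw [Real.norm_eq_abs, Real.norm_eq_abs, sub_zero] at this
  rw [pow_succ, ← mul_assoc]
  exact this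

theorem taylor_bound_two {F F1 F2 : ℝ → ℝ} {M : ℝ} (h1 : ∀ s, HasDerivAt F (F1 s) s)
    (h2 : ∀ s, HasDerivAt F1 (F2 s) s) (hM : ∀ s, |F2 s| ≤ M) (s : ℝ) :
    |F s - F 0 - s * F1 0| ≤ M * |s| ^ 2 := by
  have hM0 : 0 ≤ M := (abs_nonneg _).trans (hM 0)
  have b1 : ∀ s, |F1 s - F1 0| ≤ M * |s| ^ 1 :=
    abs_sub_le_of_abs_deriv_le_pow hM0 0 h2 (by simpa using hM)
  have := abs_sub_le_of_abs_deriv_le_pow (F := fun s => F s - s * F1 0) hM0 1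
    (fun s => (h1 s).sub ((hasDerivAt_id s).mul_const _)) (by simpa using b1) s
  simp only [zero_mul, sub_zero] at this
  rwa [sub_right_comm]

theorem taylor_bound_four {F F1 F2 F3 F4 : ℝ → ℝ} {M : ℝ} (h1 : ∀ s, HasDerivAt F (F1 s) s)
    (h2 : ∀ s, HasDerivAt F1 (F2 s) s) (h3 : ∀ s, HasDerivAt F2 (F3 s) s)
    (h4 : ∀ s, HasDerivAt F3 (F4 s) s) (hM : ∀ s, |F4 s| ≤ M) (s : ℝ) :
    |F s - F 0 - s * F1 0 - s ^ 2 / 2 * F2 0 - s ^ 3 / 6 * F3 0| ≤ M * |s| ^ 4 := by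
  have hM0 : 0 ≤ M := (abs_nonneg _).trans (hM 0)
  have b2 : ∀ s, |F2 s - F2 0 - s * F3 0| ≤ M * |s| ^ 2 := taylor_bound_two h3 h4 hM
  have b1 : ∀ s, |F1 s - F1 0 - s * F2 0 - s ^ 2 / 2 * F3 0| ≤ M * |s| ^ 3 := by
    intro s
    have := abs_sub_le_of_abs_deriv_le_pow
      (F := fun s => F1 s - s * F2 0 - s ^ 2 / 2 * F3 0)
      (F' := fun s => F2 s - F2 0 - s * F3 0) hM0 2
      (fun s => by
        have := ((h2 s).sub ((hasDerivAt_id s).mul_const (F2 0))).sub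
          ((((hasDerivAt_id s).pow 2).div_const 2).mul_const (F3 0))
        exact this.congr_deriv (by simp)) b2 s
    convert this using 2
    simp; ring
  have := abs_sub_le_of_abs_deriv_le_pow
    (F := fun s => F s - s * F1 0 - s ^ 2 / 2 * F2 0 - s ^ 3 / 6 * F3 0)
    (F' := fun s => F1 s - F1 0 - s * F2 0 - s ^ 2 / 2 * F3 0) hM0 3
    (fun s => by
      have := (((h1 s).sub ((hasDerivAt_id s).mul_const (F1 0))).sub
          ((((hasDerivAt_id s).pow 2).div_const 2).mul_const (F2 0))).sub
          ((((hasDerivAt_id s).pow 3).div_const 6).mul_const (F3 0))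
      exact this.congr_deriv (by
        change F1 s - 1 * F1 0 - (2 : ℕ) * s ^ 1 * 1 / 2 * F2 0 - (3 : ℕ) * s ^ 2 * 1 / 6 * F3 0 = _
        push_cast
        ring)) b1 s
  convert this using 2
  simp; ring

/-! ### Local averages -/

/-- The average of `f` over the segment of length `h` in the direction `d` centred at the point. -/
def avg (h : ℝ) (d : ℝ × ℝ) (f : ℝ × ℝ → ℝ) : ℝ × ℝ → ℝ :=
  fun p => ∫ s in (-1 / 2 : ℝ)..(1 / 2), f (p + (s * h) • d)

theorem continuous_segment {h : ℝ} {d : ℝ × ℝ} {f : ℝ × ℝ → ℝ} (hf : Continuous f) (p : ℝ × ℝ) :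
    Continuous fun s : ℝ => f (p + (s * h) • d) := by fun_prop

theorem continuous_avg {h : ℝ} {d : ℝ × ℝ} {f : ℝ × ℝ → ℝ} (hf : Continuous f) :
    Continuous (avg h d f) := by
  unfold avg
  refine intervalIntegral.continuous_parametric_intervalIntegral_of_continuous' ?_ _ _
  fun_prop

theorem avg_add {h : ℝ} {d : ℝ × ℝ} {f g : ℝ × ℝ → ℝ} (hf : Continuous f) (hg : Continuous g) :
    avg h d (f + g) = avg h d f + avg h d g := funext fun p =>
  intervalIntegral.integral_add ((continuous_segment hf p).intervalIntegrable _ _)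
    ((continuous_segment hg p).intervalIntegrable _ _)

theorem avg_sub {h : ℝ} {d : ℝ × ℝ} {f g : ℝ × ℝ → ℝ} (hf : Continuous f) (hg : Continuous g) :
    avg h d (f - g) = avg h d f - avg h d g := funext fun p =>
  intervalIntegral.integral_sub ((continuous_segment hf p).intervalIntegrable _ _)
    ((continuous_segment hg p).intervalIntegrable _ _)

theorem avg_smul {h : ℝ} {d : ℝ × ℝ} (c : ℝ) (f : ℝ × ℝ → ℝ) :
    avg h d (c • f) = c • avg h d f := funext fun _ => intervalIntegral.integral_const_mul c _

/-- Translation of a function on the plane. -/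
def trP (v : ℝ × ℝ) (f : ℝ × ℝ → ℝ) : ℝ × ℝ → ℝ := fun p => f (p + v)

theorem continuous_trP {v : ℝ × ℝ} {f : ℝ × ℝ → ℝ} (hf : Continuous f) : Continuous (trP v f) := by
  unfold trP; fun_prop

theorem avg_trP (h : ℝ) (d v : ℝ × ℝ) (f : ℝ × ℝ → ℝ) :
    avg h d (trP v f) = trP v (avg h d f) := by
  ext p; simp only [avg, trP, add_right_comm]

theorem abs_avg_le {h : ℝ} {d : ℝ × ℝ} {f : ℝ × ℝ → ℝ} {M : ℝ} (hM : ∀ p, |f p| ≤ M) (p : ℝ × ℝ) :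
    |avg h d f p| ≤ M := by
  have := intervalIntegral.norm_integral_le_of_norm_le_const (a := -1 / 2) (b := 1 / 2) (C := M)
    (f := fun s : ℝ => f (p + (s * h) • d)) (fun s _ => hM _)
  rw [show |(1 / 2 : ℝ) - -1 / 2| = 1 by norm_num, mul_one] at this
  exact this

theorem avg_comm {h : ℝ} {d d' : ℝ × ℝ} {f : ℝ × ℝ → ℝ} (hf : Continuous f) :
    avg h d (avg h d' f) = avg h d' (avg h d f) := by
  ext p
  simp only [avg]
  rw [intervalIntegral_intervalIntegral_swap]
  · simp only [add_right_comm]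
  · have : Continuous (Function.uncurry fun s r : ℝ => f (p + (s * h) • d + (r * h) • d')) := by
      fun_prop
    refine (this.continuousOn.integrableOn_compact
      (isCompact_uIcc.prod isCompact_uIcc)).mono_set
      (prod_mono uIoc_subset_uIcc uIoc_subset_uIcc)

theorem smul_avg_deriv {h : ℝ} {d : ℝ × ℝ} {f g : ℝ × ℝ → ℝ} (hg : Continuous g)
    (hd : HasDir d f g) : h • avg h d g = trP ((h / 2) • d) f - trP (-(h / 2) • d) f := by
  ext p
  have hder : ∀ s ∈ uIcc (-1 / 2 : ℝ) (1 / 2), HasDerivAt (fun s : ℝ => f (p + (s * h) • d))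
      (h * g (p + (s * h) • d)) s := by
    intro s _
    have := (hd p (s * h)).comp s ((hasDerivAt_id s).mul_const h)
    simpa [mul_comm, Function.comp_def] using this
  have := intervalIntegral.integral_eq_sub_of_hasDerivAt hder
    ((by fun_prop : Continuous fun s : ℝ => h * g (p + (s * h) • d)).intervalIntegrable _ _)
  rw [intervalIntegral.integral_const_mul] at this
  simp only [Pi.smul_apply, smul_eq_mul, Pi.sub_apply, trP, avg]
  rw [this]
  congr 4 <;> ring_nf

/-- The centred second difference of `f` in the direction `d`, without the factor `h⁻²`. -/
def secDiff (h : ℝ) (d : ℝ × ℝ) (f : ℝ × ℝ → ℝ) : ℝ × ℝ → ℝ :=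
  trP (h • d) f - (2 : ℝ) • f + trP (-h • d) f

theorem secDiff_eq_avg_avg {h : ℝ} {d : ℝ × ℝ} {f g k : ℝ × ℝ → ℝ} (hg : Continuous g)
    (hk : Continuous k) (h1 : HasDir d f g) (h2 : HasDir d g k) :
    secDiff h d f = h ^ 2 • avg h d (avg h d k) := by
  have e1 : h ^ 2 • avg h d (avg h d k) = h • avg h d (h • avg h d k) := by
    rw [avg_smul, smul_smul, sq]
  rw [e1, smul_avg_deriv hk h2, avg_sub (continuous_trP hg) (continuous_trP hg), avg_trP, avg_trP,
    smul_sub]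
  have e2 : ∀ v, h • trP v (avg h d g) = trP v (h • avg h d g) := fun v => rfl
  rw [e2, e2, smul_avg_deriv hg h1]
  ext p
  simp only [secDiff, trP, Pi.sub_apply, Pi.add_apply, Pi.smul_apply, smul_eq_mul]
  have a1 : p + (h / 2) • d + (h / 2) • d = p + h • d := by module
  have a2 : p + (h / 2) • d + -(h / 2) • d = p := by module
  have a3 : p + -(h / 2) • d + (h / 2) • d = p := by module
  have a4 : p + -(h / 2) • d + -(h / 2) • d = p + -h • d := by module
  rw [a1, a2, a3, a4]
  ring

theorem secDiff_trP (h : ℝ) (d v : ℝ × ℝ) (f : ℝ × ℝ → ℝ) :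
    secDiff h d (trP v f) = trP v (secDiff h d f) := by
  ext p; simp only [secDiff, trP, Pi.sub_apply, Pi.add_apply, Pi.smul_apply, add_right_comm]

theorem avg_secDiff {h : ℝ} {d d' : ℝ × ℝ} {f : ℝ × ℝ → ℝ} (hf : Continuous f) :
    avg h d (secDiff h d' f) = secDiff h d' (avg h d f) := by
  unfold secDiff
  rw [avg_add ((continuous_trP hf).sub (hf.const_smul _)) (continuous_trP hf),
    avg_sub (continuous_trP hf) (hf.const_smul _), avg_trP, avg_trP, avg_smul]

theorem continuous_secDiff {h : ℝ} {d : ℝ × ℝ} {f : ℝ × ℝ → ℝ} (hf : Continuous f) :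
    Continuous (secDiff h d f) :=
  ((continuous_trP hf).sub (hf.const_smul _)).add (continuous_trP hf)

/-- A local average `f ↦ B * f` in the direction `d` which differs from the identity by `O(h⁴)` and
turns the second derivative into the fourth order difference quotient, see `planeD4_eq_bAvg`. -/
def bAvg (h : ℝ) (d : ℝ × ℝ) (f : ℝ × ℝ → ℝ) : ℝ × ℝ → ℝ :=
  avg h d (avg h d f) - (1 / 12 : ℝ) • secDiff h d (avg h d (avg h d f))

/-- The fourth order second difference quotient in the direction `d`, on functions on the plane. -/
def planeD4 (h : ℝ) (d : ℝ × ℝ) (f : ℝ × ℝ → ℝ) : ℝ × ℝ → ℝ :=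
  (1 / h ^ 2) • (secDiff h d f - (1 / 12 : ℝ) • secDiff h d (secDiff h d f))

theorem continuous_bAvg {h : ℝ} {d : ℝ × ℝ} {f : ℝ × ℝ → ℝ} (hf : Continuous f) :
    Continuous (bAvg h d f) :=
  (continuous_avg (continuous_avg hf)).sub
    ((continuous_secDiff (continuous_avg (continuous_avg hf))).const_smul _)

theorem continuous_planeD4 {h : ℝ} {d : ℝ × ℝ} {f : ℝ × ℝ → ℝ} (hf : Continuous f) :
    Continuous (planeD4 h d f) :=
  ((continuous_secDiff hf).sub
    ((continuous_secDiff (continuous_secDiff hf)).const_smul _)).const_smul _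

theorem secDiff_smul (h : ℝ) (d : ℝ × ℝ) (c : ℝ) (f : ℝ × ℝ → ℝ) :
    secDiff h d (c • f) = c • secDiff h d f := by
  ext p; simp only [secDiff, trP, Pi.sub_apply, Pi.add_apply, Pi.smul_apply, smul_eq_mul]; ring

theorem secDiff_sub (h : ℝ) (d : ℝ × ℝ) (f g : ℝ × ℝ → ℝ) :
    secDiff h d (f - g) = secDiff h d f - secDiff h d g := by
  ext p; simp only [secDiff, trP, Pi.sub_apply, Pi.add_apply, Pi.smul_apply, smul_eq_mul]; ring

theorem secDiff_add (h : ℝ) (d : ℝ × ℝ) (f g : ℝ × ℝ → ℝ) :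
    secDiff h d (f + g) = secDiff h d f + secDiff h d g := by
  ext p; simp only [secDiff, trP, Pi.add_apply, Pi.sub_apply, Pi.smul_apply, smul_eq_mul]; ring

theorem secDiff_comm (h : ℝ) (d d' : ℝ × ℝ) (f : ℝ × ℝ → ℝ) :
    secDiff h d (secDiff h d' f) = secDiff h d' (secDiff h d f) := by
  ext p
  simp only [secDiff, trP, Pi.add_apply, Pi.sub_apply, Pi.smul_apply, smul_eq_mul,
    add_right_comm p (_ • d') (_ • d)]
  ring

theorem planeD4_eq_bAvg {h : ℝ} (hh : h ≠ 0) {d : ℝ × ℝ} {f g k : ℝ × ℝ → ℝ} (hg : Continuous g)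
    (hk : Continuous k) (h1 : HasDir d f g) (h2 : HasDir d g k) :
    planeD4 h d f = bAvg h d k := by
  unfold planeD4 bAvg
  rw [secDiff_eq_avg_avg hg hk h1 h2, secDiff_smul, smul_comm (1 / 12 : ℝ) (h ^ 2), ← smul_sub,
    smul_smul]
  rw [show 1 / h ^ 2 * h ^ 2 = 1 by field_simp, one_smul]

theorem bAvg_add {h : ℝ} {d : ℝ × ℝ} {f g : ℝ × ℝ → ℝ} (hf : Continuous f) (hg : Continuous g) :
    bAvg h d (f + g) = bAvg h d f + bAvg h d g := by
  unfold bAvg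
  rw [avg_add hf hg, avg_add (continuous_avg hf) (continuous_avg hg), secDiff_add]
  module

theorem bAvg_sub {h : ℝ} {d : ℝ × ℝ} {f g : ℝ × ℝ → ℝ} (hf : Continuous f) (hg : Continuous g) :
    bAvg h d (f - g) = bAvg h d f - bAvg h d g := by
  unfold bAvg
  rw [avg_sub hf hg, avg_sub (continuous_avg hf) (continuous_avg hg), secDiff_sub]
  module

theorem bAvg_smul {h : ℝ} {d : ℝ × ℝ} (c : ℝ) (f : ℝ × ℝ → ℝ) :
    bAvg h d (c • f) = c • bAvg h d f := by
  unfold bAvg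
  rw [avg_smul, avg_smul, secDiff_smul]
  module

theorem bAvg_trP (h : ℝ) (d v : ℝ × ℝ) (f : ℝ × ℝ → ℝ) :
    bAvg h d (trP v f) = trP v (bAvg h d f) := by
  unfold bAvg
  rw [avg_trP, avg_trP, secDiff_trP]; rfl

theorem bAvg_secDiff {h : ℝ} {d d' : ℝ × ℝ} {f : ℝ × ℝ → ℝ} (hf : Continuous f) :
    bAvg h d (secDiff h d' f) = secDiff h d' (bAvg h d f) := by
  unfold bAvg
  rw [avg_secDiff hf, avg_secDiff (continuous_avg hf), secDiff_sub, secDiff_smul, secDiff_comm]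

theorem bAvg_planeD4 {h : ℝ} {d d' : ℝ × ℝ} {f : ℝ × ℝ → ℝ} (hf : Continuous f) :
    bAvg h d (planeD4 h d' f) = planeD4 h d' (bAvg h d f) := by
  unfold planeD4
  rw [bAvg_smul, bAvg_sub (continuous_secDiff hf)
    ((continuous_secDiff (continuous_secDiff hf)).const_smul _), bAvg_smul, bAvg_secDiff hf,
    bAvg_secDiff (continuous_secDiff hf), bAvg_secDiff hf]

theorem bAvg_comm {h : ℝ} {d d' : ℝ × ℝ} {f : ℝ × ℝ → ℝ} (hf : Continuous f) :
    bAvg h d (bAvg h d' f) = bAvg h d' (bAvg h d f) := by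
  have c1 := continuous_avg (h := h) (d := d') hf
  have key : ∀ {g : ℝ × ℝ → ℝ}, Continuous g → bAvg h d' (avg h d g) = avg h d (bAvg h d' g) := by
    intro g hg
    have c1 := continuous_avg (h := h) (d := d') hg
    have c2 := continuous_avg (h := h) (d := d') c1
    unfold bAvg
    rw [avg_sub c2 ((continuous_secDiff c2).const_smul _), avg_smul, avg_secDiff c2,
      avg_comm (d := d) c1, avg_comm (d := d) hg]
  have e : ∀ {g : ℝ × ℝ → ℝ}, bAvg h d g
      = avg h d (avg h d g) - (1 / 12 : ℝ) • secDiff h d (avg h d (avg h d g)) := rfl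
  have c2 := continuous_avg (h := h) (d := d) hf
  have c3 := continuous_avg (h := h) (d := d) c2
  rw [e, e, bAvg_sub c3 ((continuous_secDiff c3).const_smul _), bAvg_smul, bAvg_secDiff c3, key c2,
    key hf]

theorem abs_secDiff_le {h : ℝ} {d : ℝ × ℝ} {f : ℝ × ℝ → ℝ} {M : ℝ} (hM : ∀ p, |f p| ≤ M)
    (p : ℝ × ℝ) : |secDiff h d f p| ≤ 4 * M := by
  simp only [secDiff, trP, Pi.add_apply, Pi.sub_apply, Pi.smul_apply, smul_eq_mul]
  have h1 := abs_le.1 (hM (p + h • d))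
  have h2 := abs_le.1 (hM p)
  have h3 := abs_le.1 (hM (p + -h • d))
  rw [abs_le]; constructor <;> linarith

theorem abs_bAvg_le {h : ℝ} {d : ℝ × ℝ} {f : ℝ × ℝ → ℝ} {M : ℝ} (hM : ∀ p, |f p| ≤ M)
    (p : ℝ × ℝ) : |bAvg h d f p| ≤ 2 * M := by
  have hA : ∀ p, |avg h d (avg h d f) p| ≤ M := abs_avg_le (abs_avg_le hM)
  have h1 := abs_le.1 (hA p)
  have h2 := abs_le.1 (abs_secDiff_le (h := h) (d := d) hA p)
  have hM0 : 0 ≤ M := (abs_nonneg _).trans (hM p)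
  simp only [bAvg, Pi.sub_apply, Pi.smul_apply, smul_eq_mul]
  rw [abs_le]; constructor <;> linarith

theorem abs_planeD4_le {h : ℝ} {d : ℝ × ℝ} {f : ℝ × ℝ → ℝ} {M : ℝ} (hM : ∀ p, |f p| ≤ M)
    (p : ℝ × ℝ) : |planeD4 h d f p| ≤ 1 / h ^ 2 * (6 * M) := by
  have h1 := abs_le.1 (abs_secDiff_le (h := h) (d := d) hM p)
  have h2 := abs_le.1 (abs_secDiff_le (h := h) (d := d) (abs_secDiff_le (h := h) (d := d) hM) p)
  have hM0 : 0 ≤ M := (abs_nonneg _).trans (hM p)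
  simp only [planeD4, Pi.sub_apply, Pi.smul_apply, smul_eq_mul]
  rw [abs_mul, abs_of_nonneg (by positivity : 0 ≤ 1 / h ^ 2)]
  refine mul_le_mul_of_nonneg_left ?_ (by positivity)
  rw [abs_le]; constructor <;> linarith

theorem abs_avg_sub_le {h M : ℝ} {d : ℝ × ℝ} {f f1 f2 : ℝ × ℝ → ℝ} (hf : Continuous f)
    (h1 : HasDir d f f1) (h2 : HasDir d f1 f2) (hM : ∀ p, |f2 p| ≤ M) (p : ℝ × ℝ) :
    |avg h d f p - f p| ≤ M * h ^ 2 := by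
  have hM0 : 0 ≤ M := (abs_nonneg _).trans (hM 0)
  have e : avg h d f p - f p
      = ∫ s in (-1 / 2 : ℝ)..(1 / 2), (f (p + (s * h) • d) - f p - s * h * f1 p) := by
    rw [intervalIntegral.integral_sub, intervalIntegral.integral_sub]
    · simp only [avg, intervalIntegral.integral_const, mul_assoc,
        intervalIntegral.integral_mul_const, integral_id]
      norm_num
    all_goals exact (by fun_prop : Continuous _).intervalIntegrable _ _
  rw [e]
  have := intervalIntegral.norm_integral_le_of_norm_le_const (a := -1 / 2) (b := 1 / 2)
    (C := M * h ^ 2) (f := fun s : ℝ => f (p + (s * h) • d) - f p - s * h * f1 p) (fun s hs => by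
      have := taylor_bound_two (h1 p) (h2 p) (fun s => hM _) (s * h)
      simp only [zero_smul, add_zero] at this
      refine this.trans ?_
      rw [sq_abs, mul_pow]
      rw [uIoc_of_le (by norm_num), mem_Ioc] at hs
      have hs2 : s ^ 2 ≤ 1 := by nlinarith [hs.1, hs.2]
      exact mul_le_mul_of_nonneg_left (mul_le_of_le_one_left (sq_nonneg _) hs2) hM0)
  rw [show |(1 / 2 : ℝ) - -1 / 2| = 1 by norm_num, mul_one] at this
  exact this

theorem abs_avg_sub_le' {h M : ℝ} {d : ℝ × ℝ} {f f1 f2 f3 f4 : ℝ × ℝ → ℝ} (hf : Continuous f)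
    (h1 : HasDir d f f1) (h2 : HasDir d f1 f2) (h3 : HasDir d f2 f3) (h4 : HasDir d f3 f4)
    (hM : ∀ p, |f4 p| ≤ M) (p : ℝ × ℝ) :
    |avg h d f p - f p - h ^ 2 / 24 * f2 p| ≤ M * h ^ 4 := by
  have hM0 : 0 ≤ M := (abs_nonneg _).trans (hM 0)
  have e : avg h d f p - f p - h ^ 2 / 24 * f2 p
      = ∫ s in (-1 / 2 : ℝ)..(1 / 2), (f (p + (s * h) • d) - f p - s * (h * f1 p)
        - s ^ 2 * (h ^ 2 / 2 * f2 p) - s ^ 3 * (h ^ 3 / 6 * f3 p)) := by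
    rw [intervalIntegral.integral_sub, intervalIntegral.integral_sub,
      intervalIntegral.integral_sub, intervalIntegral.integral_sub]
    · simp only [avg, intervalIntegral.integral_const, intervalIntegral.integral_mul_const,
        integral_id, integral_pow]
      norm_num
      ring
    all_goals exact (by fun_prop : Continuous _).intervalIntegrable _ _
  rw [e]
  have := intervalIntegral.norm_integral_le_of_norm_le_const (a := -1 / 2) (b := 1 / 2)
    (C := M * h ^ 4) (f := fun s : ℝ => f (p + (s * h) • d) - f p - s * (h * f1 p)
        - s ^ 2 * (h ^ 2 / 2 * f2 p) - s ^ 3 * (h ^ 3 / 6 * f3 p)) (fun s hs => by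
      have := taylor_bound_four (h1 p) (h2 p) (h3 p) (h4 p) (fun s => hM _) (s * h)
      simp only [zero_smul, add_zero] at this
      rw [Real.norm_eq_abs]
      have e2 : f (p + (s * h) • d) - f p - s * (h * f1 p)
        - s ^ 2 * (h ^ 2 / 2 * f2 p) - s ^ 3 * (h ^ 3 / 6 * f3 p)
        = f (p + (s * h) • d) - f p - s * h * f1 p - (s * h) ^ 2 / 2 * f2 p
          - (s * h) ^ 3 / 6 * f3 p := by ring
      rw [e2]
      refine this.trans ?_
      rw [uIoc_of_le (by norm_num), mem_Ioc] at hs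
      have hs2 : s ^ 2 ≤ 1 := by nlinarith [hs.1, hs.2]
      have hs4 : |s * h| ^ 4 ≤ h ^ 4 := by
        have e4 : |s * h| ^ 4 = (s ^ 2) ^ 2 * h ^ 4 := by
          rw [show (4 : ℕ) = 2 * 2 by norm_num, pow_mul, sq_abs]; ring
        rw [e4]
        exact mul_le_of_le_one_left (by positivity) (pow_le_one₀ (sq_nonneg _) hs2)
      exact mul_le_mul_of_nonneg_left hs4 hM0)
  rw [show |(1 / 2 : ℝ) - -1 / 2| = 1 by norm_num, mul_one] at this
  exact this

theorem abs_avg_avg_sub_le {h M : ℝ} {d : ℝ × ℝ} {f f1 f2 : ℝ × ℝ → ℝ} (hf : Continuous f)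
    (h1 : HasDir d f f1) (h2 : HasDir d f1 f2) (hM : ∀ p, |f2 p| ≤ M) (p : ℝ × ℝ) :
    |avg h d (avg h d f) p - f p| ≤ 2 * (M * h ^ 2) := by
  have b := abs_avg_sub_le (h := h) hf h1 h2 hM
  have b2 := abs_avg_le (h := h) (d := d) (f := avg h d f - f) b p
  rw [avg_sub (continuous_avg hf) hf, Pi.sub_apply] at b2
  have b1 := b p
  rw [abs_le] at *
  constructor <;> linarith

theorem abs_bAvg_sub_le_sq {h M : ℝ} {d : ℝ × ℝ} {f f1 f2 : ℝ × ℝ → ℝ} (hf : Continuous f)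
    (hf1 : Continuous f1) (hf2 : Continuous f2)
    (h1 : HasDir d f f1) (h2 : HasDir d f1 f2) (hM : ∀ p, |f2 p| ≤ M) (p : ℝ × ℝ) :
    |bAvg h d f p - f p| ≤ 3 * (M * h ^ 2) := by
  have b1 := abs_le.1 (abs_avg_avg_sub_le (h := h) hf h1 h2 hM p)
  have e : secDiff h d (avg h d (avg h d f))
      = h ^ 2 • avg h d (avg h d (avg h d (avg h d f2))) := by
    rw [← avg_secDiff (continuous_avg hf), ← avg_secDiff hf, secDiff_eq_avg_avg hf1 hf2 h1 h2,
      avg_smul, avg_smul]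
  have b2 := abs_le.1 (abs_avg_le (h := h) (d := d) (abs_avg_le (h := h) (d := d)
    (abs_avg_le (h := h) (d := d) (abs_avg_le (h := h) (d := d) hM))) p)
  have hh := sq_nonneg h
  have c1 := mul_le_mul_of_nonneg_left b2.1 hh
  have c2 := mul_le_mul_of_nonneg_left b2.2 hh
  have hM0 : 0 ≤ M * h ^ 2 := mul_nonneg ((abs_nonneg _).trans (hM 0)) hh
  simp only [bAvg, e, Pi.sub_apply, Pi.smul_apply, smul_eq_mul]
  rw [abs_le]; constructor <;> linarith

/-- The average `bAvg` is the identity up to `O(h⁴)`. -/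
theorem abs_bAvg_sub_le {h M : ℝ} {d : ℝ × ℝ} {f f1 f2 f3 f4 : ℝ × ℝ → ℝ} (hf : Continuous f)
    (hf1 : Continuous f1) (hf2 : Continuous f2)
    (h1 : HasDir d f f1) (h2 : HasDir d f1 f2) (h3 : HasDir d f2 f3) (h4 : HasDir d f3 f4)
    (hM : ∀ p, |f4 p| ≤ M) (p : ℝ × ℝ) :
    |bAvg h d f p - f p| ≤ 4 * (M * h ^ 4) := by
  have b := abs_avg_sub_le' (h := h) hf h1 h2 h3 h4 hM
  have b2 := abs_avg_le (h := h) (d := d) (f := avg h d f - f - (h ^ 2 / 24) • f2) b p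
  have b3 := abs_avg_sub_le (h := h) hf2 h3 h4 hM p
  have e : secDiff h d (avg h d (avg h d f))
      = h ^ 2 • avg h d (avg h d (avg h d (avg h d f2))) := by
    rw [← avg_secDiff (continuous_avg hf), ← avg_secDiff hf, secDiff_eq_avg_avg hf1 hf2 h1 h2,
      avg_smul, avg_smul]
  have b4 := abs_avg_avg_sub_le (h := h) hf2 h3 h4 hM
  have b5 := abs_avg_le (h := h) (d := d) (abs_avg_le (h := h) (d := d)
    (f := avg h d (avg h d f2) - f2) b4) p
  rw [avg_sub (continuous_avg (continuous_avg hf2)) hf2,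
    avg_sub (continuous_avg (continuous_avg (continuous_avg hf2))) (continuous_avg hf2),
    Pi.sub_apply] at b5
  rw [avg_sub ((continuous_avg hf).sub hf) (hf2.const_smul _), avg_sub (continuous_avg hf) hf,
    avg_smul, Pi.sub_apply, Pi.sub_apply, Pi.smul_apply, smul_eq_mul] at b2
  have b1 := abs_le.1 (b p)
  have b4' := abs_le.1 (b4 p)
  rw [abs_le] at b2 b3 b5
  have hh := sq_nonneg h
  have hM0 : 0 ≤ M * h ^ 4 := mul_nonneg ((abs_nonneg _).trans (hM 0)) (by positivity)
  have e4 : h ^ 2 * (M * h ^ 2) = M * h ^ 4 := by ring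
  have c1 := mul_le_mul_of_nonneg_left b3.1 hh
  have c2 := mul_le_mul_of_nonneg_left b3.2 hh
  have c3 := mul_le_mul_of_nonneg_left b4'.1 hh
  have c4 := mul_le_mul_of_nonneg_left b4'.2 hh
  have c5 := mul_le_mul_of_nonneg_left b5.1 hh
  have c6 := mul_le_mul_of_nonneg_left b5.2 hh
  simp only [bAvg, e, Pi.sub_apply, Pi.smul_apply, smul_eq_mul]
  rw [abs_le]; constructor <;> linarith

/-! ### Functions with bounded partial derivatives -/

/-- `f` has continuous iterated partial derivatives up to order `n`, all bounded by `M`. -/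
def BddDiff : ℕ → ℝ → (ℝ × ℝ → ℝ) → Prop
  | 0, M, f => Continuous f ∧ ∀ p, |f p| ≤ M
  | n + 1, M, f => (Continuous f ∧ ∀ p, |f p| ≤ M) ∧ HasDir (1, 0) f (dx f) ∧
      HasDir (0, 1) f (dy f) ∧ BddDiff n M (dx f) ∧ BddDiff n M (dy f)

theorem HasDir.dx_eq {f g : ℝ × ℝ → ℝ} (h : HasDir (1, 0) f g) : dx f = g := by
  ext p
  have := h (0, p.2) p.1
  simp only [Prod.smul_mk, smul_eq_mul, mul_one, mul_zero, Prod.mk_add_mk, zero_add, add_zero]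
    at this
  exact this.deriv

theorem HasDir.dy_eq {f g : ℝ × ℝ → ℝ} (h : HasDir (0, 1) f g) : dy f = g := by
  ext p
  have := h (p.1, 0) p.2
  simp only [Prod.smul_mk, smul_eq_mul, mul_one, mul_zero, Prod.mk_add_mk, zero_add, add_zero]
    at this
  exact this.deriv

theorem BddDiff.of_hasDir {n : ℕ} {M : ℝ} {f fx fy : ℝ × ℝ → ℝ} (hc : Continuous f)
    (hM : ∀ p, |f p| ≤ M) (hx : HasDir (1, 0) f fx) (hy : HasDir (0, 1) f fy)
    (hfx : BddDiff n M fx) (hfy : BddDiff n M fy) : BddDiff (n + 1) M f := by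
  refine ⟨⟨hc, hM⟩, ?_, ?_, ?_, ?_⟩
  · rwa [hx.dx_eq]
  · rwa [hy.dy_eq]
  · rwa [hx.dx_eq]
  · rwa [hy.dy_eq]

theorem BddDiff.continuous {n : ℕ} {M : ℝ} {f : ℝ × ℝ → ℝ} (h : BddDiff n M f) : Continuous f := by
  cases n with
  | zero => exact h.1
  | succ n => exact h.1.1

theorem BddDiff.bound {n : ℕ} {M : ℝ} {f : ℝ × ℝ → ℝ} (h : BddDiff n M f) (p : ℝ × ℝ) :
    |f p| ≤ M := by
  cases n with
  | zero => exact h.2 p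
  | succ n => exact h.1.2 p

theorem BddDiff.nonneg {n : ℕ} {M : ℝ} {f : ℝ × ℝ → ℝ} (h : BddDiff n M f) : 0 ≤ M :=
  (abs_nonneg _).trans (h.bound 0)

theorem BddDiff.of_succ {n : ℕ} {M : ℝ} {f : ℝ × ℝ → ℝ} (h : BddDiff (n + 1) M f) :
    BddDiff n M f := by
  induction n generalizing f with
  | zero => exact h.1
  | succ n ih => exact ⟨h.1, h.2.1, h.2.2.1, ih h.2.2.2.1, ih h.2.2.2.2⟩

theorem BddDiff.of_le {n k : ℕ} {M : ℝ} {f : ℝ × ℝ → ℝ} (h : BddDiff n M f) (hk : k ≤ n) :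
    BddDiff k M f := by
  induction n with
  | zero => rwa [Nat.le_zero.1 hk]
  | succ n ih =>
    rcases Nat.lt_or_ge n k with h1 | h1
    · rwa [show k = n + 1 by omega]
    · exact ih h.of_succ h1

theorem BddDiff.mono {n : ℕ} {M M' : ℝ} {f : ℝ × ℝ → ℝ} (h : BddDiff n M f) (hM : M ≤ M') :
    BddDiff n M' f := by
  induction n generalizing f with
  | zero => exact ⟨h.1, fun p => (h.2 p).trans hM⟩
  | succ n ih => exact ⟨⟨h.1.1, fun p => (h.1.2 p).trans hM⟩, h.2.1, h.2.2.1, ih h.2.2.2.1,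
      ih h.2.2.2.2⟩

theorem BddDiff.add {n : ℕ} {M M' : ℝ} {f g : ℝ × ℝ → ℝ} (hf : BddDiff n M f)
    (hg : BddDiff n M' g) : BddDiff n (M + M') (f + g) := by
  have hb : ∀ p, |(f + g) p| ≤ M + M' := fun p =>
    (abs_add_le _ _).trans (add_le_add (hf.bound p) (hg.bound p))
  induction n generalizing f g with
  | zero => exact ⟨hf.continuous.add hg.continuous, hb⟩
  | succ n ih =>
    exact BddDiff.of_hasDir (hf.continuous.add hg.continuous) hb (hf.2.1.add hg.2.1)
      (hf.2.2.1.add hg.2.2.1)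
      (ih hf.2.2.2.1 hg.2.2.2.1 fun p => (abs_add_le _ _).trans
        (add_le_add (hf.2.2.2.1.bound p) (hg.2.2.2.1.bound p)))
      (ih hf.2.2.2.2 hg.2.2.2.2 fun p => (abs_add_le _ _).trans
        (add_le_add (hf.2.2.2.2.bound p) (hg.2.2.2.2.bound p)))

theorem BddDiff.smul {n : ℕ} {M : ℝ} {f : ℝ × ℝ → ℝ} (hf : BddDiff n M f) (c : ℝ) :
    BddDiff n (|c| * M) (c • f) := by
  have hb : ∀ {k} {f : ℝ × ℝ → ℝ}, BddDiff k M f → ∀ p, |(c • f) p| ≤ |c| * M := fun hf p => by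
    rw [Pi.smul_apply, smul_eq_mul, abs_mul]
    exact mul_le_mul_of_nonneg_left (hf.bound p) (abs_nonneg c)
  induction n generalizing f with
  | zero => exact ⟨hf.continuous.const_smul c, hb hf⟩
  | succ n ih =>
    exact BddDiff.of_hasDir (hf.continuous.const_smul c) (hb hf) (hf.2.1.smul c)
      (hf.2.2.1.smul c) (ih hf.2.2.2.1) (ih hf.2.2.2.2)

theorem BddDiff.sub {n : ℕ} {M M' : ℝ} {f g : ℝ × ℝ → ℝ} (hf : BddDiff n M f)
    (hg : BddDiff n M' g) : BddDiff n (M + M') (f - g) := by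
  have := hf.add (hg.smul (-1))
  simpa [sub_eq_add_neg] using this

theorem BddDiff.mul {n : ℕ} {M M' : ℝ} {f g : ℝ × ℝ → ℝ} (hf : BddDiff n M f)
    (hg : BddDiff n M' g) : BddDiff n (2 ^ n * (M * M')) (f * g) := by
  have hMM : 0 ≤ M * M' := mul_nonneg hf.nonneg hg.nonneg
  have hb : ∀ (k : ℕ) (p), |(f * g) p| ≤ 2 ^ k * (M * M') := fun k p => by
    rw [Pi.mul_apply, abs_mul]
    refine (mul_le_mul (hf.bound p) (hg.bound p) (abs_nonneg _) hf.nonneg).trans ?_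
    exact le_mul_of_one_le_left hMM (one_le_pow₀ (by norm_num))
  induction n generalizing f g with
  | zero => exact ⟨hf.continuous.mul hg.continuous, hb 0⟩
  | succ n ih =>
    have e : (2 : ℝ) ^ (n + 1) * (M * M') = 2 ^ n * (M * M') + 2 ^ n * (M * M') := by ring
    have key : ∀ {f' g' : ℝ × ℝ → ℝ}, BddDiff n M f' → BddDiff n M' g' →
        BddDiff n (2 ^ n * (M * M')) (f' * g') := fun hf' hg' => ih hf' hg' fun k p => by
      rw [Pi.mul_apply, abs_mul]
      refine (mul_le_mul (hf'.bound p) (hg'.bound p) (abs_nonneg _) hf.nonneg).trans ?_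
      exact le_mul_of_one_le_left hMM (one_le_pow₀ (by norm_num))
    refine BddDiff.of_hasDir (hf.continuous.mul hg.continuous) (hb _) (hf.2.1.mul hg.2.1)
      (hf.2.2.1.mul hg.2.2.1) ?_ ?_
    · rw [e]
      exact (key hf.2.2.2.1 hg.of_succ).add (key hf.of_succ hg.2.2.2.1)
    · rw [e]
      exact (key hf.2.2.2.2 hg.of_succ).add (key hf.of_succ hg.2.2.2.2)

/-- The two coordinate directions. -/
def IsAxis (d : ℝ × ℝ) : Prop := d = (1, 0) ∨ d = (0, 1)

theorem BddDiff.exists_hasDir {n : ℕ} {M : ℝ} {f : ℝ × ℝ → ℝ} (hf : BddDiff (n + 1) M f)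
    {d : ℝ × ℝ} (hd : IsAxis d) : ∃ g, HasDir d f g ∧ BddDiff n M g := by
  rcases hd with rfl | rfl
  · exact ⟨_, hf.2.1, hf.2.2.2.1⟩
  · exact ⟨_, hf.2.2.1, hf.2.2.2.2⟩

theorem lap_eq (f : ℝ × ℝ → ℝ) : lap f = dx (dx f) + dy (dy f) := rfl

theorem BddDiff.lap {n : ℕ} {M : ℝ} {f : ℝ × ℝ → ℝ} (hf : BddDiff (n + 2) M f) :
    BddDiff n (2 * M) (lap f) := by
  rw [lap_eq, two_mul]
  exact hf.2.2.2.1.2.2.2.1.add hf.2.2.2.2.2.2.2.2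

/-! ### Consistency of the averages and the difference operators -/

theorem BddDiff.abs_bAvg_sub_le {M h : ℝ} {f : ℝ × ℝ → ℝ} (hf : BddDiff 4 M f) {d : ℝ × ℝ}
    (hd : IsAxis d) (p : ℝ × ℝ) : |bAvg h d f p - f p| ≤ 4 * (M * h ^ 4) := by
  obtain ⟨f1, h1, b1⟩ := hf.exists_hasDir hd
  obtain ⟨f2, h2, b2⟩ := b1.exists_hasDir hd
  obtain ⟨f3, h3, b3⟩ := b2.exists_hasDir hd
  obtain ⟨f4, h4, b4⟩ := b3.exists_hasDir hd
  exact CahnHilliard.abs_bAvg_sub_le hf.continuous b1.continuous b2.continuous h1 h2 h3 h4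
    b4.bound p

theorem BddDiff.abs_bAvg_sub_le_sq {M h : ℝ} {f : ℝ × ℝ → ℝ} (hf : BddDiff 2 M f) {d : ℝ × ℝ}
    (hd : IsAxis d) (p : ℝ × ℝ) : |bAvg h d f p - f p| ≤ 3 * (M * h ^ 2) := by
  obtain ⟨f1, h1, b1⟩ := hf.exists_hasDir hd
  obtain ⟨f2, h2, b2⟩ := b1.exists_hasDir hd
  exact CahnHilliard.abs_bAvg_sub_le_sq hf.continuous b1.continuous b2.continuous h1 h2 b2.bound p

/-- The average in both coordinate directions. -/
def bAvg2 (h : ℝ) (f : ℝ × ℝ → ℝ) : ℝ × ℝ → ℝ := bAvg h (1, 0) (bAvg h (0, 1) f)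

/-- The long stencil Laplacian of functions on the plane. -/
def planeLap4 (h : ℝ) (f : ℝ × ℝ → ℝ) : ℝ × ℝ → ℝ := planeD4 h (1, 0) f + planeD4 h (0, 1) f

theorem continuous_planeLap4 {h : ℝ} {f : ℝ × ℝ → ℝ} (hf : Continuous f) :
    Continuous (planeLap4 h f) := (continuous_planeD4 hf).add (continuous_planeD4 hf)

theorem bAvg2_add {h : ℝ} {f g : ℝ × ℝ → ℝ} (hf : Continuous f) (hg : Continuous g) :
    bAvg2 h (f + g) = bAvg2 h f + bAvg2 h g := by
  unfold bAvg2; rw [bAvg_add hf hg, bAvg_add (continuous_bAvg hf) (continuous_bAvg hg)]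

theorem bAvg2_sub {h : ℝ} {f g : ℝ × ℝ → ℝ} (hf : Continuous f) (hg : Continuous g) :
    bAvg2 h (f - g) = bAvg2 h f - bAvg2 h g := by
  unfold bAvg2; rw [bAvg_sub hf hg, bAvg_sub (continuous_bAvg hf) (continuous_bAvg hg)]

theorem bAvg2_smul {h : ℝ} (c : ℝ) (f : ℝ × ℝ → ℝ) : bAvg2 h (c • f) = c • bAvg2 h f := by
  unfold bAvg2; rw [bAvg_smul, bAvg_smul]

theorem bAvg2_trP (h : ℝ) (v : ℝ × ℝ) (f : ℝ × ℝ → ℝ) :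
    bAvg2 h (trP v f) = trP v (bAvg2 h f) := by
  unfold bAvg2; rw [bAvg_trP, bAvg_trP]

theorem abs_bAvg2_le {h M : ℝ} {f : ℝ × ℝ → ℝ} (hM : ∀ p, |f p| ≤ M) (p : ℝ × ℝ) :
    |bAvg2 h f p| ≤ 4 * M := by
  have := abs_bAvg_le (h := h) (d := (1, 0)) (abs_bAvg_le (h := h) (d := (0, 1)) hM) p
  unfold bAvg2
  linarith

theorem bAvg2_planeLap4 {h : ℝ} {f : ℝ × ℝ → ℝ} (hf : Continuous f) :
    bAvg2 h (planeLap4 h f) = planeLap4 h (bAvg2 h f) := by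
  unfold bAvg2 planeLap4
  rw [bAvg_add (continuous_planeD4 hf) (continuous_planeD4 hf), bAvg_planeD4 hf, bAvg_planeD4 hf,
    bAvg_add (continuous_planeD4 (continuous_bAvg hf)) (continuous_planeD4 (continuous_bAvg hf)),
    bAvg_planeD4 (continuous_bAvg hf), bAvg_planeD4 (continuous_bAvg hf)]

theorem planeD4_sub (h : ℝ) (d : ℝ × ℝ) (f g : ℝ × ℝ → ℝ) :
    planeD4 h d (f - g) = planeD4 h d f - planeD4 h d g := by
  unfold planeD4; simp only [secDiff_sub]; module

theorem planeLap4_sub (h : ℝ) (f g : ℝ × ℝ → ℝ) :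
    planeLap4 h (f - g) = planeLap4 h f - planeLap4 h g := by
  unfold planeLap4; simp only [planeD4_sub]; abel

theorem abs_planeLap4_le {h M : ℝ} {f : ℝ × ℝ → ℝ} (hM : ∀ p, |f p| ≤ M) (p : ℝ × ℝ) :
    |planeLap4 h f p| ≤ 1 / h ^ 2 * (12 * M) := by
  have h1 := abs_planeD4_le (h := h) (d := (1, 0)) hM p
  have h2 := abs_planeD4_le (h := h) (d := (0, 1)) hM p
  refine (abs_add_le _ _).trans ?_
  linarith

theorem planeLap4_eq {h M : ℝ} (hh : h ≠ 0) {f : ℝ × ℝ → ℝ} (hf : BddDiff 2 M f) :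
    planeLap4 h f = bAvg h (1, 0) (dx (dx f)) + bAvg h (0, 1) (dy (dy f)) := by
  obtain ⟨_, h1, h2, b1, b2⟩ := hf
  unfold planeLap4
  rw [planeD4_eq_bAvg hh b1.continuous b1.2.2.2.1.continuous h1 b1.2.1,
    planeD4_eq_bAvg hh b2.continuous b2.2.2.2.2.continuous h2 b2.2.2.1]

theorem BddDiff.abs_planeLap4_le {h M : ℝ} (hh : h ≠ 0) {f : ℝ × ℝ → ℝ} (hf : BddDiff 2 M f)
    (p : ℝ × ℝ) : |planeLap4 h f p| ≤ 4 * M := by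
  rw [planeLap4_eq hh hf]
  have h1 := abs_bAvg_le (h := h) (d := (1, 0)) hf.2.2.2.1.2.2.2.1.bound p
  have h2 := abs_bAvg_le (h := h) (d := (0, 1)) hf.2.2.2.2.2.2.2.2.bound p
  refine (abs_add_le _ _).trans ?_
  linarith

theorem BddDiff.abs_planeLap4_sub_lap_le {h M : ℝ} (hh : h ≠ 0) {f : ℝ × ℝ → ℝ}
    (hf : BddDiff 6 M f) (p : ℝ × ℝ) :
    |planeLap4 h f p - CahnHilliard.lap f p| ≤ 8 * (M * h ^ 4) := by
  rw [planeLap4_eq hh (hf.of_le (by norm_num)), lap_eq]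
  have h1 := abs_le.1 (hf.2.2.2.1.2.2.2.1.abs_bAvg_sub_le (h := h) (Or.inl rfl) p)
  have h2 := abs_le.1 (hf.2.2.2.2.2.2.2.2.abs_bAvg_sub_le (h := h) (Or.inr rfl) p)
  simp only [Pi.add_apply]
  rw [abs_le]; constructor <;> linarith

theorem BddDiff.abs_planeLap4_sub_lap_le_sq {h M : ℝ} (hh : h ≠ 0) {f : ℝ × ℝ → ℝ}
    (hf : BddDiff 4 M f) (p : ℝ × ℝ) :
    |planeLap4 h f p - CahnHilliard.lap f p| ≤ 6 * (M * h ^ 2) := by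
  rw [planeLap4_eq hh (hf.of_le (by norm_num)), lap_eq]
  have h1 := abs_le.1 (hf.2.2.2.1.2.2.2.1.abs_bAvg_sub_le_sq (h := h) (Or.inl rfl) p)
  have h2 := abs_le.1 (hf.2.2.2.2.2.2.2.2.abs_bAvg_sub_le_sq (h := h) (Or.inr rfl) p)
  simp only [Pi.add_apply]
  rw [abs_le]; constructor <;> linarith

theorem BddDiff.abs_bAvg2_sub_le {h M : ℝ} {f : ℝ × ℝ → ℝ} (hf : BddDiff 4 M f) (p : ℝ × ℝ) :
    |bAvg2 h f p - f p| ≤ 12 * (M * h ^ 4) := by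
  have h1 := abs_bAvg_le (h := h) (d := (1, 0)) (f := bAvg h (0, 1) f - f)
    (hf.abs_bAvg_sub_le (h := h) (Or.inr rfl)) p
  have h2 := abs_le.1 (hf.abs_bAvg_sub_le (h := h) (Or.inl rfl) p)
  rw [bAvg_sub (continuous_bAvg hf.continuous) hf.continuous, Pi.sub_apply, abs_le] at h1
  unfold bAvg2
  rw [abs_le]; constructor <;> linarith

theorem BddDiff.abs_planeLap4_bAvg2_sub_lap_le {h M : ℝ} (hh : h ≠ 0) {f : ℝ × ℝ → ℝ}
    (hf : BddDiff 6 M f) (p : ℝ × ℝ) :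
    |planeLap4 h (bAvg2 h f) p - CahnHilliard.lap f p| ≤ 56 * (M * h ^ 4) := by
  have h1 := abs_bAvg2_le (h := h) (f := planeLap4 h f - CahnHilliard.lap f)
    (hf.abs_planeLap4_sub_lap_le hh) p
  have h2 := abs_le.1 ((BddDiff.lap hf).abs_bAvg2_sub_le (h := h) p)
  rw [bAvg2_sub (continuous_planeLap4 hf.continuous) (BddDiff.lap hf).continuous,
    bAvg2_planeLap4 hf.continuous, Pi.sub_apply, abs_le] at h1
  rw [abs_le]; constructor <;> linarith

/-- The average of the Laplacian is a difference operator applied to averages. -/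
theorem bAvg2_lap {h M : ℝ} (hh : h ≠ 0) {f : ℝ × ℝ → ℝ} (hf : BddDiff 2 M f) :
    bAvg2 h (lap f) = planeLap4 h f + planeD4 h (1, 0) (bAvg h (0, 1) f - f)
      + planeD4 h (0, 1) (bAvg h (1, 0) f - f) := by
  have hc := hf.continuous
  obtain ⟨_, h1, h2, b1, b2⟩ := hf
  have cxx := b1.2.2.2.1.continuous
  have cyy := b2.2.2.2.2.continuous
  have ex := planeD4_eq_bAvg hh b1.continuous cxx h1 b1.2.1
  have ey := planeD4_eq_bAvg hh b2.continuous cyy h2 b2.2.2.1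
  rw [lap_eq, bAvg2_add cxx cyy]
  unfold bAvg2
  rw [← ey, bAvg_comm cxx, ← ex, bAvg_planeD4 hc, bAvg_planeD4 hc, planeD4_sub, planeD4_sub,
    planeLap4]
  abel

theorem BddDiff.abs_trP_sub_le {h M : ℝ} (hh : 0 ≤ h) {f : ℝ × ℝ → ℝ} (hf : BddDiff 1 M f)
    {d : ℝ × ℝ} (hd : IsAxis d) (p : ℝ × ℝ) : |trP (h • d) f p - f p| ≤ M * h := by
  obtain ⟨g, h1, b1⟩ := hf.exists_hasDir hd
  have := abs_sub_le_of_abs_deriv_le_pow hf.nonneg 0 (h1 p) (fun s => by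
    simpa using b1.bound (p + s • d)) h
  simpa [trP, abs_of_nonneg hh] using this

theorem BddDiff.abs_trP_bAvg2_sub_le {h M : ℝ} (hh : 0 ≤ h) {f : ℝ × ℝ → ℝ} (hf : BddDiff 1 M f)
    {d : ℝ × ℝ} (hd : IsAxis d) (p : ℝ × ℝ) :
    |trP (h • d) (bAvg2 h f) p - bAvg2 h f p| ≤ 4 * M * h := by
  have := abs_bAvg2_le (h := h) (f := trP (h • d) f - f) (hf.abs_trP_sub_le hh hd) p
  rwa [bAvg2_sub (continuous_trP hf.continuous) hf.continuous, bAvg2_trP, Pi.sub_apply,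
    ← mul_assoc] at this

/-! ### The chemical potential -/

/-- The chemical potential `f³ - f - ε² Δ f`. -/
def chemPot (ε : ℝ) (f : ℝ × ℝ → ℝ) : ℝ × ℝ → ℝ := f ^ 3 - f - ε ^ 2 • lap f

/-- A bound for the derivatives of the chemical potential of a function with derivatives bounded
by `M`. -/
def chemBound (ε M : ℝ) : ℝ := 4096 * M ^ 3 + M + ε ^ 2 * (2 * M)

theorem BddDiff.chemPot {ε M : ℝ} {f : ℝ × ℝ → ℝ} (hf : BddDiff 6 M f) :
    BddDiff 4 (chemBound ε M) (chemPot ε f) := by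
  have h3 : BddDiff 6 (4096 * M ^ 3) (f ^ 3) := by
    have := (hf.mul hf).mul hf
    rw [show f ^ 3 = f * f * f by ring]
    refine this.mono (le_of_eq ?_)
    norm_num; ring
  have hl := (BddDiff.lap (n := 4) hf).smul (ε ^ 2)
  rw [abs_of_nonneg (sq_nonneg ε)] at hl
  exact ((h3.of_le (by norm_num)).sub (hf.of_le (by norm_num))).sub hl

/-- Consistency, to second order, of the discrete chemical potential in the starting step. -/
theorem BddDiff.abs_planeLap4_chem_sub_le {ε h M : ℝ} (hh : h ≠ 0) {f : ℝ × ℝ → ℝ}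
    (hf : BddDiff 6 M f) (p : ℝ × ℝ) :
    |planeLap4 h (f ^ 3 - f - ε ^ 2 • planeLap4 h f) p
        - CahnHilliard.lap (CahnHilliard.chemPot ε f) p|
      ≤ (6 * chemBound ε M + 96 * ε ^ 2 * M) * h ^ 2 := by
  have h1 := abs_le.1 ((BddDiff.chemPot (ε := ε) hf).abs_planeLap4_sub_lap_le_sq hh p)
  have hb : ∀ p, |(ε ^ 2 • (planeLap4 h f - CahnHilliard.lap f)) p|
      ≤ ε ^ 2 * (8 * (M * h ^ 4)) := by
    intro p
    rw [Pi.smul_apply, smul_eq_mul, abs_mul, abs_of_nonneg (sq_nonneg ε)]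
    exact mul_le_mul_of_nonneg_left (hf.abs_planeLap4_sub_lap_le hh p) (sq_nonneg ε)
  have h2 := abs_le.1 (CahnHilliard.abs_planeLap4_le (h := h) hb p)
  have e : f ^ 3 - f - ε ^ 2 • planeLap4 h f
      = CahnHilliard.chemPot ε f - ε ^ 2 • (planeLap4 h f - CahnHilliard.lap f) := by
    unfold CahnHilliard.chemPot; module
  have e2 : 1 / h ^ 2 * (12 * (ε ^ 2 * (8 * (M * h ^ 4)))) = 96 * ε ^ 2 * M * h ^ 2 := by
    field_simp; ring
  rw [e2] at h2
  rw [e, planeLap4_sub, Pi.sub_apply, abs_le]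
  constructor <;> linarith

/-- The chemical potential of the scheme, for functions on the plane. -/
def planeMuStep (h ε A Δt : ℝ) (f1 f0 fm : ℝ × ℝ → ℝ) : ℝ × ℝ → ℝ :=
  f1 ^ 3 - (2 : ℝ) • f0 + fm - ε ^ 2 • planeLap4 h f1 - (A * Δt) • planeLap4 h (f1 - f0)

/-- Consistency of the chemical potential of the scheme at the averaged exact solution. The factor
`Δt` of the stabilization term is complemented by the time difference of its argument. -/
theorem BddDiff.abs_chemPot_sub_planeMuStep_le {ε A Δt h M K : ℝ} (hh : h ≠ 0) (hΔt : 0 ≤ Δt)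
    {f1 f0 fm : ℝ × ℝ → ℝ} (hf : BddDiff 6 M f1) (h0 : Continuous f0) (hm : Continuous fm)
    (hK1 : ∀ p, |(f1 - (2 : ℝ) • f0 + fm) p| ≤ K * Δt ^ 2)
    (hK2 : ∀ p, |planeLap4 h (f1 - f0) p| ≤ K * Δt) (p : ℝ × ℝ) :
    |(CahnHilliard.chemPot ε f1 - planeMuStep h ε A Δt (bAvg2 h f1) (bAvg2 h f0) (bAvg2 h fm)) p|
      ≤ (576 * M ^ 3 + 12 * M + 56 * ε ^ 2 * M) * h ^ 4 + (4 * K + 4 * |A| * K) * Δt ^ 2 := by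
  have hM := hf.nonneg
  have hc := hf.continuous
  have b0 := hf.bound p
  have b1 := (hf.of_le (k := 4) (by norm_num)).abs_bAvg2_sub_le (h := h) p
  have b2 := abs_bAvg2_le (h := h) hf.bound p
  have b3 := hf.abs_planeLap4_bAvg2_sub_lap_le hh p
  have b4 := abs_bAvg2_le (h := h) hK1 p
  have b5 := abs_bAvg2_le (h := h) hK2 p
  rw [bAvg2_add (hc.sub (h0.const_smul _)) hm, bAvg2_sub hc (h0.const_smul _), bAvg2_smul] at b4
  rw [bAvg2_planeLap4 (hc.sub h0), bAvg2_sub hc h0] at b5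
  set a := f1 p
  set b := bAvg2 h f1 p with hb
  simp only [Pi.add_apply, Pi.sub_apply, Pi.smul_apply, smul_eq_mul, ← hb] at b4
  have c1 : |a ^ 3 - b ^ 3| ≤ 48 * M ^ 2 * (12 * (M * h ^ 4)) := by
    have e : a ^ 3 - b ^ 3 = (a ^ 2 + a * b + b ^ 2) * (a - b) := by ring
    rw [e, abs_mul, abs_sub_comm a b]
    refine mul_le_mul ?_ b1 (abs_nonneg _) (by positivity)
    have e1 : |a ^ 2| ≤ M ^ 2 := by rw [abs_pow]; gcongr
    have e2 : |a * b| ≤ M * (4 * M) := by rw [abs_mul]; gcongr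
    have e3 : |b ^ 2| ≤ (4 * M) ^ 2 := by rw [abs_pow]; gcongr
    have := (abs_add_le (a ^ 2 + a * b) (b ^ 2)).trans (add_le_add_left (abs_add_le _ _) _)
    nlinarith [sq_nonneg M]
  have c2 : |ε ^ 2 * (planeLap4 h (bAvg2 h f1) p - CahnHilliard.lap f1 p)|
      ≤ ε ^ 2 * (56 * (M * h ^ 4)) := by
    rw [abs_mul, abs_of_nonneg (sq_nonneg ε)]
    exact mul_le_mul_of_nonneg_left b3 (sq_nonneg ε)
  have c3 : |A * Δt * planeLap4 h (bAvg2 h f1 - bAvg2 h f0) p| ≤ |A| * Δt * (4 * (K * Δt)) := by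
    rw [abs_mul, abs_mul, abs_of_nonneg hΔt]
    exact mul_le_mul_of_nonneg_left b5 (by positivity)
  have e : (CahnHilliard.chemPot ε f1
        - planeMuStep h ε A Δt (bAvg2 h f1) (bAvg2 h f0) (bAvg2 h fm)) p
      = (a ^ 3 - b ^ 3) + (b - a) - (b - 2 * bAvg2 h f0 p + bAvg2 h fm p)
        + ε ^ 2 * (planeLap4 h (bAvg2 h f1) p - CahnHilliard.lap f1 p)
        + A * Δt * planeLap4 h (bAvg2 h f1 - bAvg2 h f0) p := by
    simp only [CahnHilliard.chemPot, planeMuStep, Pi.add_apply, Pi.sub_apply, Pi.smul_apply,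
      Pi.pow_apply, smul_eq_mul]
    ring
  rw [e]
  rw [abs_le] at c1 c2 c3 b1 b4 ⊢
  constructor <;> linarith

/-! ### Sampling on the grid -/

theorem sample_trP (h : ℝ) (a b : ℤ) (f : ℝ × ℝ → ℝ) :
    sample h (trP ((a : ℝ) * h, (b : ℝ) * h) f) = tr a b (sample h f) := by
  ext i j
  simp only [sample, trP, tr, Prod.mk_add_mk]
  congr 2 <;> push_cast <;> ring

theorem sample_planeD4_x (h : ℝ) (f : ℝ × ℝ → ℝ) :
    sample h (planeD4 h (1, 0) f) = D4 h 1 0 (sample h f) := by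
  ext i j
  simp only [D4, planeD4, secDiff, sample, trP, tr, Pi.add_apply, Pi.sub_apply, Pi.neg_apply,
    Pi.smul_apply, smul_eq_mul, Prod.smul_mk, Prod.mk_add_mk, mul_one, mul_zero, add_zero, neg_zero]
  push_cast
  rw [show ((i : ℝ) - 1 / 2) * h + h + h = (i + 2 - 1 / 2) * h by ring,
    show ((i : ℝ) - 1 / 2) * h + h + -h = (i - 1 / 2) * h by ring,
    show ((i : ℝ) - 1 / 2) * h + -h + h = (i - 1 / 2) * h by ring,
    show ((i : ℝ) - 1 / 2) * h + -h + -h = (i + -2 - 1 / 2) * h by ring,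
    show ((i : ℝ) - 1 / 2) * h + h = (i + 1 - 1 / 2) * h by ring,
    show ((i : ℝ) - 1 / 2) * h + -h = (i + -1 - 1 / 2) * h by ring]
  ring

theorem sample_planeD4_y (h : ℝ) (f : ℝ × ℝ → ℝ) :
    sample h (planeD4 h (0, 1) f) = D4 h 0 1 (sample h f) := by
  ext i j
  simp only [D4, planeD4, secDiff, sample, trP, tr, Pi.add_apply, Pi.sub_apply, Pi.neg_apply,
    Pi.smul_apply, smul_eq_mul, Prod.smul_mk, Prod.mk_add_mk, mul_one, mul_zero, add_zero, neg_zero]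
  push_cast
  rw [show ((j : ℝ) - 1 / 2) * h + h + h = (j + 2 - 1 / 2) * h by ring,
    show ((j : ℝ) - 1 / 2) * h + h + -h = (j - 1 / 2) * h by ring,
    show ((j : ℝ) - 1 / 2) * h + -h + h = (j - 1 / 2) * h by ring,
    show ((j : ℝ) - 1 / 2) * h + -h + -h = (j + -2 - 1 / 2) * h by ring,
    show ((j : ℝ) - 1 / 2) * h + h = (j + 1 - 1 / 2) * h by ring,
    show ((j : ℝ) - 1 / 2) * h + -h = (j + -1 - 1 / 2) * h by ring]
  ring

theorem sample_planeLap4 (h : ℝ) (f : ℝ × ℝ → ℝ) :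
    sample h (planeLap4 h f) = lapH4 h (sample h f) := by
  rw [lapH4_eq, ← sample_planeD4_x, ← sample_planeD4_y]; rfl

theorem sample_planeMuStep (h ε A Δt : ℝ) (f1 f0 fm : ℝ × ℝ → ℝ) :
    sample h (planeMuStep h ε A Δt f1 f0 fm)
      = muStep h ε A Δt (sample h f1) (sample h f0) (sample h fm) := by
  ext i j
  simp only [muStep]
  rw [show sample h f1 - sample h f0 = sample h (f1 - f0) from rfl, ← sample_planeLap4,
    ← sample_planeLap4]
  rfl

theorem gridPeriodic_sample {L h : ℝ} {m : ℕ} (hm : 0 < m) (hh : h = L / m) {f : ℝ × ℝ → ℝ}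
    (hf : PeriodicFun L f) : GridPeriodic m (sample h f) := by
  have hx : ∀ y, Function.Periodic (fun x => f (x, y)) L := fun y x => (hf x y).1
  have hy : ∀ x, Function.Periodic (fun y => f (x, y)) L := fun x y => (hf x y).2
  have hmL : (m : ℝ) * h = L := by
    rw [hh]; field_simp
  intro i j α β
  have e1 : (((i + α * m : ℤ) : ℝ) - 1 / 2) * h = ((i : ℝ) - 1 / 2) * h + α * L := by
    push_cast; rw [← hmL]; ring
  have e2 : (((j + β * m : ℤ) : ℝ) - 1 / 2) * h = ((j : ℝ) - 1 / 2) * h + β * L := by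
    push_cast; rw [← hmL]; ring
  simp only [sample]
  rw [e1, e2]
  exact ((hx _).int_mul α _).trans ((hy _).int_mul β _)

theorem PeriodicFun.bAvg {L : ℝ} {f : ℝ × ℝ → ℝ} (hf : PeriodicFun L f) (h : ℝ) (d : ℝ × ℝ) :
    PeriodicFun L (bAvg h d f) := by
  have e1 : trP (L, 0) f = f := by
    ext ⟨x, y⟩; simpa [trP] using (hf x y).1
  have e2 : trP (0, L) f = f := by
    ext ⟨x, y⟩; simpa [trP] using (hf x y).2
  intro x y
  have h1 := congrFun (bAvg_trP h d (L, 0) f) (x, y)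
  have h2 := congrFun (bAvg_trP h d (0, L) f) (x, y)
  rw [e1] at h1
  rw [e2] at h2
  simp only [trP, Prod.mk_add_mk, add_zero] at h1 h2
  exact ⟨h1.symm, h2.symm⟩

theorem periodicFun_bAvg2 {L h : ℝ} {f : ℝ × ℝ → ℝ} (hf : PeriodicFun L f) :
    PeriodicFun L (bAvg2 h f) := (hf.bAvg h _).bAvg h _

/-! ### Fourier analysis on the square -/

theorem Omega_subset (L : ℝ) : Omega L ⊆ Icc (0 : ℝ) L ×ˢ Icc (0 : ℝ) L :=
  prod_mono Ioo_subset_Icc_self Ioo_subset_Icc_self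

instance instIsFiniteMeasureOmega (L : ℝ) : IsFiniteMeasure (measOmega L) :=
  ⟨by rw [Measure.restrict_apply_univ]
      exact (measure_mono (Omega_subset L)).trans_lt
        (isCompact_Icc.prod isCompact_Icc).measure_lt_top⟩

theorem integrable_Omega {E : Type*} [NormedAddCommGroup E] (L : ℝ) {f : ℝ × ℝ → E}
    (hf : Continuous f) : Integrable f (measOmega L) :=
  (hf.continuousOn.integrableOn_compact (isCompact_Icc.prod isCompact_Icc)).mono_set
    (Omega_subset L)

theorem integral_Omega_eq {E : Type*} [NormedAddCommGroup E] [NormedSpace ℝ E] {L : ℝ}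
    (hL : 0 < L) {f : ℝ × ℝ → E} (hf : Continuous f) :
    ∫ p in Omega L, f p = ∫ x in (0 : ℝ)..L, ∫ y in (0 : ℝ)..L, f (x, y) := by
  have h := setIntegral_prod (μ := (volume : Measure ℝ)) (ν := (volume : Measure ℝ)) f
    (s := Ioo 0 L) (t := Ioo 0 L) (integrable_Omega L hf)
  rw [intervalIntegral.integral_of_le hL.le, ← integral_Ioc_eq_integral_Ioo] at *
  simp only [intervalIntegral.integral_of_le hL.le, integral_Ioc_eq_integral_Ioo] at *
  exact h

theorem integral_Omega_eq' {E : Type*} [NormedAddCommGroup E] [NormedSpace ℝ E] {L : ℝ}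
    (hL : 0 < L) {f : ℝ × ℝ → E} (hf : Continuous f) :
    ∫ p in Omega L, f p = ∫ y in (0 : ℝ)..L, ∫ x in (0 : ℝ)..L, f (x, y) := by
  rw [integral_Omega_eq hL hf, intervalIntegral_intervalIntegral_swap]
  exact (hf.continuousOn.integrableOn_compact (isCompact_uIcc.prod isCompact_uIcc)).mono_set
      (prod_mono uIoc_subset_uIcc uIoc_subset_uIcc)

/-- The fundamental frequency `2π / L`. -/
def freq (L : ℝ) : ℝ := 2 * Real.pi / L

/-- The phase of the character with index `k`. -/
def phase (L : ℝ) (k : ℤ × ℤ) (p : ℝ × ℝ) : ℝ := freq L * k.1 * p.1 + freq L * k.2 * p.2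

/-- The `L`-periodic characters of the plane. -/
def chr (L : ℝ) (k : ℤ × ℤ) (p : ℝ × ℝ) : ℂ := Complex.exp ((phase L k p : ℝ) * Complex.I)

theorem continuous_phase (L : ℝ) (k : ℤ × ℤ) : Continuous (phase L k) := by
  unfold phase; fun_prop

theorem continuous_chr (L : ℝ) (k : ℤ × ℤ) : Continuous (chr L k) := by
  have := continuous_phase L k
  unfold chr; fun_prop

theorem norm_chr (L : ℝ) (k : ℤ × ℤ) (p : ℝ × ℝ) : ‖chr L k p‖ = 1 :=
  Complex.norm_exp_ofReal_mul_I _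

theorem chr_mul (L : ℝ) (k l : ℤ × ℤ) (p : ℝ × ℝ) : chr L k p * chr L l p = chr L (k + l) p := by
  unfold chr phase
  rw [← Complex.exp_add]
  congr 1
  push_cast [Prod.fst_add, Prod.snd_add]
  ring

theorem conj_chr (L : ℝ) (k : ℤ × ℤ) (p : ℝ × ℝ) :
    (starRingEnd ℂ) (chr L k p) = chr L (-k) p := by
  unfold chr phase
  rw [← Complex.exp_conj]
  congr 1
  simp
  ring

theorem chr_eq (L : ℝ) (k : ℤ × ℤ) (p : ℝ × ℝ) :
    chr L k p = (Real.cos (phase L k p) : ℂ) + (Real.sin (phase L k p) : ℂ) * Complex.I := by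
  rw [chr, Complex.exp_mul_I]; push_cast; rfl

theorem exp_periodic {L : ℝ} (hL : L ≠ 0) (n : ℤ) (x : ℝ) :
    Complex.exp ((freq L * n * (x + L) : ℝ) * Complex.I)
      = Complex.exp ((freq L * n * x : ℝ) * Complex.I) := by
  have : ((freq L * n * (x + L) : ℝ) : ℂ) * Complex.I
      = ((freq L * n * x : ℝ) : ℂ) * Complex.I + n * (2 * Real.pi * Complex.I) := by
    have e : freq L * n * (x + L) = freq L * n * x + n * (2 * Real.pi) := by
      unfold freq; field_simp
    rw [e]; push_cast; ring
  rw [this, Complex.exp_add, Complex.exp_int_mul_two_pi_mul_I, mul_one]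

theorem chr_eq_mul (L : ℝ) (k : ℤ × ℤ) (p : ℝ × ℝ) :
    chr L k p = Complex.exp ((freq L * k.1 * p.1 : ℝ) * Complex.I)
      * Complex.exp ((freq L * k.2 * p.2 : ℝ) * Complex.I) := by
  unfold chr phase
  rw [← Complex.exp_add]; congr 1; push_cast; ring

theorem integral_exp_freq {L : ℝ} (hL : 0 < L) (n : ℤ) :
    ∫ x in (0 : ℝ)..L, Complex.exp ((freq L * n * x : ℝ) * Complex.I)
      = if n = 0 then (L : ℂ) else 0 := by
  split_ifs with h
  · simp [h]
  · have hc : ((freq L * n : ℝ) : ℂ) * Complex.I ≠ 0 := by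
      refine mul_ne_zero ?_ Complex.I_ne_zero
      have : freq L * n ≠ 0 := mul_ne_zero (by unfold freq; positivity) (by exact_mod_cast h)
      exact_mod_cast this
    have e : ∀ x : ℝ, ((freq L * n * x : ℝ) : ℂ) * Complex.I
        = ((freq L * n : ℝ) : ℂ) * Complex.I * x := fun x => by push_cast; ring
    simp only [e]
    rw [integral_exp_mul_complex hc]
    have := exp_periodic hL.ne' n 0
    rw [zero_add, e, e] at this
    rw [this]
    simp

theorem integral_chr {L : ℝ} (hL : 0 < L) (k : ℤ × ℤ) :
    ∫ p in Omega L, chr L k p = if k = 0 then (L : ℂ) ^ 2 else 0 := by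
  rw [integral_Omega_eq hL (continuous_chr L k)]
  simp only [chr_eq_mul, intervalIntegral.integral_const_mul, intervalIntegral.integral_mul_const]
  rw [integral_exp_freq hL, integral_exp_freq hL]
  by_cases h1 : k.1 = 0 <;> by_cases h2 : k.2 = 0 <;>
    simp [h1, h2, Prod.ext_iff, sq]

/-- A continuous periodic function of one variable is determined by its Fourier coefficients. -/
theorem eq_zero_of_fourier_one {L : ℝ} (hL : 0 < L) {g : ℝ → ℂ} (hg : Continuous g)
    (hp : Function.Periodic g L)
    (h : ∀ n : ℤ, ∫ x in (0 : ℝ)..L, g x * Complex.exp ((freq L * n * x : ℝ) * Complex.I) = 0)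
    (x : ℝ) : g x = 0 := by
  have : Fact (0 < L) := ⟨hL⟩
  let F : C(AddCircle L, ℂ) := ⟨hp.lift, continuous_coinduced_dom.2 hg⟩
  have hF : ∀ x : ℝ, F (x : AddCircle L) = g x := fun x => hp.lift_coe x
  have hc : fourierCoeff F = 0 := by
    ext n
    rw [fourierCoeff_eq_intervalIntegral _ _ 0, zero_add]
    have e : ∀ x : ℝ, fourier (-n) (x : AddCircle L) • F (x : AddCircle L)
        = g x * Complex.exp ((freq L * (-n : ℤ) * x : ℝ) * Complex.I) := by
      intro x
      rw [hF, fourier_coe_apply, smul_eq_mul, mul_comm]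
      congr 2
      unfold freq
      push_cast
      ring
    simp only [e, h (-n), smul_zero, Pi.zero_apply]
  have hs := has_pointwise_sum_fourier_series_of_summable (f := F)
    (by rw [hc]; exact summable_zero) (x : AddCircle L)
  rw [hc, hF] at hs
  simpa using hs.unique (by simp)

/-- A continuous periodic function is determined by its Fourier coefficients. -/
theorem eq_zero_of_fourier {L : ℝ} (hL : 0 < L) {g : ℝ × ℝ → ℂ} (hg : Continuous g)
    (hp : ∀ x y, g (x + L, y) = g (x, y) ∧ g (x, y + L) = g (x, y))
    (h : ∀ k : ℤ × ℤ, ∫ p in Omega L, g p * chr L k p = 0) : g = 0 := by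
  have hk : ∀ k : ℤ × ℤ, Continuous fun p => g p * chr L k p := fun k =>
    hg.mul (continuous_chr L k)
  have step : ∀ (n : ℤ) (y : ℝ),
      ∫ x in (0 : ℝ)..L, g (x, y) * Complex.exp ((freq L * n * x : ℝ) * Complex.I) = 0 := by
    intro n
    refine eq_zero_of_fourier_one hL ?_ ?_ ?_
    · refine intervalIntegral.continuous_parametric_intervalIntegral_of_continuous' ?_ _ _
      fun_prop
    · intro y
      simp only [(hp _ y).2]
    · intro m
      have := h (n, m)
      rw [integral_Omega_eq' hL (hk _)] at this
      rw [← this]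
      refine intervalIntegral.integral_congr fun y _ => ?_
      simp only [chr_eq_mul, ← mul_assoc]
      rw [intervalIntegral.integral_mul_const]
  ext ⟨x, y⟩
  exact eq_zero_of_fourier_one hL (g := fun x => g (x, y)) (by fun_prop) (fun x => (hp x y).1)
    (fun n => step n y) x

theorem chr_periodic {L : ℝ} (hL : L ≠ 0) (k : ℤ × ℤ) (x y : ℝ) :
    chr L k (x + L, y) = chr L k (x, y) ∧ chr L k (x, y + L) = chr L k (x, y) := by
  simp only [chr_eq_mul, exp_periodic hL, and_self]

/-- The Fourier integrals of a real function. -/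
def fourierInt (L : ℝ) (f : ℝ × ℝ → ℝ) (k : ℤ × ℤ) : ℂ := ∫ p in Omega L, (f p : ℂ) * chr L (-k) p

theorem integrable_mul_Omega {L : ℝ} {f g : ℝ × ℝ → ℝ} (hf : Integrable f (measOmega L))
    (hg : Continuous g) (hb : ∀ p, |g p| ≤ 1) : Integrable (fun p => f p * g p) (measOmega L) :=
  hf.mul_bdd (c := 1) hg.aestronglyMeasurable (Filter.Eventually.of_forall hb)

theorem fourierInt_eq {L : ℝ} {f : ℝ × ℝ → ℝ} (hf : Integrable f (measOmega L)) (k : ℤ × ℤ) :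
    fourierInt L f k = ((∫ p in Omega L, f p * Real.cos (phase L k p) : ℝ) : ℂ)
      - ((∫ p in Omega L, f p * Real.sin (phase L k p) : ℝ) : ℂ) * Complex.I := by
  have hc := integrable_mul_Omega hf (Real.continuous_cos.comp (continuous_phase L k))
    (fun p => Real.abs_cos_le_one _)
  have hs := integrable_mul_Omega hf (Real.continuous_sin.comp (continuous_phase L k))
    (fun p => Real.abs_sin_le_one _)
  have e : ∀ p, (f p : ℂ) * chr L (-k) p = ((f p * Real.cos (phase L k p) : ℝ) : ℂ)
      - ((f p * Real.sin (phase L k p) : ℝ) : ℂ) * Complex.I := by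
    intro p
    have : phase L (-k) p = -phase L k p := by simp [phase]; ring
    rw [chr_eq, this, Real.cos_neg, Real.sin_neg]
    push_cast; ring
  simp only [fourierInt, e]
  rw [integral_sub hc.ofReal (hs.ofReal.mul_const _), integral_mul_const,
    integral_complex_ofReal, integral_complex_ofReal]

/-! Trigonometric test functions. -/

/-- The function `α cos (a x + b y) + β sin (a x + b y)`. -/
def trig (a b α β : ℝ) (p : ℝ × ℝ) : ℝ :=
  α * Real.cos (a * p.1 + b * p.2) + β * Real.sin (a * p.1 + b * p.2)

theorem contDiff_trig (a b α β : ℝ) : ContDiff ℝ ∞ (trig a b α β) := by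
  unfold trig; fun_prop

theorem dx_trig (a b α β : ℝ) : dx (trig a b α β) = trig a b (a * β) (-(a * α)) := by
  ext p
  have h1 : HasDerivAt (fun s : ℝ => a * s + b * p.2) a p.1 := by
    simpa using ((hasDerivAt_id p.1).const_mul a).add_const (b * p.2)
  have := (h1.cos.const_mul α).add (h1.sin.const_mul β)
  refine this.deriv.trans ?_
  simp only [trig]; ring

theorem dy_trig (a b α β : ℝ) : dy (trig a b α β) = trig a b (b * β) (-(b * α)) := by
  ext p
  have h1 : HasDerivAt (fun s : ℝ => a * p.1 + b * s) b p.2 := by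
    simpa using ((hasDerivAt_id p.2).const_mul b).const_add (a * p.1)
  have := (h1.cos.const_mul α).add (h1.sin.const_mul β)
  refine this.deriv.trans ?_
  simp only [trig]; ring

theorem trig_smul (a b c α β : ℝ) : trig a b (c * α) (c * β) = c • trig a b α β := by
  ext p; simp only [trig, Pi.smul_apply, smul_eq_mul]; ring

theorem partialDeriv_eight_zero_trig (a b α β : ℝ) :
    partialDeriv 8 0 (trig a b α β) = a ^ 8 • trig a b α β := by
  simp only [partialDeriv, Function.iterate_succ, Function.iterate_zero, Function.comp_apply, id,
    dx_trig]
  rw [← trig_smul]; congr 1 <;> ring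

theorem partialDeriv_zero_eight_trig (a b α β : ℝ) :
    partialDeriv 0 8 (trig a b α β) = b ^ 8 • trig a b α β := by
  simp only [partialDeriv, Function.iterate_succ, Function.iterate_zero, Function.comp_apply, id,
    dy_trig]
  rw [← trig_smul]; congr 1 <;> ring

theorem isTestFun_trig {L : ℝ} (hL : L ≠ 0) (k : ℤ × ℤ) (α β : ℝ) :
    IsTestFun L (trig (freq L * k.1) (freq L * k.2) α β) := by
  refine ⟨contDiff_trig _ _ _ _, fun x y => ?_⟩
  have e1 : freq L * k.1 * (x + L) + freq L * k.2 * y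
      = freq L * k.1 * x + freq L * k.2 * y + k.1 * (2 * Real.pi) := by
    unfold freq; field_simp; ring
  have e2 : freq L * k.1 * x + freq L * k.2 * (y + L)
      = freq L * k.1 * x + freq L * k.2 * y + k.2 * (2 * Real.pi) := by
    unfold freq; field_simp; ring
  simp only [trig, e1, e2, Real.cos_add_int_mul_two_pi, Real.sin_add_int_mul_two_pi, and_self]

theorem fourierInt_of_isWeakDeriv {L : ℝ} (hL : L ≠ 0) {a b : ℕ} {f g : ℝ × ℝ → ℝ}
    (hf : Integrable f (measOmega L)) (hg : Integrable g (measOmega L))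
    (h : IsWeakDeriv L a b f g) (hab : Even (a + b)) (k : ℤ × ℤ) {c : ℝ}
    (hc : ∀ α β, partialDeriv a b (trig (freq L * k.1) (freq L * k.2) α β)
      = c • trig (freq L * k.1) (freq L * k.2) α β) :
    fourierInt L g k = c * fourierInt L f k := by
  have key : ∀ α β, ∫ p in Omega L, g p * trig (freq L * k.1) (freq L * k.2) α β p
      = c * ∫ p in Omega L, f p * trig (freq L * k.1) (freq L * k.2) α β p := by
    intro α β
    have := h _ (isTestFun_trig hL k α β)
    rw [hc, hab.neg_one_pow, one_mul] at this
    rw [← this, ← integral_const_mul]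
    congr 1; ext p
    simp only [Pi.smul_apply, smul_eq_mul]; ring
  have h1 := key 1 0
  have h2 := key 0 1
  simp only [trig, one_mul, zero_mul, add_zero, zero_add] at h1 h2
  rw [fourierInt_eq hf, fourierInt_eq hg]
  simp only [phase]
  rw [h1, h2]
  push_cast; ring

/-- Bessel's inequality on the square. -/
theorem sum_fourierInt_sq_le {L : ℝ} (hL : 0 < L) (g : Lp ℝ 2 (measOmega L))
    (s : Finset (ℤ × ℤ)) : ∑ k ∈ s, ‖fourierInt L g k‖ ^ 2 ≤ L ^ 2 * ‖g‖ ^ 2 := by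
  have hmem : ∀ k, MemLp (fun p => (1 / L : ℂ) * chr L k p) 2 (measOmega L) := fun k =>
    MemLp.of_bound (continuous_const.mul (continuous_chr L k)).aestronglyMeasurable (1 / L)
      (Filter.Eventually.of_forall fun p => by
        rw [norm_mul, norm_chr, mul_one]; simp [abs_of_pos hL])
  set v : ℤ × ℤ → Lp ℂ 2 (measOmega L) := fun k => (hmem k).toLp _ with hv
  have hvk : ∀ k, v k =ᵐ[measOmega L] fun p => (1 / L : ℂ) * chr L k p := fun k =>
    (hmem k).coeFn_toLp
  have horth : Orthonormal ℂ v := by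
    rw [orthonormal_iff_ite]
    intro k l
    rw [L2.inner_def]
    have e : ∫ p, inner ℂ (v k p) (v l p) ∂(measOmega L)
        = ∫ p in Omega L, (1 / L : ℂ) ^ 2 * chr L (l - k) p := by
      refine integral_congr_ae ?_
      filter_upwards [hvk k, hvk l] with p h1 h2
      rw [h1, h2, RCLike.inner_apply, map_mul, conj_chr, sub_eq_add_neg, ← chr_mul]
      simp only [map_div₀, map_one, Complex.conj_ofReal]
      ring
    rw [e, integral_const_mul, integral_chr hL]
    have hL' : (L : ℂ) ≠ 0 := by exact_mod_cast hL.ne'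
    by_cases h : k = l
    · simp [h, hL']
    · rw [if_neg (fun h' => h (sub_eq_zero.1 h').symm), if_neg h, mul_zero]
  have hgm : MemLp (fun p => (g p : ℂ)) 2 (measOmega L) := (Lp.memLp g).ofReal
  set G : Lp ℂ 2 (measOmega L) := hgm.toLp _ with hG
  have hGn : ‖G‖ = ‖g‖ := by
    rw [hG, Lp.norm_toLp, Lp.norm_def]
    congr 1
    exact eLpNorm_congr_norm_ae (Filter.Eventually.of_forall fun p => by simp)
  have hb := horth.sum_inner_products_le (s := s) G
  rw [hGn] at hb
  have e : ∀ k, ‖fourierInt L g k‖ ^ 2 = L ^ 2 * ‖inner ℂ (v k) G‖ ^ 2 := by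
    intro k
    have e1 : inner ℂ (v k) G = (1 / L : ℂ) * fourierInt L g k := by
      rw [L2.inner_def, fourierInt, ← integral_const_mul]
      refine integral_congr_ae ?_
      filter_upwards [hvk k, hgm.coeFn_toLp] with p h1 h2
      rw [h1, h2, RCLike.inner_apply, map_mul, conj_chr]
      simp only [map_div₀, map_one, Complex.conj_ofReal]
      ring
    rw [e1, norm_mul, mul_pow, ← mul_assoc]
    simp [hL.ne']
  simp only [e, ← Finset.mul_sum]
  exact mul_le_mul_of_nonneg_left hb (sq_nonneg L)

/-! ### The embedding of `H⁸` into functions with six bounded derivatives -/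

/-- The weight `1 + |k|` on the frequency lattice. -/
def wt (L : ℝ) (k : ℤ × ℤ) : ℝ := 1 + |freq L * k.1| + |freq L * k.2|

theorem one_le_wt (L : ℝ) (k : ℤ × ℤ) : 1 ≤ wt L k := by
  unfold wt
  linarith [abs_nonneg (freq L * k.1), abs_nonneg (freq L * k.2)]

/-- The trigonometric series with coefficients `c`. -/
def trigSeries (L : ℝ) (c : ℤ × ℤ → ℂ) (p : ℝ × ℝ) : ℂ := ∑' k, c k * chr L k p

theorem summable_trigSeries {L : ℝ} {c : ℤ × ℤ → ℂ} (hc : Summable fun k => ‖c k‖) (p : ℝ × ℝ) :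
    Summable fun k => c k * chr L k p :=
  .of_norm (by simpa [norm_chr] using hc)

theorem continuous_trigSeries {L : ℝ} {c : ℤ × ℤ → ℂ} (hc : Summable fun k => ‖c k‖) :
    Continuous (trigSeries L c) :=
  continuous_tsum (fun k => continuous_const.mul (continuous_chr L k)) hc
    (fun k p => by simp [norm_chr])

theorem norm_trigSeries_le {L : ℝ} {c : ℤ × ℤ → ℂ} (hc : Summable fun k => ‖c k‖) (p : ℝ × ℝ) :
    ‖trigSeries L c p‖ ≤ ∑' k, ‖c k‖ :=
  tsum_of_norm_bounded hc.hasSum (fun k => by simp [norm_chr])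

theorem hasDir_trigSeries {L : ℝ} {c : ℤ × ℤ → ℂ} (hc : Summable fun k => wt L k * ‖c k‖)
    {d : ℝ × ℝ} {a : ℤ × ℤ → ℝ}
    (hd : ∀ k p s, phase L k (p + s • d) = phase L k p + a k * s) (ha : ∀ k, |a k| ≤ wt L k) :
    HasDir d (fun p => (trigSeries L c p).re)
      (fun p => (trigSeries L (fun k => c k * (a k * Complex.I)) p).re) := by
  intro p s
  have hder : ∀ k (s : ℝ), HasDerivAt (fun s : ℝ => c k * chr L k (p + s • d))
      (c k * (a k * Complex.I) * chr L k (p + s • d)) s := by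
    intro k s
    have h1 : HasDerivAt (fun s : ℝ => phase L k p + a k * s) (a k) s := by
      simpa using ((hasDerivAt_id s).const_mul (a k)).const_add (phase L k p)
    have h2 := ((h1.ofReal_comp.mul_const Complex.I).cexp).const_mul (c k)
    simp only [chr, hd]
    refine h2.congr_deriv ?_
    ring
  have hs : Summable fun k => ‖c k‖ := by
    refine Summable.of_nonneg_of_le (fun k => norm_nonneg _) (fun k => ?_) hc
    exact le_mul_of_one_le_left (norm_nonneg _) (one_le_wt L k)
  have := hasDerivAt_tsum (u := fun k => wt L k * ‖c k‖) (y₀ := (0 : ℝ)) hc hder (fun k s => by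
    rw [norm_mul, norm_chr, mul_one, norm_mul, norm_mul, Complex.norm_I, mul_one,
      Complex.norm_real, mul_comm]
    exact mul_le_mul_of_nonneg_right (ha k) (norm_nonneg _)) (summable_trigSeries hs _) s
  exact Complex.reCLM.hasFDerivAt.comp_hasDerivAt s this

theorem bddDiff_trigSeries {L : ℝ} (n : ℕ) {c : ℤ × ℤ → ℂ} {M : ℝ}
    (hc : Summable fun k => wt L k ^ n * ‖c k‖) (hM : ∑' k, wt L k ^ n * ‖c k‖ ≤ M) :
    BddDiff n M (fun p => (trigSeries L c p).re) := by
  have hle : ∀ k, ‖c k‖ ≤ wt L k ^ n * ‖c k‖ := fun k =>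
    le_mul_of_one_le_left (norm_nonneg _) (one_le_pow₀ (one_le_wt L k))
  have hs : Summable fun k => ‖c k‖ := Summable.of_nonneg_of_le (fun k => norm_nonneg _) hle hc
  have hcont : Continuous fun p => (trigSeries L c p).re :=
    Complex.continuous_re.comp (continuous_trigSeries hs)
  have hb : ∀ p, |(trigSeries L c p).re| ≤ M := fun p =>
    (Complex.abs_re_le_norm _).trans ((norm_trigSeries_le hs p).trans
      ((hs.tsum_le_tsum hle hc).trans hM))
  induction n generalizing c with
  | zero => exact ⟨hcont, hb⟩
  | succ n ih =>
    have hw : ∀ k, wt L k ^ (n + 1) * ‖c k‖ = wt L k ^ n * (wt L k * ‖c k‖) := fun k => by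
      rw [pow_succ, mul_assoc]
    have hc1 : Summable fun k => wt L k * ‖c k‖ := by
      refine Summable.of_nonneg_of_le (fun k => mul_nonneg ?_ (norm_nonneg _)) (fun k => ?_) hc
      · exact zero_le_one.trans (one_le_wt L k)
      · rw [hw]
        exact le_mul_of_one_le_left (mul_nonneg (zero_le_one.trans (one_le_wt L k))
          (norm_nonneg _)) (one_le_pow₀ (one_le_wt L k))
    have key : ∀ a : ℤ × ℤ → ℝ, (∀ k, |a k| ≤ wt L k) →
        BddDiff n M (fun p => (trigSeries L (fun k => c k * (a k * Complex.I)) p).re) := by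
      intro a ha
      have hle' : ∀ k, wt L k ^ n * ‖c k * (a k * Complex.I)‖ ≤ wt L k ^ (n + 1) * ‖c k‖ := by
        intro k
        rw [hw, norm_mul, norm_mul, Complex.norm_I, mul_one, Complex.norm_real, mul_comm ‖c k‖]
        refine mul_le_mul_of_nonneg_left (mul_le_mul_of_nonneg_right (ha k) (norm_nonneg _)) ?_
        exact pow_nonneg (zero_le_one.trans (one_le_wt L k)) n
      have hsum : Summable fun k => wt L k ^ n * ‖c k * (a k * Complex.I)‖ :=
        Summable.of_nonneg_of_le (fun k => mul_nonneg
          (pow_nonneg (zero_le_one.trans (one_le_wt L k)) n) (norm_nonneg _)) hle' hc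
      have hle2 : ∀ k, ‖c k * (a k * Complex.I)‖ ≤ wt L k ^ n * ‖c k * (a k * Complex.I)‖ :=
        fun k => le_mul_of_one_le_left (norm_nonneg _) (one_le_pow₀ (one_le_wt L k))
      have hs2 : Summable fun k => ‖c k * (a k * Complex.I)‖ :=
        Summable.of_nonneg_of_le (fun k => norm_nonneg _) hle2 hsum
      have hM2 := (hsum.tsum_le_tsum hle' hc).trans hM
      exact ih hsum hM2 hle2 hs2 (Complex.continuous_re.comp (continuous_trigSeries hs2))
        (fun p => (Complex.abs_re_le_norm _).trans ((norm_trigSeries_le hs2 p).trans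
          ((hs2.tsum_le_tsum hle2 hsum).trans hM2)))
    have ha1 : ∀ k : ℤ × ℤ, |freq L * k.1| ≤ wt L k := fun k => by
      unfold wt; linarith [abs_nonneg (freq L * k.2)]
    have ha2 : ∀ k : ℤ × ℤ, |freq L * k.2| ≤ wt L k := fun k => by
      unfold wt; linarith [abs_nonneg (freq L * k.1)]
    refine BddDiff.of_hasDir hcont hb
      (hasDir_trigSeries (a := fun k => freq L * k.1) hc1 (fun k p s => ?_) ha1)
      (hasDir_trigSeries (a := fun k => freq L * k.2) hc1 (fun k p s => ?_) ha2)
      (key _ ha1) (key _ ha2)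
    · simp [phase]; ring
    · simp [phase]; ring

/-- A continuous periodic function with absolutely summable Fourier integrals is the sum of its
Fourier series. -/
theorem eq_trigSeries {L : ℝ} (hL : 0 < L) {f : ℝ × ℝ → ℝ} (hf : Continuous f)
    (hp : PeriodicFun L f) (hs : Summable fun k => ‖fourierInt L f k‖) :
    f = fun p => (trigSeries L (fun k => fourierInt L f k / L ^ 2) p).re := by
  set c : ℤ × ℤ → ℂ := fun k => fourierInt L f k / L ^ 2 with hc
  have hL' : (L : ℂ) ≠ 0 := by exact_mod_cast hL.ne'
  have hcs : Summable fun k => ‖c k‖ := by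
    simp only [hc, norm_div]; exact hs.div_const _
  have hcont := continuous_trigSeries (L := L) hcs
  have hfc : Continuous fun p => (f p : ℂ) := Complex.continuous_ofReal.comp hf
  have hz : (fun p => (f p : ℂ) - trigSeries L c p) = 0 := by
    refine eq_zero_of_fourier hL (hfc.sub hcont) (fun x y => ?_) (fun k => ?_)
    · simp only [trigSeries, (hp x y).1, (hp x y).2, (chr_periodic hL.ne' _ x y).1,
        (chr_periodic hL.ne' _ x y).2, and_self]
    · simp only [sub_mul]
      have i1 : Integrable (fun p => (f p : ℂ) * chr L k p) (measOmega L) :=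
        integrable_Omega L (hfc.mul (continuous_chr L k))
      have i2 : Integrable (fun p => trigSeries L c p * chr L k p) (measOmega L) :=
        integrable_Omega L (hcont.mul (continuous_chr L k))
      rw [integral_sub i1 i2]
      have e1 : ∫ p in Omega L, (f p : ℂ) * chr L k p = fourierInt L f (-k) := by
        simp [fourierInt]
      have e2 : ∀ p, trigSeries L c p * chr L k p = ∑' l, c l * chr L (l + k) p := by
        intro p
        simp only [trigSeries, ← chr_mul, ← mul_assoc]
        rw [tsum_mul_right]
      have hsum := hasSum_integral_of_summable_integral_norm (μ := measOmega L)
        (F := fun l p => c l * chr L (l + k) p)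
        (fun l => integrable_Omega L (continuous_const.mul (continuous_chr L _))) (by
          simp only [norm_mul, norm_chr, mul_one, integral_const, smul_eq_mul]
          exact hcs.mul_left _)
      simp only [integral_const_mul, integral_chr hL] at hsum
      rw [e1]
      simp only [e2]
      rw [← hsum.tsum_eq, tsum_eq_single (-k)]
      · simp [hc, hL']
      · intro l hl
        rw [if_neg (fun h => hl (eq_neg_of_add_eq_zero_left h)), mul_zero]
  ext p
  have := congrFun hz p
  simp only [Pi.zero_apply] at this
  rw [← sub_eq_zero.1 this, Complex.ofReal_re]

theorem summable_inv_one_add_abs_sq {a : ℝ} (ha : 0 < a) :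
    Summable fun n : ℤ => 1 / (1 + |a * n|) ^ 2 := by
  have h1 : Summable fun n : ℤ => 1 / a ^ 2 * (1 / (n : ℝ) ^ 2) + if n = 0 then (1 : ℝ) else 0 :=
    ((Real.summable_one_div_int_pow.2 (by norm_num)).mul_left _).add
      (summable_of_ne_finset_zero (s := {0}) (by simp))
  refine Summable.of_nonneg_of_le (fun n => by positivity) (fun n => ?_) h1
  by_cases hn : n = 0
  · simp [hn]
  · rw [if_neg hn, add_zero, one_div_mul_one_div]
    have hn' : (0 : ℝ) < (n : ℝ) ^ 2 := by positivity
    refine one_div_le_one_div_of_le (by positivity) ?_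
    rw [← mul_pow, ← sq_abs (a * n)]
    gcongr
    linarith

theorem summable_wt_inv {L : ℝ} (hL : 0 < L) : Summable fun k => 1 / wt L k ^ 4 := by
  have hf : 0 < freq L := by unfold freq; positivity
  have h := (summable_inv_one_add_abs_sq hf).mul_of_nonneg (summable_inv_one_add_abs_sq hf)
    (fun n => by positivity) (fun n => by positivity)
  refine Summable.of_nonneg_of_le (fun k => ?_) (fun k => ?_) h
  · have := one_le_wt L k
    positivity
  · rw [one_div_mul_one_div]
    have h1 : 1 + |freq L * k.1| ≤ wt L k := by
      unfold wt; linarith [abs_nonneg (freq L * k.2)]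
    have h2 : 1 + |freq L * k.2| ≤ wt L k := by
      unfold wt; linarith [abs_nonneg (freq L * k.1)]
    refine one_div_le_one_div_of_le (by positivity) ?_
    have : wt L k ^ 4 = wt L k ^ 2 * wt L k ^ 2 := by ring
    rw [this]
    gcongr

theorem wt_pow_le (L : ℝ) (k : ℤ × ℤ) :
    wt L k ^ 8 ≤ 3 ^ 8 * (1 + (freq L * k.1) ^ 8 + (freq L * k.2) ^ 8) := by
  have key : ∀ a b : ℝ, 0 ≤ a → 0 ≤ b → (1 + a + b) ^ 8 ≤ 3 ^ 8 * (1 + a ^ 8 + b ^ 8) := by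
    intro a b ha hb
    set m := max 1 (max a b) with hm
    have h1 : 1 ≤ m := le_max_left _ _
    have h2 : a ≤ m := (le_max_left _ _).trans (le_max_right _ _)
    have h3 : b ≤ m := (le_max_right _ _).trans (le_max_right _ _)
    have h4 : m ^ 8 ≤ 1 + a ^ 8 + b ^ 8 := by
      have : (0 : ℝ) ≤ a ^ 8 := by positivity
      have : (0 : ℝ) ≤ b ^ 8 := by positivity
      rcases max_choice 1 (max a b) with h | h
      · rw [hm, h]; linarith
      · rw [hm, h]
        rcases max_choice a b with h' | h' <;> rw [h'] <;> linarith
    calc (1 + a + b) ^ 8 ≤ (3 * m) ^ 8 := by gcongr; linarith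
      _ = 3 ^ 8 * m ^ 8 := by ring
      _ ≤ _ := by gcongr
  have := key |freq L * k.1| |freq L * k.2| (abs_nonneg _) (abs_nonneg _)
  simpa only [wt, Even.pow_abs (show Even 8 by decide)] using this

/-- The Fourier integrals of a function with weak derivatives of order `8` in `L²` satisfy a
weighted `ℓ¹` bound, by the Cauchy–Schwarz and Bessel inequalities. -/
theorem sum_wt_fourierInt_le {L : ℝ} (hL : 0 < L) (u : Hper L 8) {f : ℝ × ℝ → ℝ}
    (hu : Represents u f) (s : Finset (ℤ × ℤ)) :
    ∑ k ∈ s, wt L k ^ 6 * ‖fourierInt L f k‖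
      ≤ Real.sqrt (3 ^ 16 * ∑' k, 1 / wt L k ^ 4) * Real.sqrt (9 * (L ^ 2 * ‖u‖ ^ 2)) := by
  set v := (u : PiLp 2 fun _ : MultiIdx 8 => Lp ℝ 2 (measOmega L)) with hv
  have hint : ∀ g : Lp ℝ 2 (measOmega L), Integrable g (measOmega L) := fun g =>
    (Lp.memLp g).integrable (by norm_num)
  have hcongr : ∀ k, fourierInt L f k = fourierInt L (v (MultiIdx.zero 8)) k := by
    intro k
    refine integral_congr_ae ?_
    filter_upwards [hu] with p hp
    rw [← hp]
  let α1 : MultiIdx 8 := ⟨(8, 0), by decide⟩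
  let α2 : MultiIdx 8 := ⟨(0, 8), by decide⟩
  have w1 : IsWeakDeriv L 8 0 (v (MultiIdx.zero 8)) (v α1) := u.2 α1
  have w2 : IsWeakDeriv L 0 8 (v (MultiIdx.zero 8)) (v α2) := u.2 α2
  have c1 : ∀ k, fourierInt L (v α1) k = ((freq L * k.1) ^ 8 : ℝ) * fourierInt L f k := fun k => by
    rw [hcongr]
    exact fourierInt_of_isWeakDeriv hL.ne' (hint _) (hint _) w1 (by decide) k
      (fun α β => partialDeriv_eight_zero_trig _ _ α β)
  have c2 : ∀ k, fourierInt L (v α2) k = ((freq L * k.2) ^ 8 : ℝ) * fourierInt L f k := fun k => by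
    rw [hcongr]
    exact fourierInt_of_isWeakDeriv hL.ne' (hint _) (hint _) w2 (by decide) k
      (fun α β => partialDeriv_zero_eight_trig _ _ α β)
  have hn : ∀ α, ‖v α‖ ^ 2 ≤ ‖u‖ ^ 2 := fun α => by
    have : ‖v α‖ ≤ ‖v‖ := PiLp.norm_apply_le v α
    have h2 : ‖u‖ = ‖v‖ := rfl
    rw [h2]; gcongr
  have bessel : ∀ α, ∑ k ∈ s, ‖fourierInt L (v α) k‖ ^ 2 ≤ L ^ 2 * ‖u‖ ^ 2 := fun α =>
    (sum_fourierInt_sq_le hL _ s).trans (mul_le_mul_of_nonneg_left (hn α) (sq_nonneg L))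
  set q : ℤ × ℤ → ℝ := fun k => 1 + (freq L * k.1) ^ 8 + (freq L * k.2) ^ 8 with hq
  have hq1 : ∀ k, 1 ≤ q k := fun k => by
    have : 0 ≤ (freq L * k.1) ^ 8 := by positivity
    have : 0 ≤ (freq L * k.2) ^ 8 := by positivity
    simp only [hq]; linarith
  have e : ∀ k, wt L k ^ 6 * ‖fourierInt L f k‖
      = (wt L k ^ 6 / q k) * (q k * ‖fourierInt L f k‖) := fun k => by
    have := zero_lt_one.trans_le (hq1 k)
    field_simp
  simp only [e]
  refine (Real.sum_mul_le_sqrt_mul_sqrt s _ _).trans ?_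
  have hA : ∑ k ∈ s, (wt L k ^ 6 / q k) ^ 2 ≤ 3 ^ 16 * ∑' k, 1 / wt L k ^ 4 := by
    have hle : ∀ k, (wt L k ^ 6 / q k) ^ 2 ≤ 3 ^ 16 * (1 / wt L k ^ 4) := fun k => by
      have hw := zero_lt_one.trans_le (one_le_wt L k)
      have hqp := zero_lt_one.trans_le (hq1 k)
      have h8 : wt L k ^ 8 ≤ 3 ^ 8 * q k := wt_pow_le L k
      have h9 : wt L k ^ 6 / q k ≤ 3 ^ 8 * (1 / wt L k ^ 2) := by
        rw [div_le_iff₀ hqp]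
        have e6 : wt L k ^ 6 = wt L k ^ 8 * (1 / wt L k ^ 2) := by field_simp
        rw [e6, mul_right_comm]
        exact mul_le_mul_of_nonneg_right h8 (by positivity)
      calc (wt L k ^ 6 / q k) ^ 2 ≤ (3 ^ 8 * (1 / wt L k ^ 2)) ^ 2 := by gcongr
        _ = 3 ^ 16 * (1 / wt L k ^ 4) := by field_simp
    refine (Finset.sum_le_sum fun k _ => hle k).trans ?_
    rw [← Finset.mul_sum]
    refine mul_le_mul_of_nonneg_left ?_ (by norm_num)
    refine (summable_wt_inv hL).sum_le_tsum s fun k _ => ?_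
    have hw := zero_lt_one.trans_le (one_le_wt L k)
    positivity
  have hB : ∑ k ∈ s, (q k * ‖fourierInt L f k‖) ^ 2 ≤ 9 * (L ^ 2 * ‖u‖ ^ 2) := by
    have hle : ∀ k, (q k * ‖fourierInt L f k‖) ^ 2 ≤ 3 * (‖fourierInt L (v (MultiIdx.zero 8)) k‖ ^ 2
        + ‖fourierInt L (v α1) k‖ ^ 2 + ‖fourierInt L (v α2) k‖ ^ 2) := fun k => by
      have n1 : ‖fourierInt L (v α1) k‖ = (freq L * k.1) ^ 8 * ‖fourierInt L f k‖ := by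
        rw [c1, norm_mul, Complex.norm_real, Real.norm_eq_abs, abs_of_nonneg (by positivity)]
      have n2 : ‖fourierInt L (v α2) k‖ = (freq L * k.2) ^ 8 * ‖fourierInt L f k‖ := by
        rw [c2, norm_mul, Complex.norm_real, Real.norm_eq_abs, abs_of_nonneg (by positivity)]
      rw [← hcongr, n1, n2]
      set x := ‖fourierInt L f k‖
      have ex : q k * x = x + (freq L * k.1) ^ 8 * x + (freq L * k.2) ^ 8 * x := by
        simp only [hq]; ring
      rw [ex]
      generalize (freq L * k.1) ^ 8 * x = y
      generalize (freq L * k.2) ^ 8 * x = z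
      nlinarith [sq_nonneg (x - y), sq_nonneg (y - z), sq_nonneg (x - z)]
    refine (Finset.sum_le_sum fun k _ => hle k).trans ?_
    rw [← Finset.mul_sum, Finset.sum_add_distrib, Finset.sum_add_distrib]
    have b0 := bessel (MultiIdx.zero 8)
    have b1 := bessel α1
    have b2 := bessel α2
    linarith
  exact mul_le_mul (Real.sqrt_le_sqrt hA) (Real.sqrt_le_sqrt hB) (Real.sqrt_nonneg _)
    (Real.sqrt_nonneg _)

theorem bddDiff_of_sum_le {L : ℝ} (hL : 0 < L) {f : ℝ × ℝ → ℝ} (hf : Continuous f)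
    (hp : PeriodicFun L f) {R : ℝ}
    (hR : ∀ s : Finset (ℤ × ℤ), ∑ k ∈ s, wt L k ^ 6 * ‖fourierInt L f k‖ ≤ R) :
    BddDiff 6 (R / L ^ 2) f := by
  have hnn : ∀ k, 0 ≤ wt L k ^ 6 * ‖fourierInt L f k‖ := fun k =>
    mul_nonneg (pow_nonneg (zero_le_one.trans (one_le_wt L k)) 6) (norm_nonneg _)
  have hs : Summable fun k => wt L k ^ 6 * ‖fourierInt L f k‖ := summable_of_sum_le hnn hR
  have hs0 : Summable fun k => ‖fourierInt L f k‖ :=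
    Summable.of_nonneg_of_le (fun k => norm_nonneg _) (fun k =>
      le_mul_of_one_le_left (norm_nonneg _) (one_le_pow₀ (one_le_wt L k))) hs
  have e : ∀ k, wt L k ^ 6 * ‖fourierInt L f k / (L : ℂ) ^ 2‖
      = wt L k ^ 6 * ‖fourierInt L f k‖ / L ^ 2 := fun k => by
    rw [norm_div, norm_pow, Complex.norm_real, Real.norm_eq_abs, sq_abs, mul_div_assoc]
  rw [eq_trigSeries hL hf hp hs0]
  refine bddDiff_trigSeries 6 ?_ ?_
  · simp only [e]; exact hs.div_const _
  · simp only [e]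
    rw [tsum_div_const]
    exact div_le_div_of_nonneg_right (hs.tsum_le_of_sum_le hR) (sq_nonneg L)

/-! ### Spatial regularity of the solution and the pointwise equation -/

/-- Integration over `Ω` against a continuous function is a continuous linear functional on the
bounded continuous functions. -/
theorem exists_integral_clm (L : ℝ) {ψ : ℝ × ℝ → ℝ} (h : Continuous ψ) :
    ∃ l : (ℝ × ℝ →ᵇ ℝ) →L[ℝ] ℝ, ∀ f, l f = ∫ p in Omega L, f p * ψ p := by
  have hi : ∀ f : ℝ × ℝ →ᵇ ℝ, Integrable (fun p => f p * ψ p) (measOmega L) := fun f =>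
    integrable_Omega L (f.continuous.mul h)
  refine ⟨LinearMap.mkContinuous ⟨⟨fun f => ∫ p in Omega L, f p * ψ p, fun f g => ?_⟩,
    fun c f => ?_⟩ (∫ p in Omega L, |ψ p|) fun f => ?_, fun f => rfl⟩
  · rw [← integral_add (hi f) (hi g)]
    congr 1; ext p; simp [add_mul]
  · simp only [RingHom.id_apply, smul_eq_mul]
    rw [← integral_const_mul]
    congr 1; ext p; simp [mul_assoc]
  · refine (norm_integral_le_integral_norm _).trans ?_
    rw [mul_comm, ← integral_const_mul]
    refine integral_mono (hi f).norm ((integrable_Omega L h.abs).const_mul _) fun p => ?_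
    simp only [norm_mul]
    exact mul_le_mul_of_nonneg_right (f.norm_coe_le_norm p) (norm_nonneg _)

theorem continuousOn_fourierInt {L : ℝ} {S : Set ℝ} {Φ : ℝ → (ℝ × ℝ →ᵇ ℝ)}
    (h : ContinuousOn Φ S) (k : ℤ × ℤ) : ContinuousOn (fun t => fourierInt L (Φ t) k) S := by
  obtain ⟨l1, hl1⟩ := exists_integral_clm L (Real.continuous_cos.comp (continuous_phase L k))
  obtain ⟨l2, hl2⟩ := exists_integral_clm L (Real.continuous_sin.comp (continuous_phase L k))
  have e : (fun t => fourierInt L (Φ t) k)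
      = fun t => ((l1 (Φ t) : ℝ) : ℂ) - ((l2 (Φ t) : ℝ) : ℂ) * Complex.I := by
    ext t
    rw [fourierInt_eq (integrable_Omega L (Φ t).continuous), hl1, hl2]
    rfl
  rw [e]
  have h1 := Complex.continuous_ofReal.comp_continuousOn (l1.continuous.comp_continuousOn h)
  have h2 := Complex.continuous_ofReal.comp_continuousOn (l2.continuous.comp_continuousOn h)
  exact h1.sub (h2.mul continuousOn_const)

theorem le_of_ae_le_of_continuousOn {T K : ℝ} (hT : 0 < T) {f : ℝ → ℝ}
    (hf : ContinuousOn f (Icc 0 T)) (h : ∀ᵐ t ∂(volume.restrict (Ioo 0 T)), f t ≤ K) {t : ℝ}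
    (ht : t ∈ Icc 0 T) : f t ≤ K := by
  have h' : f =ᵐ[volume.restrict (Icc 0 T)] fun t => min (f t) K := by
    rw [← restrict_Ioo_eq_restrict_Icc]
    filter_upwards [h] with t ht
    rw [min_eq_left ht]
  have := Measure.eqOn_Icc_of_ae_eq volume hT.ne h' hf (hf.inf continuousOn_const) ht
  exact min_eq_left_iff.1 this.symm

/-- The bound in `H⁸` for almost every time gives six classical derivatives at every time, with
uniform bounds: the weighted sums of Fourier coefficients are lower semicontinuous in time. -/
theorem exists_bddDiff {L T : ℝ} (hL : 0 < L) (hT : 0 < T) {Φ : ℝ → (ℝ × ℝ →ᵇ ℝ)}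
    (hc : ContinuousOn Φ (Icc 0 T)) (hp : ∀ t ∈ Icc 0 T, PeriodicFun L (Φ t))
    (hreg : RegularityClass L T Φ) : ∃ M, ∀ t ∈ Icc 0 T, BddDiff 6 M (Φ t) := by
  obtain ⟨u, hu, hrep⟩ := hreg.linfh8
  have hfin : eLpNormEssSup u (volume.restrict (Ioo 0 T)) ≠ ⊤ := by
    have := hu.2.ne
    rwa [eLpNorm_exponent_top] at this
  set R := (eLpNormEssSup u (volume.restrict (Ioo 0 T))).toReal with hR
  have hb : ∀ᵐ t ∂(volume.restrict (Ioo 0 T)), ‖u t‖ ≤ R := by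
    filter_upwards [ae_le_eLpNormEssSup (f := u) (μ := volume.restrict (Ioo 0 T))] with t ht
    rw [← toReal_enorm]
    exact ENNReal.toReal_mono hfin ht
  set Q := √(3 ^ 16 * ∑' k, 1 / wt L k ^ 4) * √(9 * (L ^ 2 * R ^ 2)) with hQ
  refine ⟨Q / L ^ 2, fun t ht => bddDiff_of_sum_le hL (Φ t).continuous (hp t ht) fun s => ?_⟩
  have hcs : ContinuousOn (fun t => ∑ k ∈ s, wt L k ^ 6 * ‖fourierInt L (Φ t) k‖) (Icc 0 T) :=
    continuousOn_finsetSum _ fun k _ => continuousOn_const.mul (continuousOn_fourierInt hc k).norm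
  refine le_of_ae_le_of_continuousOn hT hcs ?_ ht
  filter_upwards [hb, hrep] with t h1 h2
  refine (sum_wt_fourierInt_le hL (u t) h2 s).trans ?_
  rw [hQ]
  gcongr

theorem PeriodicFun.dx {L : ℝ} {f : ℝ × ℝ → ℝ} (h : PeriodicFun L f) : PeriodicFun L (dx f) := by
  intro x y
  constructor
  · have e : (fun s => f (s, y)) = fun s => f (s + L, y) := by ext s; exact (h s y).1.symm
    simp only [CahnHilliard.dx]
    conv_rhs => rw [e, deriv_comp_add_const (fun s => f (s, y)) L x]
  · simp only [CahnHilliard.dx]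
    congr 1; ext s; exact (h s y).2

theorem PeriodicFun.dy {L : ℝ} {f : ℝ × ℝ → ℝ} (h : PeriodicFun L f) : PeriodicFun L (dy f) := by
  intro x y
  constructor
  · simp only [CahnHilliard.dy]
    congr 1; ext s; exact (h x s).1
  · have e : (fun s => f (x, s)) = fun s => f (x, s + L) := by ext s; exact (h x s).2.symm
    simp only [CahnHilliard.dy]
    conv_rhs => rw [e, deriv_comp_add_const (fun s => f (x, s)) L y]

theorem PeriodicFun.add {L : ℝ} {f g : ℝ × ℝ → ℝ} (hf : PeriodicFun L f) (hg : PeriodicFun L g) :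
    PeriodicFun L (f + g) := fun x y => by
  simp only [Pi.add_apply, (hf x y).1, (hf x y).2, (hg x y).1, (hg x y).2, and_self]

theorem PeriodicFun.sub {L : ℝ} {f g : ℝ × ℝ → ℝ} (hf : PeriodicFun L f) (hg : PeriodicFun L g) :
    PeriodicFun L (f - g) := fun x y => by
  simp only [Pi.sub_apply, (hf x y).1, (hf x y).2, (hg x y).1, (hg x y).2, and_self]

theorem PeriodicFun.smul {L : ℝ} {f : ℝ × ℝ → ℝ} (c : ℝ) (hf : PeriodicFun L f) :
    PeriodicFun L (c • f) := fun x y => by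
  simp only [Pi.smul_apply, (hf x y).1, (hf x y).2, and_self]

theorem PeriodicFun.mul {L : ℝ} {f g : ℝ × ℝ → ℝ} (hf : PeriodicFun L f) (hg : PeriodicFun L g) :
    PeriodicFun L (f * g) := fun x y => by
  simp only [Pi.mul_apply, (hf x y).1, (hf x y).2, (hg x y).1, (hg x y).2, and_self]

theorem PeriodicFun.lap {L : ℝ} {f : ℝ × ℝ → ℝ} (h : PeriodicFun L f) :
    PeriodicFun L (lap f) := by
  rw [lap_eq]; exact h.dx.dx.add h.dy.dy

theorem PeriodicFun.chemPot {L : ℝ} {f : ℝ × ℝ → ℝ} (ε : ℝ) (h : PeriodicFun L f) :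
    PeriodicFun L (chemPot ε f) := by
  have h3 : PeriodicFun L (f ^ 3) := by
    rw [show f ^ 3 = f * f * f by ring]; exact (h.mul h).mul h
  exact (h3.sub h).sub (h.lap.smul _)

theorem hasDir_dx {ψ : ℝ × ℝ → ℝ} (h : ContDiff ℝ ∞ ψ) : HasDir (1, 0) ψ (dx ψ) := fun p s => by
  have hd : DifferentiableAt ℝ (fun s => ψ (s, p.2)) (p.1 + s) :=
    (h.differentiable (by simp)).differentiableAt.comp (f := fun s : ℝ => (s, p.2)) _ (by fun_prop)
  have := (hd.hasDerivAt).comp_const_add p.1 s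
  obtain ⟨x, y⟩ := p
  simpa [dx] using this

theorem hasDir_dy {ψ : ℝ × ℝ → ℝ} (h : ContDiff ℝ ∞ ψ) : HasDir (0, 1) ψ (dy ψ) := fun p s => by
  have hd : DifferentiableAt ℝ (fun s => ψ (p.1, s)) (p.2 + s) :=
    (h.differentiable (by simp)).differentiableAt.comp (f := fun s : ℝ => (p.1, s)) _ (by fun_prop)
  have := (hd.hasDerivAt).comp_const_add p.2 s
  obtain ⟨x, y⟩ := p
  simpa [dy] using this

theorem IsTestFun.lap {L : ℝ} {ψ : ℝ × ℝ → ℝ} (h : IsTestFun L ψ) : IsTestFun L (lap ψ) :=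
  ⟨(contDiff_partialDeriv 2 0 h.smooth).add (contDiff_partialDeriv 0 2 h.smooth), h.periodic.lap⟩

theorem integral_hasDir_eq_zero {L : ℝ} (hL : 0 < L) {d : ℝ × ℝ} (hd : IsAxis d)
    {f g : ℝ × ℝ → ℝ} (h : HasDir d f g) (hg : Continuous g) (hp : PeriodicFun L f) :
    ∫ p in Omega L, g p = 0 := by
  rcases hd with rfl | rfl
  · rw [integral_Omega_eq' hL hg]
    have : ∀ y : ℝ, ∫ x in (0 : ℝ)..L, g (x, y) = 0 := fun y => by
      rw [intervalIntegral.integral_eq_sub_of_hasDerivAt (f := fun x => f (x, y))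
        (fun x _ => by simpa using h (0, y) x)
        (Continuous.intervalIntegrable (by fun_prop) _ _)]
      have := (hp 0 y).1
      rw [zero_add] at this
      rw [this, sub_self]
    simp [this]
  · rw [integral_Omega_eq hL hg]
    have : ∀ x : ℝ, ∫ y in (0 : ℝ)..L, g (x, y) = 0 := fun x => by
      rw [intervalIntegral.integral_eq_sub_of_hasDerivAt (f := fun y => f (x, y))
        (fun y _ => by simpa using h (x, 0) y)
        (Continuous.intervalIntegrable (by fun_prop) _ _)]
      have := (hp x 0).2
      rw [zero_add] at this
      rw [this, sub_self]
    simp [this]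

theorem integral_mul_hasDir {L : ℝ} (hL : 0 < L) {d : ℝ × ℝ} (hd : IsAxis d)
    {f f' g g' : ℝ × ℝ → ℝ} (hf : HasDir d f f') (hg : HasDir d g g') (cf : Continuous f)
    (cf' : Continuous f') (cg : Continuous g) (cg' : Continuous g') (pf : PeriodicFun L f)
    (pg : PeriodicFun L g) :
    ∫ p in Omega L, f p * g' p = -∫ p in Omega L, f' p * g p := by
  have := integral_hasDir_eq_zero hL hd (hf.mul hg) ((cf'.mul cg).add (cf.mul cg')) (pf.mul pg)
  have e : ∫ p in Omega L, (f' * g + f * g') p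
      = (∫ p in Omega L, f' p * g p) + ∫ p in Omega L, f p * g' p :=
    integral_add (integrable_Omega L (cf'.mul cg)) (integrable_Omega L (cf.mul cg'))
  rw [e] at this
  linarith

theorem integral_add_Omega (L : ℝ) {f g F : ℝ × ℝ → ℝ} (hf : Continuous f) (hg : Continuous g)
    (hF : F = f + g) :
    ∫ p in Omega L, F p = (∫ p in Omega L, f p) + ∫ p in Omega L, g p := by
  rw [hF]
  exact integral_add (integrable_Omega L hf) (integrable_Omega L hg)

theorem integral_mul_lap {L M : ℝ} (hL : 0 < L) {f ψ : ℝ × ℝ → ℝ} (hf : BddDiff 2 M f)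
    (hp : PeriodicFun L f) (hψ : IsTestFun L ψ) :
    ∫ p in Omega L, f p * lap ψ p = ∫ p in Omega L, lap f p * ψ p := by
  have sx := contDiff_dx hψ.smooth
  have sy := contDiff_dy hψ.smooth
  have c := hψ.smooth.continuous
  have hx := hf.2.2.2.1
  have hy := hf.2.2.2.2
  have x1 := integral_mul_hasDir hL (.inl rfl) hf.2.1 (hasDir_dx sx) hf.continuous hx.continuous
    sx.continuous (contDiff_dx sx).continuous hp hψ.periodic.dx
  have x2 := integral_mul_hasDir hL (.inl rfl) hx.2.1 (hasDir_dx hψ.smooth) hx.continuous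
    hx.2.2.2.1.continuous c sx.continuous hp.dx hψ.periodic
  have y1 := integral_mul_hasDir hL (.inr rfl) hf.2.2.1 (hasDir_dy sy) hf.continuous hy.continuous
    sy.continuous (contDiff_dy sy).continuous hp hψ.periodic.dy
  have y2 := integral_mul_hasDir hL (.inr rfl) hy.2.2.1 (hasDir_dy hψ.smooth) hy.continuous
    hy.2.2.2.2.continuous c sy.continuous hp.dy hψ.periodic
  have e1 : ∫ p in Omega L, f p * lap ψ p
      = (∫ p in Omega L, f p * dx (dx ψ) p) + ∫ p in Omega L, f p * dy (dy ψ) p :=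
    integral_add_Omega L (hf.continuous.mul (contDiff_dx sx).continuous)
      (hf.continuous.mul (contDiff_dy sy).continuous) (by ext p; simp [lap_eq, mul_add])
  have e2 : ∫ p in Omega L, lap f p * ψ p
      = (∫ p in Omega L, dx (dx f) p * ψ p) + ∫ p in Omega L, dy (dy f) p * ψ p :=
    integral_add_Omega L (hx.2.2.2.1.continuous.mul c) (hy.2.2.2.2.continuous.mul c)
      (by ext p; simp [lap_eq, add_mul])
  rw [e1, e2, x1, x2, y1, y2]
  ring

/-- Two continuous periodic functions with the same pairings with all test functions agree. -/
theorem eq_of_integral_testFun {L : ℝ} (hL : 0 < L) {f g : ℝ × ℝ → ℝ} (hf : Continuous f)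
    (hg : Continuous g) (pf : PeriodicFun L f) (pg : PeriodicFun L g)
    (h : ∀ ψ, IsTestFun L ψ → ∫ p in Omega L, f p * ψ p = ∫ p in Omega L, g p * ψ p) :
    f = g := by
  have hc : Continuous fun p => ((f p - g p : ℝ) : ℂ) :=
    Complex.continuous_ofReal.comp (hf.sub hg)
  have hF : ∀ k, fourierInt L f k = fourierInt L g k := fun k => by
    have e1 : trig (freq L * k.1) (freq L * k.2) 1 0 = fun p => Real.cos (phase L k p) := by
      ext p; simp [trig, phase]
    have e2 : trig (freq L * k.1) (freq L * k.2) 0 1 = fun p => Real.sin (phase L k p) := by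
      ext p; simp [trig, phase]
    have h1 := h _ (isTestFun_trig hL.ne' k 1 0)
    have h2 := h _ (isTestFun_trig hL.ne' k 0 1)
    rw [e1] at h1
    rw [e2] at h2
    rw [fourierInt_eq (integrable_Omega L hf), fourierInt_eq (integrable_Omega L hg), h1, h2]
  have hz := eq_zero_of_fourier hL hc (fun x y => by
      rw [(pf x y).1, (pf x y).2, (pg x y).1, (pg x y).2]; exact ⟨rfl, rfl⟩) fun k => by
    have := hF (-k)
    simp only [fourierInt, neg_neg] at this
    have i1 : Integrable (fun p => (f p : ℂ) * chr L k p) (measOmega L) :=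
      integrable_Omega L ((Complex.continuous_ofReal.comp hf).mul (continuous_chr L k))
    have i2 : Integrable (fun p => (g p : ℂ) * chr L k p) (measOmega L) :=
      integrable_Omega L ((Complex.continuous_ofReal.comp hg).mul (continuous_chr L k))
    simp only [Complex.ofReal_sub, sub_mul]
    rw [integral_sub i1 i2, this, sub_self]
  ext p
  have := congrFun hz p
  simp only [Pi.zero_apply, Complex.ofReal_eq_zero] at this
  linarith

/-- The right hand side of the weak equation at a smooth function. -/
theorem integral_weak_rhs {L ε M : ℝ} (hL : 0 < L) {f ψ : ℝ × ℝ → ℝ} (hf : BddDiff 6 M f)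
    (hp : PeriodicFun L f) (hψ : IsTestFun L ψ) :
    ∫ p in Omega L, (((f p) ^ 3 - f p) * lap ψ p - ε ^ 2 * f p * lap (lap ψ) p)
      = ∫ p in Omega L, lap (chemPot ε f) p * ψ p := by
  have cl := hψ.lap.smooth.continuous
  have cll := hψ.lap.lap.smooth.continuous
  have cf := hf.continuous
  have hlf := (hf.lap).continuous
  have h1 := integral_mul_lap hL (hf.of_le (k := 2) (by norm_num)) hp hψ.lap
  have h2 := integral_mul_lap hL (hf.chemPot (ε := ε) |>.of_le (k := 2) (by norm_num))
    (hp.chemPot ε) hψ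
  rw [← h2]
  have i1 : Integrable (fun p => ((f p) ^ 3 - f p) * lap ψ p) (measOmega L) :=
    integrable_Omega L (by fun_prop)
  have i2 : Integrable (fun p => ε ^ 2 * (f p * lap (lap ψ) p)) (measOmega L) :=
    integrable_Omega L (by fun_prop)
  have i3 : Integrable (fun p => ε ^ 2 * (lap f p * lap ψ p)) (measOmega L) :=
    integrable_Omega L (by fun_prop)
  simp only [mul_assoc (ε ^ 2)]
  rw [integral_sub i1 i2, integral_const_mul, h1, ← integral_const_mul, ← integral_sub i1 i3]
  congr 1; ext p
  simp only [chemPot, Pi.sub_apply, Pi.pow_apply, Pi.smul_apply, smul_eq_mul]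
  ring

theorem PeriodicFun.iff_forall {L : ℝ} {f : ℝ × ℝ → ℝ} :
    PeriodicFun L f ↔ ∀ p, f (p + (L, 0)) - f p = 0 ∧ f (p + (0, L)) - f p = 0 := by
  simp [PeriodicFun, sub_eq_zero, Prod.forall]

/-- If a curve of functions vanishes under a continuous functional on `[0, T]`, so does its
derivative. -/
theorem clm_deriv_eq_zero {X : Type*} [NormedAddCommGroup X] [NormedSpace ℝ X] {T : ℝ} (hT : 0 < T)
    {U V : ℝ → X} (hU : ∀ t, HasDerivAt U (V t) t) (l : X →L[ℝ] ℝ)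
    (h : ∀ t ∈ Icc 0 T, l (U t) = 0) : ∀ t ∈ Icc 0 T, l (V t) = 0 := by
  intro t ht
  have h1 : HasDerivWithinAt (fun t => l (U t)) (l (V t)) (Icc 0 T) t :=
    (l.hasFDerivAt.comp_hasDerivAt t (hU t)).hasDerivWithinAt
  have h2 : HasDerivWithinAt (fun t => l (U t)) 0 (Icc 0 T) t :=
    (hasDerivWithinAt_const t (Icc 0 T) (0 : ℝ)).congr h (h t ht)
  exact (uniqueDiffOn_Icc hT t ht).eq_deriv _ h1 h2

theorem eq_zero_of_deriv_eq_zero_Iic {c c' : ℝ → ℝ} (h : ∀ t, HasDerivAt c (c' t) t)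
    (h0 : c 0 = 0) (h' : ∀ t ≤ 0, c' t = 0) {t : ℝ} (ht : t ≤ 0) : c t = 0 := by
  have := (convex_Iic (0 : ℝ)).norm_image_sub_le_of_norm_hasDerivWithin_le (f := c) (f' := c')
    (C := 0) (fun s _ => (h s).hasDerivWithinAt) (fun s hs => by rw [h' s hs, norm_zero])
    (x := 0) (y := t) (mem_Iic.2 le_rfl) ht
  rw [zero_mul, h0, sub_zero] at this
  exact norm_le_zero_iff.1 this

/-- Spatial periodicity carries over to the extension in time to the past, since this extension is
quadratic in `t`. -/
theorem periodicFun_of_extension {L T : ℝ} (hT : 0 < T) {U V W : ℝ → (ℝ × ℝ →ᵇ ℝ)}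
    (hU : ∀ t, HasDerivAt U (V t) t) (hV : ∀ t, HasDerivAt V (W t) t)
    (hW : ∀ t ≤ 0, W t = W 0) (hp : ∀ t ∈ Icc 0 T, PeriodicFun L (U t)) :
    (∀ t ∈ Icc 0 T, PeriodicFun L (V t)) ∧ ∀ t ≤ T, PeriodicFun L (U t) := by
  have key : ∀ l : (ℝ × ℝ →ᵇ ℝ) →L[ℝ] ℝ, (∀ t ∈ Icc 0 T, l (U t) = 0) →
      (∀ t ∈ Icc 0 T, l (V t) = 0) ∧ ∀ t ≤ T, l (U t) = 0 := by
    intro l h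
    have hv := clm_deriv_eq_zero hT hU l h
    have hw := clm_deriv_eq_zero hT hV l hv
    have h0 : (0 : ℝ) ∈ Icc 0 T := ⟨le_rfl, hT.le⟩
    refine ⟨hv, fun t ht => ?_⟩
    rcases le_total 0 t with h1 | h1
    · exact h t ⟨h1, ht⟩
    · refine eq_zero_of_deriv_eq_zero_Iic
        (fun t => l.hasFDerivAt.comp_hasDerivAt t (hU t)) (h 0 h0) (fun s hs => ?_) h1
      refine eq_zero_of_deriv_eq_zero_Iic
        (fun t => l.hasFDerivAt.comp_hasDerivAt t (hV t)) (hv 0 h0) (fun r hr => ?_) hs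
      rw [hW r hr]
      exact hw 0 h0
  set D : ℝ × ℝ → ℝ × ℝ → (ℝ × ℝ →ᵇ ℝ) →L[ℝ] ℝ := fun v p =>
    BoundedContinuousFunction.evalCLM ℝ (p + v) - BoundedContinuousFunction.evalCLM ℝ p
  have k1 := fun p => key (D (L, 0) p) fun t ht => (PeriodicFun.iff_forall.1 (hp t ht) p).1
  have k2 := fun p => key (D (0, L) p) fun t ht => (PeriodicFun.iff_forall.1 (hp t ht) p).2
  exact ⟨fun t ht => PeriodicFun.iff_forall.2 fun p => ⟨(k1 p).1 t ht, (k2 p).1 t ht⟩,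
    fun t ht => PeriodicFun.iff_forall.2 fun p => ⟨(k1 p).2 t ht, (k2 p).2 t ht⟩⟩

/-- The equation holds pointwise on the closed time interval. -/
theorem timeDeriv_eq_lap_chemPot {L ε T M : ℝ} (hL : 0 < L) (hT : 0 < T) {Φ₀ : ℝ × ℝ → ℝ}
    {Φ U V : ℝ → (ℝ × ℝ →ᵇ ℝ)} (hsol : IsExactSolution L ε T Φ₀ Φ)
    (hU : ∀ t, HasDerivAt U (V t) t) (hV : Continuous V) (hUΦ : ∀ t ∈ Icc 0 T, U t = Φ t)
    (hM : ∀ t ∈ Icc 0 T, BddDiff 6 M (U t)) (hp : ∀ t ∈ Icc 0 T, PeriodicFun L (U t))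
    (hpV : ∀ t ∈ Icc 0 T, PeriodicFun L (V t)) :
    ∀ t ∈ Icc 0 T, ⇑(V t) = lap (chemPot ε (U t)) := by
  intro t ht
  refine eq_of_integral_testFun hL (V t).continuous
    ((hM t ht).chemPot (ε := ε)).lap.continuous (hpV t ht) ((hp t ht).chemPot ε).lap
    fun ψ hψ => ?_
  rw [← integral_weak_rhs hL (hM t ht) (hp t ht) hψ]
  have cl := hψ.lap.smooth.continuous
  have cll := hψ.lap.lap.smooth.continuous
  obtain ⟨l0, hl0⟩ := exists_integral_clm L hψ.smooth.continuous
  obtain ⟨l1, hl1⟩ := exists_integral_clm L cl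
  obtain ⟨l2, hl2⟩ := exists_integral_clm L cll
  have hUc : Continuous U := continuous_iff_continuousAt.2 fun t => (hU t).continuousAt
  have hr : ∀ f : ℝ × ℝ →ᵇ ℝ,
      ∫ p in Omega L, (((f p) ^ 3 - f p) * lap ψ p - ε ^ 2 * f p * lap (lap ψ) p)
        = l1 (f ^ 3 - f) - ε ^ 2 * l2 f := fun f => by
    have i1 : Integrable (fun p => ((f p) ^ 3 - f p) * lap ψ p) (measOmega L) :=
      integrable_Omega L (by fun_prop)
    have i2 : Integrable (fun p => ε ^ 2 * (f p * lap (lap ψ) p)) (measOmega L) :=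
      integrable_Omega L (by fun_prop)
    simp only [mul_assoc (ε ^ 2)]
    rw [hl1, hl2, integral_sub i1 i2, integral_const_mul]
    rfl
  rw [hr, ← hl0]
  have hcl : IsClosed {t | l0 (V t) = l1 (U t ^ 3 - U t) - ε ^ 2 * l2 (U t)} :=
    isClosed_eq (by fun_prop) (by fun_prop)
  have hsub : Ioo 0 T ⊆ {t | l0 (V t) = l1 (U t ^ 3 - U t) - ε ^ 2 * l2 (U t)} := by
    intro s hs
    have h1 := hsol.equation ψ hψ s hs
    have h2 : HasDerivAt (fun t => l0 (U t)) (l0 (V s)) s :=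
      l0.hasFDerivAt.comp_hasDerivAt s (hU s)
    have h3 : (fun t => ∫ p in Omega L, Φ t p * ψ p) =ᶠ[nhds s] fun t => l0 (U t) := by
      filter_upwards [Ioo_mem_nhds hs.1 hs.2] with r hr
      rw [hl0, hUΦ r (Ioo_subset_Icc_self hr)]
    have := (h2.congr_of_eventuallyEq h3).unique h1
    rw [← hUΦ s (Ioo_subset_Icc_self hs), hr] at this
    exact this
  have := hcl.closure_subset_iff.2 hsub
  rw [closure_Ioo hT.ne] at this
  exact this ht

/-! ### Differences in time of the exact solution -/

theorem norm_sub_le_of_hasDerivAt {X : Type*} [NormedAddCommGroup X] [NormedSpace ℝ X]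
    {f f' : ℝ → X} {a b C : ℝ} (hab : a ≤ b) (hf : ∀ t, HasDerivAt f (f' t) t)
    (hC : ∀ t ∈ Icc a b, ‖f' t‖ ≤ C) : ‖f b - f a‖ ≤ C * (b - a) := by
  have := (convex_Icc a b).norm_image_sub_le_of_norm_hasDerivWithin_le (f := f) (f' := f')
    (fun t _ => (hf t).hasDerivWithinAt) hC (left_mem_Icc.2 hab) (right_mem_Icc.2 hab)
  rwa [Real.norm_of_nonneg (sub_nonneg.2 hab)] at this

theorem norm_second_difference_le {X : Type*} [NormedAddCommGroup X] [NormedSpace ℝ X]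
    {U V W : ℝ → X} {t τ K : ℝ} (hτ : 0 ≤ τ) (hU : ∀ t, HasDerivAt U (V t) t)
    (hV : ∀ t, HasDerivAt V (W t) t) (hK : ∀ s ∈ Icc (t - 2 * τ) t, ‖W s‖ ≤ K) :
    ‖U t - (2 : ℝ) • U (t - τ) + U (t - 2 * τ)‖ ≤ K * τ ^ 2 := by
  have h1 : ∀ s, HasDerivAt (fun s => U s - U (s - τ)) (V s - V (s - τ)) s := fun s =>
    (hU s).sub ((hU (s - τ)).comp_sub_const s τ)
  have h2 : ∀ s ∈ Icc (t - τ) t, ‖V s - V (s - τ)‖ ≤ K * τ := fun s hs => by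
    have := norm_sub_le_of_hasDerivAt (a := s - τ) (b := s) (by linarith) hV
      (fun r hr => hK r ⟨by linarith [hr.1, hs.1], hr.2.trans hs.2⟩)
    rwa [sub_sub_cancel] at this
  have h3 := norm_sub_le_of_hasDerivAt (a := t - τ) (b := t) (by linarith) h1 h2
  rw [sub_sub_cancel] at h3
  have e : U t - (2 : ℝ) • U (t - τ) + U (t - 2 * τ)
      = U t - U (t - τ) - (U (t - τ) - U (t - τ - τ)) := by
    rw [show t - 2 * τ = t - τ - τ by ring]; module
  rw [e]
  linarith

/-- The truncation error of the two step backward difference quotient. -/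
theorem norm_bdf_remainder_le {X : Type*} [NormedAddCommGroup X] [NormedSpace ℝ X]
    {U V W : ℝ → X} {t τ γ : ℝ} (hτ : 0 ≤ τ) (hU : ∀ t, HasDerivAt U (V t) t)
    (hV : ∀ t, HasDerivAt V (W t) t) (hγ : ∀ s ∈ Icc (t - 2 * τ) t, ‖W s - W t‖ ≤ γ) :
    ‖(3 / 2 : ℝ) • U t - (2 : ℝ) • U (t - τ) + (1 / 2 : ℝ) • U (t - 2 * τ) - τ • V t‖
      ≤ 6 * γ * τ ^ 2 := by
  -- the remainder `P` of the second order Taylor expansion at `t`, and its derivative `Q`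
  set P : ℝ → X := fun s => U s - U t - (s - t) • V t - ((s - t) ^ 2 / 2) • W t with hP
  set Q : ℝ → X := fun s => V s - V t - (s - t) • W t with hQ
  have hγ0 : 0 ≤ γ := (norm_nonneg _).trans (hγ t ⟨by linarith, le_rfl⟩)
  have dQ : ∀ s, HasDerivAt Q (W s - W t) s := fun s => by
    have := ((hV s).sub_const (V t)).sub (((hasDerivAt_id s).sub_const t).smul_const (W t))
    exact this.congr_deriv (by simp)
  have dP : ∀ s, HasDerivAt P (Q s) s := fun s => by
    have h1 : HasDerivAt (fun s : ℝ => (s - t) ^ 2 / 2) (s - t) s := by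
      have := (((hasDerivAt_id s).sub_const t).pow 2).div_const 2
      simpa using this
    have := (((hU s).sub_const (U t)).sub
      (((hasDerivAt_id s).sub_const t).smul_const (V t))).sub (h1.smul_const (W t))
    exact this.congr_deriv (by rw [one_smul])
  have Qt : Q t = 0 := by simp [hQ]
  have Pt : P t = 0 := by simp [hP]
  have bQ : ∀ s ∈ Icc (t - 2 * τ) t, ‖Q s‖ ≤ 2 * γ * τ := fun s hs => by
    have := norm_sub_le_of_hasDerivAt hs.2 dQ (fun r hr => hγ r ⟨hs.1.trans hr.1, hr.2⟩)
    rw [Qt, zero_sub, norm_neg] at this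
    nlinarith [hs.1]
  have bP : ∀ s ∈ Icc (t - 2 * τ) t, ‖P s‖ ≤ 2 * γ * τ * (t - s) := fun s hs => by
    have := norm_sub_le_of_hasDerivAt hs.2 dP (fun r hr => bQ r ⟨hs.1.trans hr.1, hr.2⟩)
    rwa [Pt, zero_sub, norm_neg] at this
  have b0 := bP (t - τ) ⟨by linarith, by linarith⟩
  have b1 := bP (t - 2 * τ) ⟨le_rfl, by linarith⟩
  have e : (3 / 2 : ℝ) • U t - (2 : ℝ) • U (t - τ) + (1 / 2 : ℝ) • U (t - 2 * τ) - τ • V t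
      = (1 / 2 : ℝ) • P (t - 2 * τ) - (2 : ℝ) • P (t - τ) := by
    simp only [hP]; module
  rw [e]
  refine (norm_sub_le _ _).trans ?_
  rw [norm_smul, norm_smul, Real.norm_of_nonneg (by norm_num), Real.norm_of_nonneg (by norm_num)]
  nlinarith

theorem sq_integral_le {a b : ℝ} (hab : a < b) {g : ℝ → ℝ} (hg : IntervalIntegrable g volume a b)
    (hg2 : IntervalIntegrable (fun t => g t ^ 2) volume a b) :
    (∫ t in a..b, g t) ^ 2 ≤ (b - a) * ∫ t in a..b, g t ^ 2 := by
  set c := (∫ t in a..b, g t) / (b - a) with hc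
  have hba : 0 < b - a := sub_pos.2 hab
  have h0 : 0 ≤ ∫ t in a..b, (g t ^ 2 - 2 * c * g t + c ^ 2) :=
    intervalIntegral.integral_nonneg hab.le fun t _ => by
      rw [show g t ^ 2 - 2 * c * g t + c ^ 2 = (g t - c) ^ 2 by ring]; positivity
  rw [intervalIntegral.integral_add (hg2.sub (hg.const_mul _)) (by simp),
    intervalIntegral.integral_sub hg2 (hg.const_mul _), intervalIntegral.integral_const_mul,
    intervalIntegral.integral_const, smul_eq_mul] at h0
  have e : ∫ t in a..b, g t = c * (b - a) := by rw [hc]; field_simp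
  rw [e] at h0 ⊢
  nlinarith

theorem sum_integral_le {g : ℝ → ℝ} (hg : Integrable g) (h0 : ∀ t, 0 ≤ g t) {a : ℕ → ℝ}
    (ha : Monotone a) (n : ℕ) :
    ∑ k ∈ Finset.range n, ∫ t in a k..a (k + 1), g t ≤ ∫ t, g t := by
  rw [intervalIntegral.sum_integral_adjacent_intervals fun k _ => hg.intervalIntegrable,
    intervalIntegral.integral_of_le (ha (Nat.zero_le n))]
  exact setIntegral_le_integral hg (Filter.Eventually.of_forall h0)

/-- The truncation errors of the time steps are square summable with the gain `τ⁵`. Each of them is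
controlled by the third time derivative on two time steps only, so square integrability of this
derivative is enough. -/
theorem exists_bdf_remainder_bound {X : Type*} [NormedAddCommGroup X] [NormedSpace ℝ X]
    [CompleteSpace X] {U V W G : ℝ → X} (hU : ∀ t, HasDerivAt U (V t) t)
    (hV : ∀ t, HasDerivAt V (W t) t) (hG : MemLp G 2 volume)
    (hW : ∀ s t, W t - W s = ∫ r in s..t, G r) (hGi : ∀ a b, IntervalIntegrable G volume a b)
    {τ : ℝ} (hτ : 0 < τ) :
    ∃ r : ℕ → ℝ, (∀ k : ℕ, ‖(3 / 2 : ℝ) • U ((k + 1) * τ) - (2 : ℝ) • U (k * τ)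
        + (1 / 2 : ℝ) • U ((k - 1) * τ) - τ • V ((k + 1) * τ)‖ ≤ r k) ∧
      ∀ n, ∑ k ∈ Finset.range n, r k ^ 2 ≤ 144 * (∫ t, ‖G t‖ ^ 2) * τ ^ 5 := by
  have hG2 : Integrable fun t => ‖G t‖ ^ 2 :=
    (memLp_two_iff_integrable_sq_norm hG.aestronglyMeasurable).1 hG
  refine ⟨fun k => 6 * (∫ t in ((k - 1) * τ)..((k + 1) * τ), ‖G t‖) * τ ^ 2, fun k => ?_,
    fun n => ?_⟩
  · have e1 : (k : ℝ) * τ = (k + 1) * τ - τ := by ring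
    have e2 : ((k : ℝ) - 1) * τ = (k + 1) * τ - 2 * τ := by ring
    rw [e1, e2]
    refine norm_bdf_remainder_le hτ.le hU hV fun s hs => ?_
    rw [hW]
    have hi : ∀ a b, IntervalIntegrable (fun t => ‖G t‖) volume a b := fun a b => (hGi a b).norm
    rw [intervalIntegral.integral_symm, norm_neg]
    refine (intervalIntegral.norm_integral_le_integral_norm hs.2).trans ?_
    refine intervalIntegral.integral_mono_interval (e2.le.trans hs.1) hs.2 le_rfl
      (Filter.Eventually.of_forall fun t => norm_nonneg _) (hi _ _)
  · have hle : ∀ k : ℕ, (6 * (∫ t in ((k - 1) * τ)..((k + 1) * τ), ‖G t‖) * τ ^ 2) ^ 2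
        ≤ 72 * τ ^ 5 * ((∫ t in ((k : ℝ) - 1) * τ..(((k + 1 : ℕ) : ℝ) - 1) * τ, ‖G t‖ ^ 2)
          + ∫ t in (k : ℝ) * τ..((k + 1 : ℕ) : ℝ) * τ, ‖G t‖ ^ 2) := fun k => by
      have hc := sq_integral_le (a := (k - 1) * τ) (b := (k + 1) * τ) (by nlinarith)
        (hGi _ _).norm hG2.intervalIntegrable
      have e : (((k + 1 : ℕ) : ℝ) - 1) * τ = k * τ := by push_cast; ring
      rw [e, show ((k + 1 : ℕ) : ℝ) = k + 1 by push_cast; ring,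
        intervalIntegral.integral_add_adjacent_intervals hG2.intervalIntegrable
          hG2.intervalIntegrable]
      have e3 : ((k : ℝ) + 1) * τ - (k - 1) * τ = 2 * τ := by ring
      rw [e3] at hc
      calc _ = 36 * τ ^ 4 * (∫ t in ((k - 1) * τ)..((k + 1) * τ), ‖G t‖) ^ 2 := by ring
        _ ≤ 36 * τ ^ 4 * (2 * τ * ∫ t in ((k - 1) * τ)..((k + 1) * τ), ‖G t‖ ^ 2) := by gcongr
        _ = _ := by ring
    refine (Finset.sum_le_sum fun k _ => hle k).trans ?_
    rw [← Finset.mul_sum, Finset.sum_add_distrib]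
    have s1 := sum_integral_le hG2 (fun t => by positivity) (a := fun k : ℕ => ((k : ℝ) - 1) * τ)
      (fun i j hij => by
        have : (i : ℝ) ≤ j := by exact_mod_cast hij
        simp only; gcongr) n
    have s2 := sum_integral_le hG2 (fun t => by positivity) (a := fun k : ℕ => (k : ℝ) * τ)
      (fun i j hij => by
        have : (i : ℝ) ≤ j := by exact_mod_cast hij
        simp only; gcongr) n
    calc _ ≤ 72 * τ ^ 5 * ((∫ t, ‖G t‖ ^ 2) + ∫ t, ‖G t‖ ^ 2) :=
          mul_le_mul_of_nonneg_left (add_le_add s1 s2) (by positivity)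
      _ = _ := by ring

/-- The properties of the exact solution, extended to negative times, that the error analysis uses.
`V` is the time derivative of `U`, and the constants `M` and `K` do not depend on the time step. -/
structure SmoothEvolution (L ε T M K : ℝ) (U V : ℝ → (ℝ × ℝ →ᵇ ℝ)) : Prop where
  bddDiff : ∀ t ∈ Icc 0 T, BddDiff 6 M (U t)
  deriv_eq : ∀ t ∈ Icc 0 T, ⇑(V t) = lap (chemPot ε (U t))
  periodic : ∀ t ≤ T, PeriodicFun L (U t)
  second_diff : ∀ t τ, 0 ≤ τ → -1 ≤ t - 2 * τ → t ≤ T →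
    ‖U t - (2 : ℝ) • U (t - τ) + U (t - 2 * τ)‖ ≤ K * τ ^ 2
  ghost : ∀ τ, 0 ≤ τ → τ ≤ 1 → ‖U (-τ) - U 0 + τ • V 0‖ ≤ K * τ ^ 2
  lap_diff : ∀ t τ, 0 ≤ τ → 0 ≤ t - τ → t ≤ T → ∀ h ≠ 0, ∀ p,
    |planeLap4 h (U t - U (t - τ)) p| ≤ K * τ
  truncation : ∀ τ, 0 < τ → ∃ r : ℕ → ℝ,
    (∀ k : ℕ, ‖(3 / 2 : ℝ) • U ((k + 1) * τ) - (2 : ℝ) • U (k * τ)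
        + (1 / 2 : ℝ) • U ((k - 1) * τ) - τ • V ((k + 1) * τ)‖ ≤ r k) ∧
      ∀ n, ∑ k ∈ Finset.range n, r k ^ 2 ≤ K * τ ^ 5

theorem exists_planeLap4_clm (h : ℝ) (p : ℝ × ℝ) :
    ∃ l : (ℝ × ℝ →ᵇ ℝ) →L[ℝ] ℝ, ∀ f, l f = planeLap4 h f p := by
  have hs : ∀ (d : ℝ × ℝ) (q : ℝ × ℝ), ∃ l : (ℝ × ℝ →ᵇ ℝ) →L[ℝ] ℝ, ∀ f, l f = secDiff h d f q :=
    fun d q => ⟨BoundedContinuousFunction.evalCLM ℝ (q + h • d)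
      - (2 : ℝ) • BoundedContinuousFunction.evalCLM ℝ q
      + BoundedContinuousFunction.evalCLM ℝ (q + -h • d), fun f => rfl⟩
  choose s hs using hs
  have hd : ∀ d : ℝ × ℝ, ∃ l : (ℝ × ℝ →ᵇ ℝ) →L[ℝ] ℝ, ∀ f, l f = planeD4 h d f p := fun d =>
    ⟨(1 / h ^ 2) • (s d p - (1 / 12 : ℝ) • (s d (p + h • d) - (2 : ℝ) • s d p + s d (p + -h • d))),
      fun f => by
        simp only [FunLike.coe_smul, FunLike.coe_sub, FunLike.coe_add, Pi.smul_apply, Pi.sub_apply,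
          Pi.add_apply, hs]
        rfl⟩
  choose l hl using hd
  exact ⟨l (1, 0) + l (0, 1), fun f => by
    simp only [FunLike.coe_add, Pi.add_apply, hl]; rfl⟩

/-- An exact solution of the given regularity extends to an evolution with all the properties that
the error analysis uses. -/
theorem exists_smoothEvolution {L ε T : ℝ} (hL : 0 < L) (hT : 0 < T) {Φ₀ : ℝ × ℝ → ℝ}
    {Φ : ℝ → (ℝ × ℝ →ᵇ ℝ)} (hsol : IsExactSolution L ε T Φ₀ Φ) (hreg : RegularityClass L T Φ) :
    ∃ M K U V, SmoothEvolution L ε T M K U V ∧ ∀ t ∈ Icc 0 T, U t = Φ t := by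
  obtain ⟨U, V, W, G, hU, hV, hWc, hG, hW, hGi, hW0, hUΦ⟩ :=
    exists_time_extension hT hsol.continuousOn hreg.h3c0
  obtain ⟨M, hM⟩ := exists_bddDiff hL hT hsol.continuousOn hsol.periodic hreg
  have hM' : ∀ t ∈ Icc 0 T, BddDiff 6 M (U t) := fun t ht => by rw [hUΦ t ht]; exact hM t ht
  have hp : ∀ t ∈ Icc 0 T, PeriodicFun L (U t) := fun t ht => by
    rw [hUΦ t ht]; exact hsol.periodic t ht
  obtain ⟨hpV, hpU⟩ := periodicFun_of_extension hT hU hV hW0 hp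
  have hVc : Continuous V := continuous_iff_continuousAt.2 fun t => (hV t).continuousAt
  have hVeq := timeDeriv_eq_lap_chemPot hL hT hsol hU hVc hUΦ hM' hp hpV
  obtain ⟨KW, hKW⟩ := (isCompact_Icc (a := (-1 : ℝ)) (b := T)).exists_bound_of_continuousOn
    hWc.continuousOn
  set I := ∫ t, ‖G t‖ ^ 2 with hI
  have hI0 : 0 ≤ I := integral_nonneg fun t => by positivity
  have hKW0 : 0 ≤ KW := (norm_nonneg _).trans (hKW 0 ⟨by norm_num, hT.le⟩)
  have h0T : (0 : ℝ) ∈ Icc 0 T := ⟨le_rfl, hT.le⟩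
  have hc0 : 0 ≤ chemBound ε M := ((hM 0 h0T).chemPot (ε := ε)).nonneg
  set K := KW + 8 * chemBound ε M + 144 * I with hK
  have hK1 : KW ≤ K := by linarith
  refine ⟨M, K, U, V, ⟨hM', hVeq, hpU, ?_, ?_, ?_, ?_⟩, hUΦ⟩
  · intro t τ hτ h1 h2
    exact norm_second_difference_le hτ hU hV fun s hs =>
      (hKW s ⟨h1.trans hs.1, hs.2.trans h2⟩).trans hK1
  · intro τ hτ h1
    have hV' : ∀ s ∈ Icc (-τ) 0, ‖V s - V 0‖ ≤ KW * τ := fun s hs => by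
      have := norm_sub_le_of_hasDerivAt hs.2 hV
        (fun r hr => hKW r ⟨by linarith [hs.1, hr.1], by linarith [hr.2]⟩)
      rw [norm_sub_rev] at this
      refine this.trans ?_
      gcongr
      linarith [hs.1]
    have hd : ∀ s, HasDerivAt (fun s => U s - s • V 0) (V s - V 0) s := fun s => by
      exact ((hU s).sub ((hasDerivAt_id s).smul_const (V 0))).congr_deriv (by simp)
    have := norm_sub_le_of_hasDerivAt (a := -τ) (b := 0) (by linarith) hd hV'
    rw [norm_sub_rev] at this
    have e : U (-τ) - -τ • V 0 - (U 0 - (0 : ℝ) • V 0) = U (-τ) - U 0 + τ • V 0 := by module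
    rw [e] at this
    nlinarith [mul_le_mul_of_nonneg_right hK1 (sq_nonneg τ)]
  · intro t τ hτ h1 h2 h hh p
    obtain ⟨l, hl⟩ := exists_planeLap4_clm h p
    have := norm_sub_le_of_hasDerivAt (a := t - τ) (b := t) (by linarith)
      (fun s => l.hasFDerivAt.comp_hasDerivAt s (hU s)) (C := 8 * chemBound ε M) fun s hs => by
        have hs' : s ∈ Icc 0 T := ⟨h1.trans hs.1, hs.2.trans h2⟩
        rw [hl, hVeq s hs', Real.norm_eq_abs]
        have := (((hM' s hs').chemPot (ε := ε)).lap).abs_planeLap4_le hh p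
        linarith
    rw [sub_sub_cancel, Function.comp_apply, Function.comp_apply, ← map_sub, hl,
      Real.norm_eq_abs] at this
    refine this.trans ?_
    gcongr
    linarith
  · intro τ hτ
    obtain ⟨r, h1, h2⟩ := exists_bdf_remainder_bound hU hV hG hW hGi hτ
    refine ⟨r, h1, fun n => (h2 n).trans ?_⟩
    gcongr
    linarith

/-! ### The averaged exact solution on the grid -/

theorem gsum_sq_le_of_abs_le {m : ℕ} {ν : GridFun} {b : ℝ} (h : ∀ i j, |ν i j| ≤ b) :
    gsum m (ν ^ 2) ≤ m ^ 2 * b ^ 2 := by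
  refine (gsum_mono (v := fun _ _ => b ^ 2) fun i j => ?_).trans (le_of_eq ?_)
  · exact sq_le_sq' (abs_le.1 (h i j)).1 (abs_le.1 (h i j)).2
  · rw [gsum_apply]
    simp only [Finset.sum_const, Int.card_Icc, add_sub_cancel_right, Int.toNat_natCast,
      nsmul_eq_mul]
    ring

theorem gsum_add_sq_le (m : ℕ) (u v : GridFun) :
    gsum m ((u + v) ^ 2) ≤ 2 * gsum m (u ^ 2) + 2 * gsum m (v ^ 2) := by
  have : gsum m ((u + v) ^ 2) ≤ gsum m ((2 : ℝ) • u ^ 2 + (2 : ℝ) • v ^ 2) :=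
      gsum_mono fun i j => by
    simp only [Pi.add_apply, Pi.pow_apply, Pi.smul_apply, smul_eq_mul]
    nlinarith [sq_nonneg (u i j - v i j)]
  simpa only [map_add, map_smul, smul_eq_mul] using this

theorem GridPeriodic.muStep {m : ℕ} {φ1 φ0 φm : GridFun} (h1 : GridPeriodic m φ1)
    (h0 : GridPeriodic m φ0) (hm : GridPeriodic m φm) (h ε A Δt : ℝ) :
    GridPeriodic m (muStep h ε A Δt φ1 φ0 φm) := fun i j α β => by
  simp only [CahnHilliard.muStep, h1 i j α β, h0 i j α β, hm i j α β, h1.lapH4 h i j α β,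
    (h1.sub h0).lapH4 h i j α β]

/-- The grid values of the averaged solution at the time level `k`. -/
def avgSol (h τ : ℝ) (U : ℝ → (ℝ × ℝ →ᵇ ℝ)) (k : ℤ) : GridFun := sample h (bAvg2 h (U (k * τ)))

/-- The constant in the estimate of the spatial residuals. -/
def resConst (ε A M K : ℝ) : ℝ :=
  576 * M ^ 3 + 12 * M + 56 * ε ^ 2 * M + (4 * K + 4 * |A| * K) + 4 * chemBound ε M

/-- The averaged solution satisfies the scheme up to small residuals. Since averages turn second
derivatives into second differences exactly, the spatial residuals appear under difference
operators, and only their own size matters. -/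
theorem SmoothEvolution.exists_residual {L ε T M K : ℝ} {U V : ℝ → (ℝ × ℝ →ᵇ ℝ)}
    (ev : SmoothEvolution L ε T M K U V) {h τ : ℝ} {m : ℕ} (hm : 0 < m) (hh : h = L / m)
    (hL : 0 < L) (hK : 0 ≤ K) (hτ : 0 < τ) (hτ1 : τ ≤ 1) (A : ℝ) {k : ℕ} (hk : (k + 1) * τ ≤ T)
    {b : ℝ} (hb : ‖(3 / 2 : ℝ) • U ((k + 1) * τ) - (2 : ℝ) • U (k * τ)
        + (1 / 2 : ℝ) • U ((k - 1) * τ) - τ • V ((k + 1) * τ)‖ ≤ b) :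
    ∃ ρ ρx ρy r : GridFun, GridPeriodic m ρ ∧ GridPeriodic m ρx ∧ GridPeriodic m ρy ∧
      (3 / 2 : ℝ) • avgSol h τ U (k + 1) - (2 : ℝ) • avgSol h τ U k
          + (1 / 2 : ℝ) • avgSol h τ U (k - 1)
        = τ • (lapH4 h (muStep h ε A τ (avgSol h τ U (k + 1)) (avgSol h τ U k)
            (avgSol h τ U (k - 1))) + lapH4 h ρ + D4 h 1 0 ρx + D4 h 0 1 ρy) + r ∧
      (∀ i j, |ρ i j| ≤ resConst ε A M K * (τ ^ 2 + h ^ 4)) ∧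
      (∀ i j, |ρx i j| ≤ resConst ε A M K * (τ ^ 2 + h ^ 4)) ∧
      (∀ i j, |ρy i j| ≤ resConst ε A M K * (τ ^ 2 + h ^ 4)) ∧
      ∀ i j, |r i j| ≤ 4 * b := by
  have hm' : (0 : ℝ) < m := by exact_mod_cast hm
  have hh0 : h ≠ 0 := by rw [hh]; positivity
  have hk0 : (0 : ℝ) ≤ k := Nat.cast_nonneg k
  have ht1 : ((k : ℝ) + 1) * τ ∈ Icc 0 T := ⟨by positivity, hk⟩
  have e1 : (k : ℝ) * τ = (k + 1) * τ - τ := by ring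
  have e2 : ((k : ℝ) - 1) * τ = (k + 1) * τ - 2 * τ := by ring
  set f1 := U ((k + 1) * τ) with hf1
  set f0 := U (k * τ) with hf0
  set fm := U ((k - 1) * τ) with hfm
  have p1 : PeriodicFun L f1 := ev.periodic _ hk
  have p0 : PeriodicFun L f0 := ev.periodic _ (by nlinarith)
  have pm : PeriodicFun L fm := ev.periodic _ (by nlinarith)
  have a1 : avgSol h τ U (k + 1) = sample h (bAvg2 h f1) := by
    simp only [avgSol, hf1]; push_cast; rfl
  have a0 : avgSol h τ U k = sample h (bAvg2 h f0) := by
    simp only [avgSol, hf0]; push_cast; rfl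
  have am : avgSol h τ U (k - 1) = sample h (bAvg2 h fm) := by
    simp only [avgSol, hfm]; push_cast; rfl
  have hB := ev.bddDiff _ ht1
  rw [← hf1] at hB
  have hμ := hB.chemPot (ε := ε)
  have hM := hB.nonneg
  have hcb := hμ.nonneg
  set μ := chemPot ε f1 with hμdef
  have pμ : PeriodicFun L μ := p1.chemPot ε
  set R : ℝ × ℝ →ᵇ ℝ := (3 / 2 : ℝ) • f1 - (2 : ℝ) • f0 + (1 / 2 : ℝ) • fm - τ • V ((k + 1) * τ)
    with hR
  have hRp : ∀ p, |R p| ≤ b := fun p => (R.norm_coe_le_norm p).trans hb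
  have hV := ev.deriv_eq _ ht1
  rw [← hf1, ← hμdef] at hV
  have eR : (3 / 2 : ℝ) • ⇑f1 - (2 : ℝ) • ⇑f0 + (1 / 2 : ℝ) • ⇑fm = τ • lap μ + ⇑R := by
    rw [← hV]; ext p
    simp [hR]
  have c1 := f1.continuous
  have c0 := f0.continuous
  have cm := fm.continuous
  have eA := congrArg (bAvg2 h) eR
  rw [bAvg2_add ((c1.const_smul _).sub (c0.const_smul _)) (cm.const_smul _),
    bAvg2_sub (c1.const_smul _) (c0.const_smul _),
    bAvg2_add (hμ.lap.continuous.const_smul _) R.continuous] at eA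
  simp only [bAvg2_smul] at eA
  rw [bAvg2_lap hh0 (hμ.of_le (by norm_num))] at eA
  set Z := planeMuStep h ε A τ (bAvg2 h f1) (bAvg2 h f0) (bAvg2 h fm) with hZ
  have eB : planeLap4 h μ = planeLap4 h Z + planeLap4 h (μ - Z) := by
    rw [planeLap4_sub]; abel
  rw [eB] at eA
  have hδ : resConst ε A M K * (τ ^ 2 + h ^ 4)
      = (576 * M ^ 3 + 12 * M + 56 * ε ^ 2 * M) * h ^ 4 + (4 * K + 4 * |A| * K) * τ ^ 2
        + 4 * (chemBound ε M * h ^ 4) + ((576 * M ^ 3 + 12 * M + 56 * ε ^ 2 * M) * τ ^ 2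
          + (4 * K + 4 * |A| * K) * h ^ 4 + 4 * (chemBound ε M * τ ^ 2)) := by
    unfold resConst; ring
  have n1 : 0 ≤ (576 * M ^ 3 + 12 * M + 56 * ε ^ 2 * M) * h ^ 4 := by positivity
  have n2 : 0 ≤ (4 * K + 4 * |A| * K) * τ ^ 2 := by positivity
  have n3 : 0 ≤ 4 * (chemBound ε M * h ^ 4) := by positivity
  have n4 : 0 ≤ (576 * M ^ 3 + 12 * M + 56 * ε ^ 2 * M) * τ ^ 2
          + (4 * K + 4 * |A| * K) * h ^ 4 + 4 * (chemBound ε M * τ ^ 2) := by positivity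
  have pZ : GridPeriodic m (sample h Z) := by
    rw [hZ, sample_planeMuStep]
    exact GridPeriodic.muStep (gridPeriodic_sample hm hh (periodicFun_bAvg2 p1))
      (gridPeriodic_sample hm hh (periodicFun_bAvg2 p0))
      (gridPeriodic_sample hm hh (periodicFun_bAvg2 pm)) _ _ _ _
  refine ⟨sample h (μ - Z), sample h (bAvg h (0, 1) μ - μ), sample h (bAvg h (1, 0) μ - μ),
    sample h (bAvg2 h R), (gridPeriodic_sample hm hh pμ).sub pZ,
    gridPeriodic_sample hm hh ((pμ.bAvg h _).sub pμ),
    gridPeriodic_sample hm hh ((pμ.bAvg h _).sub pμ), ?_, fun i j => ?_, fun i j => ?_,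
    fun i j => ?_, fun i j => abs_bAvg2_le hRp _⟩
  · rw [a1, a0, am, ← sample_planeMuStep, ← hZ, ← sample_planeLap4, ← sample_planeLap4,
      ← sample_planeD4_x, ← sample_planeD4_y]
    exact congrArg (sample h) eA
  · have hk1 : ∀ p, |(⇑f1 - (2 : ℝ) • ⇑f0 + ⇑fm) p| ≤ K * τ ^ 2 := fun p => by
      have := ev.second_diff ((k + 1) * τ) τ hτ.le (by nlinarith) hk
      rw [← e1, ← e2] at this
      exact (BoundedContinuousFunction.norm_coe_le_norm _ p).trans this
    have hk2 : ∀ p, |planeLap4 h (⇑f1 - ⇑f0) p| ≤ K * τ := fun p => by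
      have := ev.lap_diff ((k + 1) * τ) τ hτ.le (by rw [← e1]; positivity) hk h hh0 p
      rwa [← e1] at this
    have := hB.abs_chemPot_sub_planeMuStep_le (ε := ε) (A := A) hh0 hτ.le c0 cm hk1 hk2
      (((i : ℝ) - 1 / 2) * h, ((j : ℝ) - 1 / 2) * h)
    rw [hδ]
    refine le_trans this ?_
    linarith
  · have := hμ.abs_bAvg_sub_le (h := h) (.inr rfl) (((i : ℝ) - 1 / 2) * h, ((j : ℝ) - 1 / 2) * h)
    rw [hδ]
    refine le_trans this ?_
    linarith
  · have := hμ.abs_bAvg_sub_le (h := h) (.inl rfl) (((i : ℝ) - 1 / 2) * h, ((j : ℝ) - 1 / 2) * h)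
    rw [hδ]
    refine le_trans this ?_
    linarith

theorem BddDiff.abs_bAvg2_sub_le_sq {h M : ℝ} {f : ℝ × ℝ → ℝ} (hf : BddDiff 2 M f) (p : ℝ × ℝ) :
    |bAvg2 h f p - f p| ≤ 9 * (M * h ^ 2) := by
  have h1 := abs_bAvg_le (h := h) (d := (1, 0)) (f := CahnHilliard.bAvg h (0, 1) f - f)
    (hf.abs_bAvg_sub_le_sq (h := h) (Or.inr rfl)) p
  have h2 := abs_le.1 (hf.abs_bAvg_sub_le_sq (h := h) (Or.inl rfl) p)
  rw [bAvg_sub (continuous_bAvg hf.continuous) hf.continuous, Pi.sub_apply, abs_le] at h1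
  unfold bAvg2
  rw [abs_le]; constructor <;> linarith

/-- The constant in the estimate of the initial errors. -/
def initConst (ε M K : ℝ) : ℝ := 12 * M + 24 * chemBound ε M + 96 * ε ^ 2 * M + 4 * K

/-- The error at the fictitious time level `-1`. The starting step is only second order accurate in
space, but it is multiplied by the time step. -/
theorem SmoothEvolution.abs_ghost_error_le {L ε T M K : ℝ} {U V : ℝ → (ℝ × ℝ →ᵇ ℝ)}
    (ev : SmoothEvolution L ε T M K U V) (hT : 0 < T) {h τ : ℝ} (hh : h ≠ 0) (hK : 0 ≤ K)
    (hτ : 0 < τ) (hτ1 : τ ≤ 1) {φm : GridFun}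
    (hφ : ∀ i j, φm i j
      = sample h (U 0) i j - τ * lapH4 h (muInit h ε (sample h (U 0))) i j) (i j : ℤ) :
    |(avgSol h τ U (-1) - φm) i j| ≤ initConst ε M K * (τ ^ 2 + h ^ 4) := by
  have h0T : (0 : ℝ) ∈ Icc 0 T := ⟨le_rfl, hT.le⟩
  have hB := ev.bddDiff 0 h0T
  have hμ := hB.chemPot (ε := ε)
  have hV := ev.deriv_eq 0 h0T
  have hM := hB.nonneg
  have hcb := hμ.nonneg
  set f := U 0 with hf
  set μ := chemPot ε f with hμdef
  set R : ℝ × ℝ →ᵇ ℝ := U (-τ) - f + τ • V 0 with hR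
  have hRp : ∀ p, |R p| ≤ K * τ ^ 2 := fun p =>
    (R.norm_coe_le_norm p).trans (ev.ghost τ hτ.le hτ1)
  set p : ℝ × ℝ := (((i : ℝ) - 1 / 2) * h, ((j : ℝ) - 1 / 2) * h) with hp
  have cl := hμ.lap.continuous
  have eU : ⇑(U (-τ)) = ⇑f - τ • lap μ + ⇑R := by
    rw [← hV]; ext p; simp [hR]
  have eA := congrFun (congrArg (bAvg2 h) eU) p
  rw [bAvg2_add (f.continuous.sub (cl.const_smul _)) R.continuous,
    bAvg2_sub f.continuous (cl.const_smul _), bAvg2_smul] at eA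
  simp only [Pi.add_apply, Pi.sub_apply, Pi.smul_apply, smul_eq_mul] at eA
  have eI : muInit h ε (sample h f) = sample h (⇑f ^ 3 - ⇑f - ε ^ 2 • planeLap4 h f) := by
    ext i j; simp only [muInit, ← sample_planeLap4]; rfl
  have eφ : φm i j = f p - τ * planeLap4 h (⇑f ^ 3 - ⇑f - ε ^ 2 • planeLap4 h f) p := by
    rw [hφ, eI, ← sample_planeLap4]; rfl
  have eψ : avgSol h τ U (-1) i j = bAvg2 h (U (-τ)) p := by
    simp only [avgSol, Int.cast_neg, Int.cast_one, neg_one_mul]; rfl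
  have b1 := (hB.of_le (k := 4) (by norm_num)).abs_bAvg2_sub_le (h := h) p
  have b2 := (hμ.lap).abs_bAvg2_sub_le_sq (h := h) p
  have b3 := hB.abs_planeLap4_chem_sub_le (ε := ε) hh p
  have b4 := abs_bAvg2_le (h := h) hRp p
  have e : avgSol h τ U (-1) i j - φm i j = (bAvg2 h f p - f p)
      - τ * ((bAvg2 h (lap μ) p - lap μ p)
        - (planeLap4 h (⇑f ^ 3 - ⇑f - ε ^ 2 • planeLap4 h f) p - lap μ p)) + bAvg2 h R p := by
    rw [eψ, eφ, eA]; ring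
  have b5 : |τ * ((bAvg2 h (lap μ) p - lap μ p)
        - (planeLap4 h (⇑f ^ 3 - ⇑f - ε ^ 2 • planeLap4 h f) p - lap μ p))|
      ≤ τ * (9 * (2 * chemBound ε M * h ^ 2)
        + (6 * chemBound ε M + 96 * ε ^ 2 * M) * h ^ 2) := by
    rw [abs_mul, abs_of_pos hτ]
    refine mul_le_mul_of_nonneg_left ((abs_sub _ _).trans (add_le_add b2 b3)) hτ.le
  have b6 : τ * (9 * (2 * chemBound ε M * h ^ 2)
        + (6 * chemBound ε M + 96 * ε ^ 2 * M) * h ^ 2)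
      ≤ (24 * chemBound ε M + 96 * ε ^ 2 * M) * (τ ^ 2 + h ^ 4) := by
    have : τ * h ^ 2 ≤ τ ^ 2 + h ^ 4 := by
      nlinarith [sq_nonneg (τ - h ^ 2), sq_nonneg τ, sq_nonneg (h ^ 2)]
    calc _ = (24 * chemBound ε M + 96 * ε ^ 2 * M) * (τ * h ^ 2) := by ring
      _ ≤ _ := mul_le_mul_of_nonneg_left this (by positivity)
  have n1 : 0 ≤ M * τ ^ 2 := by positivity
  have n2 : 0 ≤ K * h ^ 4 := by positivity
  rw [Pi.sub_apply, Pi.sub_apply, e]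
  unfold initConst
  rw [abs_le] at b1 b4 b5 ⊢
  constructor <;> linarith

/-- The averages change the solution and its discrete Laplacian only to fourth order. -/
theorem BddDiff.abs_planeLap4_bAvg2_sub_le {h M : ℝ} (hh : h ≠ 0) {f : ℝ × ℝ → ℝ}
    (hf : BddDiff 6 M f) (p : ℝ × ℝ) :
    |planeLap4 h (bAvg2 h f) p - planeLap4 h f p| ≤ 64 * (M * h ^ 4) := by
  have h1 := abs_le.1 (hf.abs_planeLap4_bAvg2_sub_lap_le hh p)
  have h2 := abs_le.1 (hf.abs_planeLap4_sub_lap_le hh p)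
  rw [abs_le]; constructor <;> linarith

/-! ### The error estimate -/

/-- The factor of the time step in the growth rate of the error energy. -/
def growthConst (ε M : ℝ) : ℝ := 16 / ε ^ 2 + 1600 * (1 + (4 * M) ^ 2) * (4 * M) ^ 2 + 4

/-- The energy inequality for the error `e` between the averaged exact solution and the numerical
solution. -/
theorem SmoothEvolution.error_step {L ε T M K : ℝ} {U V : ℝ → (ℝ × ℝ →ᵇ ℝ)}
    (ev : SmoothEvolution L ε T M K U V) (hL : 0 < L) (hε : 0 < ε) (hK : 0 ≤ K) {A h τ : ℝ}
    {m : ℕ} (hm : 0 < m) (hh : h = L / m) (hτ : 0 < τ) (hτ1 : τ ≤ 1)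
    (hτA : |A| * τ ≤ ε ^ 2 / 16) {Φ₀ : ℝ × ℝ → ℝ} {n : ℕ} (hn : n * τ ≤ T) {φ : ℤ → GridFun}
    (hφ : IsNumericalSolution m h ε A τ Φ₀ n φ) {e : ℤ → GridFun}
    (he : e = fun k => avgSol h τ U k - φ k) {k : ℕ} (hk : k < n) {b : ℝ}
    (hb : ‖(3 / 2 : ℝ) • U ((k + 1) * τ) - (2 : ℝ) • U (k * τ)
        + (1 / 2 : ℝ) • U ((k - 1) * τ) - τ • V ((k + 1) * τ)‖ ≤ b) :
    bdfEnergy m (e (k + 1)) (e k) + ε ^ 2 / 2 * (τ * gsum m (lapH4 h (e (k + 1)) ^ 2))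
      ≤ bdfEnergy m (e k) (e (k - 1)) + ε ^ 2 / 32 * (τ * gsum m (lapH4 h (e k) ^ 2))
        + growthConst ε M * τ * (bdfEnergy m (e (k + 1)) (e k) + bdfEnergy m (e k) (e (k - 1)))
        + (4 / ε ^ 2 * τ * (3 * (m ^ 2 * (resConst ε A M K * (τ ^ 2 + h ^ 4)) ^ 2))
          + 1 / (4 * τ) * (m ^ 2 * (4 * b) ^ 2)) := by
  have hm' : (0 : ℝ) < m := by exact_mod_cast hm
  have hhp : 0 < h := by rw [hh]; positivity
  have hkn : ((k : ℝ) + 1) * τ ≤ T := by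
    refine le_trans ?_ hn
    have : (k : ℝ) + 1 ≤ n := by exact_mod_cast hk
    gcongr
  have hkn' : (k : ℝ) * τ ≤ T := by nlinarith
  have hkm' : ((k : ℝ) - 1) * τ ≤ T := by nlinarith
  obtain ⟨ρ, ρx, ρy, R, pρ, px, py, hres, bρ, bx, by', bR⟩ :=
    ev.exists_residual hm hh hL hK hτ hτ1 A hkn hb
  have hkI : (k : ℤ) < n := by exact_mod_cast hk
  have hk0 : (0 : ℤ) ≤ k := Int.natCast_nonneg k
  have pψ : ∀ j : ℤ, (j : ℝ) * τ ≤ T → GridPeriodic m (avgSol h τ U j) := fun j hj =>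
    gridPeriodic_sample hm hh (periodicFun_bAvg2 (ev.periodic _ hj))
  have hB := ev.bddDiff ((k + 1) * τ) ⟨by positivity, hkn⟩
  have a1 : avgSol h τ U (k + 1) = sample h (bAvg2 h (U ((k + 1) * τ))) := by
    simp only [avgSol]; push_cast; rfl
  have hφs : (3 / 2 : ℝ) • φ (k + 1) - (2 : ℝ) • φ k + (1 / 2 : ℝ) • φ (k - 1)
      = τ • lapH4 h (muStep h ε A τ (φ (k + 1)) (φ k) (φ (k - 1))) := by
    ext i j
    have := hφ.step k hk0 hkI i j
    rw [div_eq_iff hτ.ne'] at this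
    simp only [Pi.add_apply, Pi.sub_apply, Pi.smul_apply, smul_eq_mul]
    linarith
  have hst := bdfEnergy_step hhp hε hτ hτA (pψ (k + 1) (by push_cast; exact hkn))
    (pψ k (by push_cast; exact hkn')) (pψ (k - 1) (by push_cast; exact hkm'))
    (hφ.periodic (k + 1) (by omega) (by omega)) (hφ.periodic k (by omega) (by omega))
    (hφ.periodic (k - 1) (by omega) (by omega)) pρ px py (B := 4 * M) (K := 4 * M)
    (fun i j => by rw [a1]; exact abs_bAvg2_le hB.bound _)
    (fun i j => by
      have := (hB.of_le (k := 1) (by norm_num)).abs_trP_bAvg2_sub_le hhp.le (.inl rfl)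
        (((i : ℝ) - 1 / 2) * h, ((j : ℝ) - 1 / 2) * h)
      have e1 := congrFun (congrFun (sample_trP h 1 0 (bAvg2 h (U ((k + 1) * τ)))) i) j
      rw [a1, ← e1]
      simpa [sample] using this)
    (fun i j => by
      have := (hB.of_le (k := 1) (by norm_num)).abs_trP_bAvg2_sub_le hhp.le (.inr rfl)
        (((i : ℝ) - 1 / 2) * h, ((j : ℝ) - 1 / 2) * h)
      have e1 := congrFun (congrFun (sample_trP h 0 1 (bAvg2 h (U ((k + 1) * τ)))) i) j
      rw [a1, ← e1]
      simpa [sample] using this)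
    hφs hres
  have c1 := gsum_sq_le_of_abs_le (m := m) bρ
  have c2 := gsum_sq_le_of_abs_le (m := m) bx
  have c3 := gsum_sq_le_of_abs_le (m := m) by'
  have c4 := gsum_sq_le_of_abs_le (m := m) bR
  subst he
  refine hst.trans (add_le_add le_rfl (add_le_add ?_ ?_))
  · exact mul_le_mul_of_nonneg_left (by linarith only [c1, c2, c3]) (by positivity)
  · exact mul_le_mul_of_nonneg_left c4 (by positivity)

/-- The energy of the initial errors at the time levels `0` and `-1`. -/
theorem SmoothEvolution.initial_error {L ε T M K : ℝ} {U V : ℝ → (ℝ × ℝ →ᵇ ℝ)}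
    (ev : SmoothEvolution L ε T M K U V) (hT : 0 < T) (hK : 0 ≤ K) {A h τ : ℝ}
    {m : ℕ} (hh : 0 < h) (hτ : 0 < τ) (hτ1 : τ ≤ 1) {n : ℕ} {φ : ℤ → GridFun}
    (hφ : IsNumericalSolution m h ε A τ (U 0) n φ) {e : ℤ → GridFun}
    (he : e = fun k => avgSol h τ U k - φ k) :
    bdfEnergy m (e 0) (e (-1)) + ε ^ 2 / 32 * (τ * gsum m (lapH4 h (e 0) ^ 2))
      ≤ m ^ 2 * (τ ^ 2 + h ^ 4) ^ 2 * (5 / 2 * initConst ε M K ^ 2 + 128 * ε ^ 2 * M ^ 2) := by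
  have h0T : (0 : ℝ) ∈ Icc 0 T := ⟨le_rfl, hT.le⟩
  have hB0 := ev.bddDiff 0 h0T
  have hM := hB0.nonneg
  have hcb : 0 ≤ chemBound ε M := (hB0.chemPot (ε := ε)).nonneg
  set δ := τ ^ 2 + h ^ 4 with hδ
  have hδ0 : 0 ≤ δ := by positivity
  have hδh : h ^ 4 ≤ δ := by rw [hδ]; linarith [sq_nonneg τ]
  set Ci := initConst ε M K with hCi
  have hCi0 : 12 * M ≤ Ci := by
    rw [hCi]; unfold initConst
    have : 0 ≤ ε ^ 2 * M := by positivity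
    linarith
  have hCi1 : 0 ≤ Ci := by linarith
  have e0 : e 0 = sample h (bAvg2 h (U 0) - U 0) := by
    simp only [he, hφ.initial, avgSol, Int.cast_zero, zero_mul]; rfl
  have b0 : ∀ i j, |e 0 i j| ≤ Ci * δ := fun i j => by
    rw [e0]
    refine ((hB0.of_le (k := 4) (by norm_num)).abs_bAvg2_sub_le (h := h) _).trans ?_
    rw [← mul_assoc]
    gcongr
  have bm : ∀ i j, |e (-1) i j| ≤ Ci * δ := fun i j => by
    rw [he]
    exact ev.abs_ghost_error_le hT hh.ne' hK hτ hτ1 (fun i j => by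
      rw [hφ.ghost, hφ.initial]) i j
  have b2 : ∀ i j, |((2 : ℝ) • e 0 - e (-1)) i j| ≤ 3 * (Ci * δ) := fun i j => by
    have h1 := abs_le.1 (b0 i j)
    have h2 := abs_le.1 (bm i j)
    simp only [Pi.sub_apply, Pi.smul_apply, smul_eq_mul]
    rw [abs_le]; constructor <;> linarith
  have bY : ∀ i j, |lapH4 h (e 0) i j| ≤ 64 * M * δ := fun i j => by
    rw [e0, ← sample_planeLap4, planeLap4_sub]
    refine (hB0.abs_planeLap4_bAvg2_sub_le hh.ne' _).trans ?_
    rw [← mul_assoc]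
    gcongr
  have g0 := gsum_sq_le_of_abs_le (m := m) b0
  have g2 := gsum_sq_le_of_abs_le (m := m) b2
  have gY := gsum_sq_le_of_abs_le (m := m) bY
  have gY0 := gsum_sq_nonneg m (lapH4 h (e 0))
  have gY' : ε ^ 2 / 32 * (τ * gsum m (lapH4 h (e 0) ^ 2))
      ≤ ε ^ 2 / 32 * (1 * (m ^ 2 * (64 * M * δ) ^ 2)) := by
    gcongr
  simp only [bdfEnergy]
  linarith

/-- The discrete Gronwall inequality for an energy with dissipation. Part of the dissipation of the
previous step on the right is absorbed by including it into the energy. -/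
theorem gronwall_dissipation {E Y s : ℕ → ℝ} {c κ : ℝ} (hc : 0 ≤ c) (hc2 : c ≤ 1 / 2)
    (hκ : 0 ≤ κ) (hE : ∀ k, 0 ≤ E k) (hY : ∀ k, 0 ≤ Y k) (hs : ∀ k, 0 ≤ s k) {n : ℕ}
    (h : ∀ k < n, E (k + 1) + κ / 2 * Y (k + 1)
      ≤ E k + κ / 32 * Y k + c * (E (k + 1) + E k) + s k) :
    E n + κ / 4 * ∑ j ∈ Finset.range n, Y (j + 1)
      ≤ Real.exp (4 * c * n) * (E 0 + κ / 32 * Y 0 + 2 * ∑ j ∈ Finset.range n, s j) := by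
  set a : ℕ → ℝ := fun k => E k + κ / 32 * Y k + κ / 4 * ∑ j ∈ Finset.range k, Y (j + 1) with ha
  have hEa : ∀ k, E k ≤ a k := fun k => by
    have := hY k
    have := Finset.sum_nonneg (s := Finset.range k) fun j _ => hY (j + 1)
    have h1 : 0 ≤ κ / 32 * Y k := by positivity
    have h2 : 0 ≤ κ / 4 * ∑ j ∈ Finset.range k, Y (j + 1) := by positivity
    simp only [ha]; linarith
  have hG := discrete_gronwall hc hc2 n (fun k => (hE k).trans (hEa k)) hs (fun k hk => by
    have h1 := h k hk
    have h2 := mul_le_mul_of_nonneg_left (add_le_add (hEa (k + 1)) (hEa k)) hc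
    have h3 : 0 ≤ κ * Y (k + 1) := mul_nonneg hκ (hY _)
    have e1 : a (k + 1) = E (k + 1) + κ / 32 * Y (k + 1)
        + (κ / 4 * ∑ j ∈ Finset.range k, Y (j + 1) + κ / 4 * Y (k + 1)) := by
      simp only [ha, Finset.sum_range_succ, mul_add]
    have e2 : a k = E k + κ / 32 * Y k + κ / 4 * ∑ j ∈ Finset.range k, Y (j + 1) := rfl
    linarith) n le_rfl
  have e0 : a 0 = E 0 + κ / 32 * Y 0 := by simp [ha]
  have h4 : 0 ≤ κ / 32 * Y n := mul_nonneg (by positivity) (hY n)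
  rw [e0] at hG
  refine le_trans ?_ hG
  simp only [ha]; linarith

/-- The error between the averaged exact solution and the numerical solution is of the optimal
order. -/
theorem SmoothEvolution.exists_error_bound {L ε T M K : ℝ} {U V : ℝ → (ℝ × ℝ →ᵇ ℝ)}
    (ev : SmoothEvolution L ε T M K U V) (hL : 0 < L) (hε : 0 < ε) (hT : 0 < T) (hK : 0 ≤ K)
    (A : ℝ) :
    ∃ D ≥ 0, ∃ Δt₀ > 0, ∀ τ : ℝ, 0 < τ → τ ≤ Δt₀ → ∀ (m : ℕ) (h : ℝ), 0 < m → h = L / m →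
      ∀ n : ℕ, n * τ ≤ T → ∀ φ : ℤ → GridFun, IsNumericalSolution m h ε A τ (U 0) n φ →
        gsum m ((avgSol h τ U n - φ n) ^ 2) ≤ D * (m ^ 2 * (τ ^ 2 + h ^ 4) ^ 2) ∧
        ε ^ 2 * τ * ∑ k ∈ Finset.range n,
            gsum m (lapH4 h (avgSol h τ U (k + 1) - φ (k + 1)) ^ 2)
          ≤ D * (m ^ 2 * (τ ^ 2 + h ^ 4) ^ 2) := by
  set C0 := growthConst ε M with hC0
  have hC0p : 0 < C0 := by rw [hC0, growthConst]; positivity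
  set Cr := resConst ε A M K
  set Ci := initConst ε M K with hCi
  set D0 := Real.exp (4 * C0 * T) * (5 / 2 * Ci ^ 2 + 128 * ε ^ 2 * M ^ 2
    + 2 * (12 * T * Cr ^ 2 / ε ^ 2 + 4 * K)) with hD0
  -- the last two bounds on the time step absorb the stabilization term into the surface diffusion
  -- and make the implicit terms in the Gronwall inequality at most one half
  refine ⟨4 * D0, by positivity, min 1 (min (ε ^ 2 / 16 / (|A| + 1)) (1 / (2 * C0))),
    by positivity, ?_⟩
  intro τ hτ hτ0 m h hm hh n hn φ hφ
  have hτ1 : τ ≤ 1 := hτ0.trans (min_le_left _ _)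
  have hτA : |A| * τ ≤ ε ^ 2 / 16 := by
    have h1 : τ ≤ ε ^ 2 / 16 / (|A| + 1) := hτ0.trans ((min_le_right _ _).trans (min_le_left _ _))
    rw [le_div_iff₀ (by positivity)] at h1
    linarith
  have hτC : C0 * τ ≤ 1 / 2 := by
    have h1 : τ ≤ 1 / (2 * C0) := hτ0.trans ((min_le_right _ _).trans (min_le_right _ _))
    rw [le_div_iff₀ (by positivity)] at h1
    linarith
  have hm' : (0 : ℝ) < m := by exact_mod_cast hm
  have hhp : 0 < h := by rw [hh]; positivity
  obtain ⟨r, hr, hrs⟩ := ev.truncation τ hτ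
  obtain ⟨e, he⟩ : ∃ e : ℤ → GridFun, e = fun k => avgSol h τ U k - φ k := ⟨_, rfl⟩
  have hinit := ev.initial_error hT hK hhp hτ hτ1 hφ he
  have hG := gronwall_dissipation (E := fun k : ℕ => bdfEnergy m (e k) (e (k - 1)))
    (Y := fun k : ℕ => gsum m (lapH4 h (e k) ^ 2)) (c := C0 * τ) (κ := ε ^ 2 * τ)
    (s := fun k => 4 / ε ^ 2 * τ * (3 * (m ^ 2 * (Cr * (τ ^ 2 + h ^ 4)) ^ 2))
      + 1 / (4 * τ) * (m ^ 2 * (4 * r k) ^ 2)) (by positivity) hτC (by positivity)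
    (fun k => bdfEnergy_nonneg _ _ _) (fun k => gsum_sq_nonneg _ _) (fun k => by positivity)
    (n := n) (fun k hk => by
      have := ev.error_step hL hε hK hm hh hτ hτ1 hτA hn hφ he hk (hr k)
      push_cast
      rw [add_sub_cancel_right]
      linarith only [this])
  simp only [Nat.cast_zero, zero_sub, Nat.cast_add, Nat.cast_one] at hG
  set δ := τ ^ 2 + h ^ 4 with hδ
  have hsum : ∑ j ∈ Finset.range n, (4 / ε ^ 2 * τ * (3 * (m ^ 2 * (Cr * δ) ^ 2))
      + 1 / (4 * τ) * (m ^ 2 * (4 * r j) ^ 2))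
      ≤ m ^ 2 * δ ^ 2 * (12 * T * Cr ^ 2 / ε ^ 2 + 4 * K) := by
    rw [Finset.sum_add_distrib, Finset.sum_const, Finset.card_range, nsmul_eq_mul,
      ← Finset.mul_sum, ← Finset.mul_sum]
    have e1 : ∑ j ∈ Finset.range n, (4 * r j) ^ 2 ≤ 16 * (K * τ ^ 5) := by
      simp only [mul_pow]
      rw [← Finset.mul_sum]
      have := hrs n
      linarith
    have e2 : 1 / (4 * τ) * (m ^ 2 * ∑ j ∈ Finset.range n, (4 * r j) ^ 2)
        ≤ m ^ 2 * δ ^ 2 * (4 * K) := by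
      calc _ ≤ 1 / (4 * τ) * (m ^ 2 * (16 * (K * τ ^ 5))) := by gcongr
        _ = m ^ 2 * (τ ^ 2) ^ 2 * (4 * K) := by field_simp; ring
        _ ≤ _ := by
          gcongr
          rw [hδ]; linarith [pow_pos hhp 4]
    have e3 : (n : ℝ) * (4 / ε ^ 2 * τ * (3 * (m ^ 2 * (Cr * δ) ^ 2)))
        ≤ m ^ 2 * δ ^ 2 * (12 * T * Cr ^ 2 / ε ^ 2) := by
      calc _ = n * τ * (m ^ 2 * δ ^ 2 * (12 * Cr ^ 2 / ε ^ 2)) := by ring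
        _ ≤ T * (m ^ 2 * δ ^ 2 * (12 * Cr ^ 2 / ε ^ 2)) := by gcongr
        _ = _ := by ring
    linarith
  have hexp : Real.exp (4 * (C0 * τ) * n) ≤ Real.exp (4 * C0 * T) := by
    refine Real.exp_le_exp.2 ?_
    calc 4 * (C0 * τ) * n = 4 * C0 * (n * τ) := by ring
      _ ≤ 4 * C0 * T := by gcongr
  have hfin : bdfEnergy m (e n) (e (n - 1))
      + ε ^ 2 * τ / 4 * ∑ j ∈ Finset.range n, gsum m (lapH4 h (e (j + 1)) ^ 2)
      ≤ D0 * (m ^ 2 * δ ^ 2) := by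
    refine hG.trans ((mul_le_mul_of_nonneg_left (b := _)
      (c := m ^ 2 * δ ^ 2 * (5 / 2 * Ci ^ 2 + 128 * ε ^ 2 * M ^ 2
        + 2 * (12 * T * Cr ^ 2 / ε ^ 2 + 4 * K))) ?_ (Real.exp_pos _).le).trans
      ((mul_le_mul_of_nonneg_right hexp (by positivity)).trans (le_of_eq ?_)))
    · linarith only [hinit, hsum]
    · rw [hD0]; ring
  have hS : 0 ≤ ε ^ 2 * τ / 4 * ∑ j ∈ Finset.range n, gsum m (lapH4 h (e (j + 1)) ^ 2) :=
    mul_nonneg (by positivity) (Finset.sum_nonneg fun j _ => gsum_sq_nonneg _ _)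
  have h1 := bdfEnergy_nonneg m (e n) (e (n - 1))
  have h3 : gsum m (e n ^ 2) ≤ 4 * bdfEnergy m (e n) (e (n - 1)) := by
    have h2 := gsum_sq_nonneg m ((2 : ℝ) • e n - e (n - 1))
    simp only [bdfEnergy]; linarith only [h2]
  subst he
  constructor <;> linarith only [h1, h3, hS, hfin]

theorem sq_gridNorm (m : ℕ) (h : ℝ) (ν : GridFun) : gridNorm m h ν ^ 2 = h ^ 2 * gsum m (ν ^ 2) :=
  Real.sq_sqrt (mul_nonneg (sq_nonneg h) (gsum_sq_nonneg m ν))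

theorem gridNorm_le_of_gsum_le {m : ℕ} {h L b : ℝ} (hmL : m * h = L) {ν : GridFun}
    (hν : gsum m (ν ^ 2) ≤ b * m ^ 2) : gridNorm m h ν ^ 2 ≤ L ^ 2 * b := by
  rw [sq_gridNorm, ← hmL]
  calc h ^ 2 * gsum m (ν ^ 2) ≤ h ^ 2 * (b * m ^ 2) := by gcongr
    _ = (m * h) ^ 2 * b := by ring

theorem sum_Icc_one_eq_sum_range (f : ℕ → ℝ) (n : ℕ) :
    ∑ k ∈ Finset.Icc 1 n, f k = ∑ k ∈ Finset.range n, f (k + 1) := by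
  induction n with
  | zero => simp
  | succ n ih => rw [Finset.sum_Icc_succ_top (by omega), ih, Finset.sum_range_succ]

end CahnHilliard

end

theorem theorem3p6 (L ε A T : ℝ) (hL : 0 < L) (hε : 0 < ε) (hT : 0 < T)
    (Φ₀ : ℝ × ℝ → ℝ) (hΦ₀ : ∃ u : CahnHilliard.Hper L 8, CahnHilliard.Represents u Φ₀)
    (Φ : ℝ → (ℝ × ℝ →ᵇ ℝ))
    (hsol : CahnHilliard.IsExactSolution L ε T Φ₀ Φ)
    (hreg : CahnHilliard.RegularityClass L T Φ) :
    ∃ C > 0, ∃ Δt₀ > 0, ∃ h₀ > 0,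
      ∀ Δt : ℝ, 0 < Δt → Δt ≤ Δt₀ →
      ∀ (m : ℕ) (h : ℝ), 0 < m → h = L / m → h ≤ h₀ →
      ∀ n : ℕ, 0 < n → n * Δt ≤ T →
      ∀ φ : ℤ → CahnHilliard.GridFun,
        CahnHilliard.IsNumericalSolution m h ε A Δt Φ₀ n φ →
        CahnHilliard.gridNorm m h (CahnHilliard.sample h (Φ (n * Δt)) - φ n)
          + Real.sqrt (ε ^ 2 * Δt * ∑ k ∈ Finset.Icc 1 n,
              CahnHilliard.gridNorm m h (CahnHilliard.lapH h
                (CahnHilliard.sample h (Φ (k * Δt)) - φ k)) ^ 2)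
          ≤ C * (Δt ^ 2 + h ^ 4) := by
  open CahnHilliard in
  obtain ⟨M, K, U, V, ev, hUΦ⟩ := exists_smoothEvolution hL hT hsol hreg
  have h0T : (0 : ℝ) ∈ Icc 0 T := ⟨le_rfl, hT.le⟩
  have hK : 0 ≤ K := by
    have := (norm_nonneg _).trans (ev.ghost 1 zero_le_one le_rfl)
    linarith
  have hM := (ev.bddDiff 0 h0T).nonneg
  have hU0 : Φ₀ = U 0 := by
    ext p; rw [hUΦ 0 h0T, hsol.initial]
  obtain ⟨D, hD, Δt₀, hΔt₀, hmain⟩ := ev.exists_error_bound hL hε hT hK A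
  set C1 := L ^ 2 * (288 * M ^ 2 + 2 * D) with hC1
  set C2 := L ^ 2 * (16384 * ε ^ 2 * T * M ^ 2 + 4 * D) with hC2
  have hC10 : 0 ≤ C1 := by positivity
  have hC20 : 0 ≤ C2 := by positivity
  refine ⟨√C1 + √C2 + 1, by positivity, Δt₀, hΔt₀, 1, one_pos, ?_⟩
  intro τ hτ hττ m h hm hh _ n _ hn φ hφ
  rw [hU0] at hφ
  obtain ⟨m1, m2⟩ := hmain τ hτ hττ m h hm hh n hn φ hφ
  have hm' : (0 : ℝ) < m := by exact_mod_cast hm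
  have hhp : 0 < h := by rw [hh]; positivity
  have hmL : m * h = L := by rw [hh]; field_simp
  set δ := τ ^ 2 + h ^ 4 with hδ
  have hδ0 : 0 ≤ δ := by positivity
  have hδh : h ^ 4 ≤ δ := by rw [hδ]; linarith [sq_nonneg τ]
  have htk : ∀ k : ℕ, k ≤ n → (k : ℝ) * τ ∈ Icc 0 T := fun k hk => by
    have : (k : ℝ) ≤ n := by exact_mod_cast hk
    exact ⟨by positivity, le_trans (by gcongr) hn⟩
  set u : ℕ → GridFun := fun k => sample h (Φ (k * τ)) - avgSol h τ U k with hu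
  have hue : ∀ k ≤ n, u k = sample h (⇑(U (k * τ)) - bAvg2 h (U (k * τ))) := fun k hk => by
    simp only [hu, ← hUΦ _ (htk k hk), avgSol, Int.cast_natCast]; rfl
  have hub : ∀ k ≤ n, gsum m (u k ^ 2) ≤ m ^ 2 * (12 * M * δ) ^ 2 := fun k hk =>
    gsum_sq_le_of_abs_le fun i j => by
      rw [hue k hk]
      have := ((ev.bddDiff _ (htk k hk)).of_le (k := 4) (by norm_num)).abs_bAvg2_sub_le (h := h)
        (((i : ℝ) - 1 / 2) * h, ((j : ℝ) - 1 / 2) * h)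
      rw [abs_sub_comm] at this
      refine le_trans this ?_
      rw [← mul_assoc]
      gcongr
  have hul : ∀ k ≤ n, gsum m (lapH4 h (u k) ^ 2) ≤ m ^ 2 * (64 * M * δ) ^ 2 := fun k hk =>
    gsum_sq_le_of_abs_le fun i j => by
      rw [hue k hk, ← sample_planeLap4, planeLap4_sub]
      have := (ev.bddDiff _ (htk k hk)).abs_planeLap4_bAvg2_sub_le hhp.ne'
        (((i : ℝ) - 1 / 2) * h, ((j : ℝ) - 1 / 2) * h)
      rw [abs_sub_comm] at this
      refine le_trans this ?_
      rw [← mul_assoc]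
      gcongr
  have hsplit : ∀ k : ℕ, sample h (Φ (k * τ)) - φ k = u k + (avgSol h τ U k - φ k) := fun k => by
    simp only [hu]; abel
  have first : gridNorm m h (sample h (Φ (n * τ)) - φ n) ≤ √C1 * δ := by
    refine abs_le_of_sq_le_sq' ?_ (by positivity) |>.2
    rw [mul_pow, Real.sq_sqrt hC10, hC1, mul_assoc]
    refine gridNorm_le_of_gsum_le hmL ?_
    rw [hsplit]
    refine (gsum_add_sq_le m _ _).trans ?_
    have := hub n le_rfl
    linarith
  have second : √(ε ^ 2 * τ * ∑ k ∈ Finset.Icc 1 n,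
      gridNorm m h (lapH h (sample h (Φ (k * τ)) - φ k)) ^ 2) ≤ √C2 * δ := by
    refine Real.sqrt_le_iff.2 ⟨by positivity, ?_⟩
    rw [mul_pow, Real.sq_sqrt hC20]
    have hk : ∀ k ∈ Finset.Icc 1 n, gridNorm m h (lapH h (sample h (Φ (k * τ)) - φ k)) ^ 2
        ≤ 4 * L ^ 2 * (64 * M * δ) ^ 2
          + 4 * h ^ 2 * gsum m (lapH4 h (avgSol h τ U k - φ k) ^ 2) := fun k hk => by
      have hkn := (Finset.mem_Icc.1 hk).2
      have pk : GridPeriodic m (sample h (Φ (k * τ)) - φ k) :=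
        (gridPeriodic_sample hm hh (hsol.periodic _ (htk k hkn))).sub
          (hφ.periodic k (by omega) (by exact_mod_cast hkn))
      rw [sq_gridNorm]
      have h1 := gsum_lapH_sq_le pk hhp.ne'
      rw [hsplit, lapH4_add] at h1
      rw [hsplit]
      have h2 := gsum_add_sq_le m (lapH4 h (u k)) (lapH4 h (avgSol h τ U k - φ k))
      have h3 := hul k hkn
      calc _ ≤ h ^ 2 * (4 * (m ^ 2 * (64 * M * δ) ^ 2)
            + 4 * gsum m (lapH4 h (avgSol h τ U k - φ k) ^ 2)) := by
            refine mul_le_mul_of_nonneg_left ?_ (sq_nonneg h)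
            linarith
        _ = _ := by rw [← hmL]; ring
    have hsum := mul_le_mul_of_nonneg_left (Finset.sum_le_sum hk)
      (by positivity : 0 ≤ ε ^ 2 * τ)
    refine hsum.trans ?_
    rw [Finset.sum_add_distrib, Finset.sum_const, Nat.card_Icc, add_tsub_cancel_right,
      nsmul_eq_mul, ← Finset.mul_sum, sum_Icc_one_eq_sum_range]
    push_cast
    have h4 := mul_le_mul_of_nonneg_left m2 (by positivity : 0 ≤ 4 * h ^ 2)
    have h5 : ε ^ 2 * (n * τ) * (4 * L ^ 2 * (64 * M * δ) ^ 2)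
        ≤ ε ^ 2 * T * (4 * L ^ 2 * (64 * M * δ) ^ 2) := by gcongr
    have e5 : C2 * δ ^ 2 = ε ^ 2 * T * (4 * L ^ 2 * (64 * M * δ) ^ 2)
        + 4 * h ^ 2 * (D * (m ^ 2 * δ ^ 2)) := by
      rw [hC2, ← hmL]; ring
    linarith
  calc _ ≤ √C1 * δ + √C2 * δ := add_le_add first second
    _ ≤ (√C1 + √C2 + 1) * δ := by linarith
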